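/- **Setting.** Let $V$ be a non-empty finite set and $\Sigma$ the finite monoid of all maps $V\to V$ under composition, acting componentwise on $V^m$ and on laws on $V^m$ (for laws $\kappa$ on $\Sigma$ and $\Lambda$ on $V^m$, $\kappa\Lambda$ is the law of $f\mathbf x$ with $f\sim\kappa$, $\mathbf x\sim\Lambda$ independent). Products of laws are convolutions, a map is identified with the point mass at it, $\mathcal S(\kappa)$ is the support of $\kappa$, $E(A)$ the set of idempotents in $A$, and $\omega_A$ the uniform law on a finite set $A$. Let $\mu$ be a probability on $\Sigma$, $S$ the semigroup generated by $\mathcal S(\mu)$, $m_\mu=\min\{\#(gV):g\in S\}$, and $W_\mu$ the set of vectors $\mathbf x\in V^{m_\mu}$ with distinct entries such that $f\mathbf x$ has distinct entries for all $f\in S$. Choose: an idempotent subsequential limit $\eta$ of $(\mu^n)_{n\ge 1}$; an idempotent $e\in\mathcal S(\eta)$. Let $p\ge 1$ be least with $\mu^p\eta=\eta$, put $\nu=\frac1p\sum_{k=0}^{p-1}\mu^k\eta$, $L=E(\mathcal S(\eta)e)$, $H=e\mathcal S(\eta)e$, $G=e\mathcal S(\nu)e$; $G$ is a group with unit $e$,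 and powers and inverses of its elements are taken in it. Let $\eta^L,\eta^R$ be the laws of $z^L=ze(eze)^{-1}$ and $z^R=(eze)^{-1}ez$ for $z\sim\eta$. Choose further: $\gamma\in G$ with $\mu^k\eta=\eta^L\gamma^k\omega_H\eta^R$ for $0\le k<p$; and $W\subset eW_\mu$ with $eW_\mu=GW$ such that the product mapping $(f,g,\mathbf w)\mapsto fg\mathbf w$ is injective on $L\times G\times W$. Its inverse on $LGW$ is written $\mathbf x\mapsto(\mathbf x^L,\mathbf x^G,\mathbf x^W)$. Let $C=\{e,\gamma,\dots,\gamma^{p-1}\}$. An *$m$-particle $\mu$-evolution* is a pair $(\mathbf X,N)$ of a $V^m$-valued process $\mathbf X=(\mathbf X_k)_{k\in\mathbb Z}$ and an iid $\Sigma$-valued process $N=(N_k)_{k\in\mathbb Z}$ on a probability space such that, for every $k$, $\mathbf X_k=N_k\mathbf X_{k-1}$ a.s., $N_k$ is independent of $\sigma(\mathbf X_j,N_j:j\le k-1)$, and $N_k\sim\mu$. Write $\mathcal F^{\mathbf X}_k=\sigma(\mathbf X_j:j\le k)$, $\mathcal F^N_k=\sigma(N_j:j\le k)$, $\mathcal F^{\mathbf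 X}_{-\infty}=\bigcap_k\mathcal F^{\mathbf X}_k$; equality and inclusion of $\sigma$-fields "a.s." mean after adjoining null events (to the larger side, in the case of inclusion). **Theorem.** Choices $(\eta,e,\gamma,W)$ as above exist for every $\mu$. For any such choice, let $(\mathbf X,N)$ be any (not necessarily stationary) $m_\mu$-particle $\mu$-evolution whose component processes $X^1,\dots,X^{m_\mu}$ are a.s. distinct, and let $\Lambda_k$ be the law of $\mathbf X_k$. Then for every $k$ the entries of $\mathbf X_k$ are a.s. distinct, $\Lambda_k=\mu\Lambda_{k-1}$, and there are constants $c_0,\dots,c_{p-1}\ge 0$ with $\sum_i c_i=1$ and probabilities $\Lambda^0_W,\dots,\Lambda^{p-1}_W$ on $W$ with $$\Lambda_k=\sum_{i=0}^{p-1}c_i\,\eta^L\gamma^{k+i}\omega_H\Lambda^i_W\qquad(k\in\mathbb Z).\tag{$*$}$$ Moreover, there are a $C$-valued random variable $Y_C$, $H$-valued random variables $U^H_k$ $(k\in\mathbb Z)$ and a $W$-valued random variable $\mathbf Z_W$ such that: 1. (i) $\mathbf X_k\in LGW$ a.s. and $\mathbf X_k^L\sim\eta^L$ for all $k$. 2.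 (ii) $\mathbf X_k^G=(\gamma^kY_C)U^H_k$ a.s. for all $k$, and $U^H_k$ is uniform on $H$. 3. (iii) $\mathbf X_k^W=\mathbf Z_W$ a.s. for all $k$. 4. (iv) With $M^G_j=\mathbf X^G_j(\mathbf X^G_{j-1})^{-1}$ and $M^G_{k,j}=\mathbf X^G_k(\mathbf X^G_j)^{-1}$, for $j\le k$ one has a.s. $M^G_{k,j}=M^G_kM^G_{k-1}\cdots M^G_{j+1}$ (the empty product being $e$) and $\mathbf X_j=\mathbf X^L_j(M^G_{k,j})^{-1}(\gamma^kY_C)U^H_k\mathbf Z_W$. 5. (v) For all $k$, $\mathcal F^{\mathbf X}_k=\mathcal G^N_k\vee\mathcal F^{\mathbf X}_{-\infty}\vee\sigma(U^H_k)$ a.s., where $\mathcal G^N_k:=\sigma(\mathbf X^L_j,M^G_j:j\le k)\subset\mathcal F^N_k$ a.s.; the three $\sigma$-fields $\mathcal F^N_k$, $\mathcal F^{\mathbf X}_{-\infty}$ and $\sigma(U^H_k)$ are independent; and $\mathcal F^{\mathbf X}_{-\infty}=\sigma(Y_C,\mathbf Z_W)$ a.s. 6. For every representation $(*)$, $\mathbb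 P(Y_C=\gamma^i,\ \mathbf Z_W=\mathbf w)=c_i\Lambda^i_W\{\mathbf w\}$ for $i=0,\dots,p-1$ and $\mathbf w\in W$. -/

import Mathlib

open MeasureTheory ProbabilityTheory Filter Topology
open scoped Pointwise ENNReal NNReal

namespace ActionEvolution

/-! ### Probabilities on the finite monoid of self-maps

`Function.End V` is the type `V → V` with composition as multiplication; it acts on `V` by
evaluation, hence componentwise on `Fin m → V`.  All spaces are finite and discrete. -/

instance endMeasurableSpace (V : Type*) : MeasurableSpace (Function.End V) := ⊤

instance endDiscrete (V : Type*) : DiscreteMeasurableSpace (Function.End V) :=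
  ⟨fun _ => MeasurableSpace.measurableSet_top⟩

/-- The support `{z : κ {z} > 0}` of a measure on a discrete space. -/
def supp {α : Type*} [MeasurableSpace α] (κ : Measure α) : Set α := {z | 0 < κ {z}}

/-- The `n`-fold convolution power `μⁿ` (with `μ⁰` the point mass at the identity map). -/
noncomputable def convPow {V : Type*} (μ : Measure (Function.End V)) :
    ℕ → Measure (Function.End V)
  | 0 => Measure.dirac 1
  | n + 1 => μ.mconv (convPow μ n)

/-- The measure `κΛ` on `V^m`: the law of `f x` for independent `f ∼ κ`, `x ∼ Λ`. -/
noncomputable def act {V : Type*} [MeasurableSpace V] {m : ℕ}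
    (κ : Measure (Function.End V)) (Λ : Measure (Fin m → V)) : Measure (Fin m → V) :=
  (κ.prod Λ).map (fun q => q.1 • q.2)

/-- `κ` is a subsequential limit of the sequence `(μⁿ)`. -/
def IsSubseqLimit {V : Type*} (μ κ : Measure (Function.End V)) : Prop :=
  ∃ φ : ℕ → ℕ, StrictMono φ ∧
    ∀ A : Set (Function.End V), Tendsto (fun n => convPow μ (φ n) A) atTop (𝓝 (κ A))

/-- The semigroup generated by the support of `μ`. -/
def semigroupOf {V : Type*} (μ : Measure (Function.End V)) : Subsemigroup (Function.End V) :=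
  Subsemigroup.closure (supp μ)

/-- `m_μ = min {#(gV) : g ∈ S}`. -/
noncomputable def minRank {V : Type*} (μ : Measure (Function.End V)) : ℕ :=
  sInf {n | ∃ g ∈ semigroupOf μ, n = (Set.range (fun v : V => g • v)).ncard}

/-- `W_μ`: vectors of distinct points which stay distinct under every map in `S`
(here for a general number `m` of particles). -/
def deadlocked {V : Type*} (μ : Measure (Function.End V)) (m : ℕ) : Set (Fin m → V) :=
  {x | Function.Injective x ∧ ∀ f ∈ semigroupOf μ, Function.Injective (f • x)}

/-! ### Group operations at an idempotent -/

open Classical in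
/-- The inverse of `g` in the group of units of `e · End(V) · e`, whose unit is `e`
(and `e` if there is no inverse). -/
noncomputable def localInv {V : Type*} (e g : Function.End V) : Function.End V :=
  if h : ∃ x, e * x = x ∧ x * e = x ∧ g * x = e ∧ x * g = e then h.choose else e

/-- The integer powers of `g` in the group of units of `e · End(V) · e`. -/
noncomputable def localPow {V : Type*} (e g : Function.End V) : ℤ → Function.End V
  | Int.ofNat n => e * g ^ n
  | Int.negSucc n => localInv e (g ^ (n + 1))

/-- `z^L = z e (e z e)⁻¹`. -/
noncomputable def leftPart {V : Type*} (e z : Function.End V) : Function.End V :=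
  z * e * localInv e (e * z * e)

/-- `z^R = (e z e)⁻¹ e z`. -/
noncomputable def rightPart {V : Type*} (e z : Function.End V) : Function.End V :=
  localInv e (e * z * e) * (e * z)

/-- The order `p` of the cyclic group `{η, μη, …, μ^{p-1}η}`: the least `p ≥ 1` with
`μ^p η = η`. -/
noncomputable def period {V : Type*} (μ η : Measure (Function.End V)) : ℕ :=
  Function.minimalPeriod (fun κ => μ.mconv κ) η

/-- `ν = p⁻¹ (η + μη + ⋯ + μ^{p-1}η)`. -/
noncomputable def cyclicMean {V : Type*} (μ η : Measure (Function.End V)) :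
    Measure (Function.End V) :=
  (period μ η : ℝ≥0∞)⁻¹ • ∑ k ∈ Finset.range (period μ η), (convPow μ k).mconv η

/-- `L = E(𝒮(η)e)`. -/
def leftIdempotents {V : Type*} (η : Measure (Function.End V)) (e : Function.End V) :
    Set (Function.End V) :=
  {z | z ∈ supp η * {e} ∧ IsIdempotentElem z}

/-- `e 𝒮(κ) e`: this is the group `H` for `κ = η` and the group `G` for `κ = ν`. -/
def groupFactor {V : Type*} (κ : Measure (Function.End V)) (e : Function.End V) :
    Set (Function.End V) :=
  {e} * supp κ * {e}

/-- The choices that the factorization of `m_μ`-particle evolutions depends on: the idempotent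
subsequential limit `η` of `(μⁿ)`, an idempotent `e` of `𝒮(η)`, an element `γ` of `G` with
`μ^k η = η^L γ^k ω_H η^R` for `0 ≤ k < p`, and a set `W` of representatives of the orbits of `G`
in `e W_μ`, for which the product mapping on `L × G × W` is injective. -/
structure Frame {V : Type*} (μ : Measure (Function.End V)) where
  η : Measure (Function.End V)
  isLimit : IsSubseqLimit μ η
  idem : η.mconv η = η
  e : Function.End V
  e_mem : e ∈ supp η
  e_idem : IsIdempotentElem e
  γ : Function.End V
  γ_mem : γ ∈ groupFactor (cyclicMean μ η) e
  γ_spec : ∀ k < period μ η, (convPow μ k).mconv η =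
    (η.map (leftPart e)).mconv ((Measure.dirac (localPow e γ k)).mconv
      ((uniformOn (groupFactor η e)).mconv (η.map (rightPart e))))
  W : Set (Fin (minRank μ) → V)
  W_sub : W ⊆ e • deadlocked μ (minRank μ)
  W_span : e • deadlocked μ (minRank μ) = groupFactor (cyclicMean μ η) e • W
  W_inj : Set.InjOn
    (fun q : Function.End V × Function.End V × (Fin (minRank μ) → V) => (q.1 * q.2.1) • q.2.2)
    (leftIdempotents η e ×ˢ groupFactor (cyclicMean μ η) e ×ˢ W)

namespace Frame

variable {V : Type*} {μ : Measure (Function.End V)}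

/-- `p`. -/
noncomputable def p (F : Frame μ) : ℕ := period μ F.η

/-- `L`. -/
def L (F : Frame μ) : Set (Function.End V) := leftIdempotents F.η F.e

/-- `G`. -/
noncomputable def G (F : Frame μ) : Set (Function.End V) := groupFactor (cyclicMean μ F.η) F.e

/-- `H`. -/
def H (F : Frame μ) : Set (Function.End V) := groupFactor F.η F.e

/-- `γ^k`, taken in the group `G`. -/
noncomputable def γpow (F : Frame μ) (k : ℤ) : Function.End V := localPow F.e F.γ k

/-- `C = {e, γ, …, γ^{p-1}}`. -/
def C (F : Frame μ) : Set (Function.End V) := {c | ∃ i < F.p, c = F.γpow i}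

/-- `η^L`, the law of `z^L` for `z ∼ η`. -/
noncomputable def ηL (F : Frame μ) : Measure (Function.End V) := F.η.map (leftPart F.e)

/-- The inverse of `G`, whose unit is `e`. -/
noncomputable def inv (F : Frame μ) (g : Function.End V) : Function.End V := localInv F.e g

/-- The domain `L × G × W` of the product mapping. -/
def box (F : Frame μ) : Set (Function.End V × Function.End V × (Fin (minRank μ) → V)) :=
  F.L ×ˢ F.G ×ˢ F.W

/-- The product mapping `(f, g, w) ↦ f g w`. -/
def prodMap (_F : Frame μ) (q : Function.End V × Function.End V × (Fin (minRank μ) → V)) :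
    Fin (minRank μ) → V :=
  (q.1 * q.2.1) • q.2.2

variable [Nonempty V]

/-- The inverse `x ↦ (x^L, x^G, x^W)` of the bijection `L × G × W → LGW`
(arbitrary outside `LGW`). -/
noncomputable def coord (F : Frame μ) (x : Fin (minRank μ) → V) :
    Function.End V × Function.End V × (Fin (minRank μ) → V) :=
  Function.invFunOn F.prodMap F.box x

/-- `x^L`. -/
noncomputable def xL (F : Frame μ) (x : Fin (minRank μ) → V) : Function.End V := (F.coord x).1

/-- `x^G`. -/
noncomputable def xG (F : Frame μ) (x : Fin (minRank μ) → V) : Function.End V := (F.coord x).2.1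

/-- `x^W`. -/
noncomputable def xW (F : Frame μ) (x : Fin (minRank μ) → V) : Fin (minRank μ) → V :=
  (F.coord x).2.2

/-- `M^G_{k,j} = X^G_k (X^G_j)⁻¹`. -/
noncomputable def MG (F : Frame μ) {Ω : Type*} (X : ℤ → Ω → Fin (minRank μ) → V) (k j : ℤ)
    (ω : Ω) : Function.End V :=
  F.xG (X k ω) * F.inv (F.xG (X j ω))

/-- `M^G_{j+n} M^G_{j+n-1} ⋯ M^G_{j+1}` where `M^G_i = X^G_i (X^G_{i-1})⁻¹`;
the empty product is `e`. -/
noncomputable def MGprod (F : Frame μ) {Ω : Type*} (X : ℤ → Ω → Fin (minRank μ) → V) (j : ℤ) :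
    ℕ → Ω → Function.End V
  | 0, _ => F.e
  | n + 1, ω => F.MG X (j + n + 1) (j + n) ω * F.MGprod X j n ω

end Frame

/-! ### σ-fields up to null events -/

/-- `σ(Z_j : j ≤ k)`. -/
@[reducible] def past {Ω α : Type*} [MeasurableSpace α] (Z : ℤ → Ω → α) (k : ℤ) : MeasurableSpace Ω :=
  ⨆ j : ℤ, ⨆ _ : j ≤ k, MeasurableSpace.comap (Z j) inferInstance

/-- `⋂_k σ(Z_j : j ≤ k)`. -/
@[reducible] def remotePast {Ω α : Type*} [MeasurableSpace α] (Z : ℤ → Ω → α) : MeasurableSpace Ω :=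
  ⨅ k : ℤ, past Z k

/-- The σ-field generated by the null events of `P`. -/
@[reducible] def nullField {Ω : Type*} {mΩ : MeasurableSpace Ω} (P : Measure Ω) : MeasurableSpace Ω :=
  MeasurableSpace.generateFrom {A | MeasurableSet[mΩ] A ∧ P A = 0}

/-- `𝓐 ⊂ 𝓑` a.s. -/
def SubAE {Ω : Type*} {mΩ : MeasurableSpace Ω} (P : Measure Ω) (A B : MeasurableSpace Ω) : Prop :=
  A ≤ B ⊔ nullField P

/-- `𝓐 = 𝓑` a.s. -/
def EqAE {Ω : Type*} {mΩ : MeasurableSpace Ω} (P : Measure Ω) (A B : MeasurableSpace Ω) : Prop :=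
  A ⊔ nullField P = B ⊔ nullField P

/-! ### Evolutions -/

/-- `(X, N)` is an `m`-particle `μ`-evolution on `(Ω, P)`. -/
structure IsEvolution {V Ω : Type*} [MeasurableSpace V] [MeasurableSpace Ω] {m : ℕ}
    (μ : Measure (Function.End V)) (P : Measure Ω)
    (X : ℤ → Ω → Fin m → V) (N : ℤ → Ω → Function.End V) : Prop where
  measurable_X : ∀ k, Measurable (X k)
  measurable_N : ∀ k, Measurable (N k)
  iIndep_N : iIndepFun N P
  law_N : ∀ k, P.map (N k) = μ
  step : ∀ k, ∀ᵐ ω ∂P, X k ω = N k ω • X (k - 1) ω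
  indep_past : ∀ k, Indep (MeasurableSpace.comap (N k) inferInstance)
    (past X (k - 1) ⊔ past N (k - 1)) P

/-- `(c_i)` and `(Λ^i_W)` represent the sequence `(Λ_k)`: `c_i ≥ 0`, `∑ c_i = 1`, `Λ^i_W` is a
probability on `W` and `Λ_k = ∑_i c_i η^L γ^{k+i} ω_H Λ^i_W` for all `k ∈ ℤ`. -/
structure Frame.Represents {V : Type*} [MeasurableSpace V] {μ : Measure (Function.End V)}
    (F : Frame μ) (c : Fin F.p → ℝ≥0) (ΛW : Fin F.p → Measure (Fin (minRank μ) → V))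
    (Λ : ℤ → Measure (Fin (minRank μ) → V)) : Prop where
  sum_eq_one : ∑ i, c i = 1
  isProb : ∀ i, IsProbabilityMeasure (ΛW i)
  onW : ∀ i, ΛW i F.Wᶜ = 0
  eq : ∀ k : ℤ, Λ k = ∑ i : Fin F.p, c i •
    act (F.ηL.mconv ((Measure.dirac (F.γpow (k + (i : ℕ)))).mconv (uniformOn F.H))) (ΛW i)

/-- `𝓖^N_k = σ(X^L_j, M^G_j : j ≤ k)`. -/
@[reducible] noncomputable def Frame.reducedNoise {V Ω : Type*} [Nonempty V]
    {μ : Measure (Function.End V)} (F : Frame μ) (X : ℤ → Ω → Fin (minRank μ) → V) (k : ℤ) :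
    MeasurableSpace Ω :=
  past (fun j ω => F.xL (X j ω)) k ⊔ past (fun j ω => F.MG X j (j - 1) ω) k

end ActionEvolution

/-!
# Factorization of `m_μ`-particle evolutions

The algebraic side rests on two facts about an idempotent subsequential limit `η` of `(μⁿ)`. First,
`η δ_z η = η` for every `z` in the support of `η` (`sandwich`): by the maximum principle, the
function `z ↦ η δ_z η` is constant on the support. Second, `μⁿ η = η` for all large `n` in a
sequence along which `μⁿ → η` (`eventually_pow_mul_eq`), so that the laws `μᵏ η` run through a
finite cycle. Both are proved by identifying a law on `End(V)` with its matrix in the right regular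
representation (`rep`), where convolution is matrix multiplication and limits are limits of
matrices. From them it follows that `H = e 𝒮(η) e` is a group with `e η e = ω_H`, that it is normal
in the group `G = e 𝒮(ν) e` with the cosets `γᵏ H`, and that `μᵏ η = η^L γᵏ ω_H η^R`. Maps in
`𝒮(η)` have minimal rank, hence a map in `G` is determined by its value at a single vector of
`e W_μ`; orbit representatives of `G` in `e W_μ` then give a set `W`, and the existence of all
choices (`frame_nonempty`).

For the evolution, almost every trajectory stays in `LGW`. One step leaves `x^W` unchanged, and
moves the coset `γᵏ y H` of `x^G` to `γᵏ⁺¹ y H`; hence the index of the coset and `x^W`, read off at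
time `0`, define `Y_C` and `Z_W`. They can be read off at any other time as well, so they belong to
the remote past up to null events. The main step is `Frame.real_inter_eq`: on any remote event
contained in `{Y_C = y, Z_W = w}`, the vector `X_k` has the law of `f γᵏ y w` with `f ∼ η`. It
follows from the Markov property started at time `k - n`, with `n → ∞` along a sequence such that
`μⁿ → η`: the law of `f x`, `f ∼ η`, depends on `x ∈ LGW` only through `x^W` and the coset of `x^G`.

In coordinates this says that, given the remote past, `X_k^L ∼ η^L` and `U_k` is uniform on `H`,
independently. The noise of the times `j + 1, …, k` turns `U_j` into `U_k` by a group
multiplication that depends on the noise and on `X_j^L`; by the invariance of `ω_H`, the noise,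
`U_k` and the remote past are therefore independent (`Frame.real_triple`). Since cylinder events
are functions of an early state and later noise, the remote past is trivial on each event `{Y_C =
y, Z_W = w}` (`Frame.real_remotePast_inter_label`), which identifies it as the σ-field of `Y_C`
and `Z_W`. The coordinate `X_k^L` is a function of the recent noise as soon as a product of it
lies in `𝒮(η)`, which happens almost surely (`Frame.measurable_xL_noise`).
-/

set_option linter.unusedSectionVars false

namespace ActionEvolution

/-! ### Probabilities on the monoid as matrices -/

section Representation

open scoped Classical

variable {V : Type*} [Finite V]

instance endFinite : Finite (Function.End V) := inferInstanceAs (Finite (V → V))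

noncomputable instance endFintype : Fintype (Function.End V) := Fintype.ofFinite _

/-- The right regular representation of a finite measure `κ` on `End V`: the transition matrix of
the walk `x ↦ x z` with `z ∼ κ`. -/
noncomputable def rep (κ : Measure (Function.End V)) :
    Matrix (Function.End V) (Function.End V) ℝ :=
  Matrix.of fun x y => κ.real {z | x * z = y}

/-- The image of the point mass at `z` under the regular representation. -/
noncomputable def pt (z : Function.End V) : Matrix (Function.End V) (Function.End V) ℝ :=
  rep (Measure.dirac z)

theorem rep_apply (κ : Measure (Function.End V)) (x y : Function.End V) :
    rep κ x y = κ.real {z | x * z = y} := rfl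

theorem rep_one_apply (κ : Measure (Function.End V)) (y : Function.End V) :
    rep κ 1 y = κ.real {y} := by
  simp [rep_apply]

theorem rep_injective {κ ρ : Measure (Function.End V)} [IsFiniteMeasure κ] [IsFiniteMeasure ρ]
    (h : rep κ = rep ρ) : κ = ρ := by
  refine Measure.ext_of_singleton fun a => ?_
  have := congrFun (congrFun h 1) a
  rw [rep_one_apply, rep_one_apply] at this
  exact (measureReal_eq_measureReal_iff).1 this

theorem rep_mconv (κ ρ : Measure (Function.End V)) [IsFiniteMeasure κ] [IsFiniteMeasure ρ] :
    rep (κ.mconv ρ) = rep κ * rep ρ := by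
  ext x y
  rw [Matrix.mul_apply, rep_apply, Measure.mconv,
    map_measureReal_apply (by fun_prop) (MeasurableSet.of_discrete)]
  have : (fun q : Function.End V × Function.End V => q.1 * q.2) ⁻¹' {z | x * z = y} =
      ⋃ w ∈ (Finset.univ : Finset (Function.End V)), {z | x * z = w} ×ˢ {z | w * z = y} := by
    ext ⟨a, b⟩
    simp [mul_assoc]
  rw [this, measureReal_biUnion_finset]
  · simp only [measureReal_prod_prod, rep_apply]
  · intro u _ v _ huv
    refine Set.disjoint_left.2 fun q hq hq' => huv ?_
    exact hq.1.symm.trans hq'.1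
  · intro _ _
    exact MeasurableSet.of_discrete

theorem pt_apply (z x y : Function.End V) : pt z x y = if x * z = y then 1 else 0 := by
  by_cases h : x * z = y <;> simp [pt, rep_apply, h, measureReal_def]

theorem rep_dirac (z : Function.End V) : rep (Measure.dirac z) = pt z := rfl

theorem pt_one : pt (1 : Function.End V) = 1 := by
  ext x y
  simp [pt_apply, Matrix.one_apply]

theorem pt_mul (x y : Function.End V) : pt (x * y) = pt x * pt y := by
  rw [pt, pt, pt, ← rep_mconv, Measure.dirac_mconv_dirac]

theorem rep_eq_sum (κ : Measure (Function.End V)) [IsFiniteMeasure κ] :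
    rep κ = ∑ z, κ.real {z} • pt z := by
  ext x y
  rw [Matrix.sum_apply, rep_apply]
  have : {z | x * z = y} = ((Finset.univ.filter fun z => x * z = y : Finset _) : Set _) := by
    ext; simp
  rw [this, ← sum_measureReal_singleton, Finset.sum_filter]
  simp [pt_apply]

theorem rep_map {α : Type*} [MeasurableSpace α] [DiscreteMeasurableSpace α] [Fintype α]
    (κ : Measure α) [IsFiniteMeasure κ] (f : α → Function.End V) :
    rep (κ.map f) = ∑ z, κ.real {z} • pt (f z) := by
  ext x y
  rw [Matrix.sum_apply, rep_apply, map_measureReal_apply .of_discrete .of_discrete]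
  have : f ⁻¹' {z | x * z = y} =
      ((Finset.univ.filter fun z => x * f z = y : Finset _) : Set _) := by
    ext; simp
  rw [this, ← sum_measureReal_singleton, Finset.sum_filter]
  simp [pt_apply]

theorem sum_singleton_eq_one {α : Type*} [MeasurableSpace α] [DiscreteMeasurableSpace α] [Fintype α]
    (κ : Measure α) [IsProbabilityMeasure κ] : ∑ z, κ.real {z} = 1 := by
  rw [sum_measureReal_singleton]
  simp

theorem mem_supp_iff {α : Type*} [MeasurableSpace α] {κ : Measure α} [IsFiniteMeasure κ] {z : α} :
    z ∈ supp κ ↔ 0 < κ.real {z} := by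
  simp [supp, measureReal_def, ENNReal.toReal_pos_iff, measure_lt_top]

theorem real_eq_zero_of_notMem_supp {α : Type*} [MeasurableSpace α] {κ : Measure α} {z : α}
    (h : z ∉ supp κ) : κ.real {z} = 0 := by
  simp only [supp, Set.mem_ofPred_eq, not_lt, nonpos_iff_eq_zero] at h
  simp [measureReal_def, h]

/-- A linear identity that holds for all point masses in the support of a probability holds for
the probability itself. -/
theorem sum_supp_eq {α E : Type*} [MeasurableSpace α] [DiscreteMeasurableSpace α] [Fintype α]
    [AddCommGroup E] [Module ℝ E] (κ : Measure α) [IsProbabilityMeasure κ] (f : α → E) (c : E)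
    (h : ∀ z ∈ supp κ, f z = c) : ∑ z, κ.real {z} • f z = c := by
  calc ∑ z, κ.real {z} • f z = ∑ z, κ.real {z} • c := by
        refine Finset.sum_congr rfl fun z _ => ?_
        by_cases hz : z ∈ supp κ
        · rw [h z hz]
        · simp [real_eq_zero_of_notMem_supp hz]
    _ = c := by rw [← Finset.sum_smul, sum_singleton_eq_one, one_smul]

/-- The use of `sum_supp_eq` for convolutions: a factor `δ_z` may be averaged over `z ∼ κ`. -/
theorem mul_rep_mul_eq {κ : Measure (Function.End V)} [IsProbabilityMeasure κ]
    {A B C : Matrix (Function.End V) (Function.End V) ℝ}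
    (h : ∀ z ∈ supp κ, A * pt z * B = C) : A * rep κ * B = C := by
  rw [rep_eq_sum, Finset.mul_sum, Finset.sum_mul]
  simp only [mul_smul_comm, smul_mul_assoc]
  exact sum_supp_eq κ _ _ h

instance mconv_prob {κ ρ : Measure (Function.End V)} [IsProbabilityMeasure κ]
    [IsProbabilityMeasure ρ] : IsProbabilityMeasure (κ.mconv ρ) :=
  Measure.isProbabilityMeasure_map (by fun_prop)

theorem supp_nonempty {α : Type*} [MeasurableSpace α] [DiscreteMeasurableSpace α] [Finite α]
    (κ : Measure α) [IsProbabilityMeasure κ] : (supp κ).Nonempty := by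
  have := Fintype.ofFinite α
  by_contra! h
  have h1 := sum_singleton_eq_one κ
  rw [Finset.sum_eq_zero] at h1
  · exact zero_ne_one h1
  · intro z _
    exact real_eq_zero_of_notMem_supp (by simp [h])

theorem measure_eq_zero_of_forall_notMem {α : Type*} [MeasurableSpace α] [DiscreteMeasurableSpace α]
    [Finite α] {κ : Measure α} {A : Set α} (h : ∀ z ∈ supp κ, z ∉ A) : κ A = 0 := by
  rw [← Set.biUnion_of_singleton A]
  refine (measure_biUnion_null_iff (Set.to_countable A)).2 fun z hz => ?_
  by_contra h0
  exact h z (pos_iff_ne_zero.2 h0) hz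

theorem supp_mconv (κ ρ : Measure (Function.End V)) [IsFiniteMeasure κ] [IsFiniteMeasure ρ] :
    supp (κ.mconv ρ) = supp κ * supp ρ := by
  ext z
  have hz : (κ.mconv ρ) {z} = (κ.prod ρ) {q | q.1 * q.2 = z} := by
    rw [Measure.mconv, Measure.map_apply (by fun_prop) .of_discrete]
    rfl
  constructor
  · intro h
    by_contra h'
    refine absurd (measure_eq_zero_of_forall_notMem (κ := κ.prod ρ)
      (A := {q | q.1 * q.2 = z}) ?_) ?_
    · rintro ⟨a, b⟩ hab rfl
      refine h' (Set.mul_mem_mul ?_ ?_)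
      all_goals
        rw [supp, Set.mem_ofPred_eq, ← Set.singleton_prod_singleton, Measure.prod_prod] at hab
        rw [supp, Set.mem_ofPred_eq, pos_iff_ne_zero]
        intro h0
        simp [h0] at hab
    · rw [← hz]
      exact h.ne'
  · rintro ⟨a, ha, b, hb, rfl⟩
    rw [supp, Set.mem_ofPred_eq, hz]
    refine lt_of_lt_of_le (ENNReal.mul_pos ha.ne' hb.ne')
      (le_of_eq_of_le ?_ (measure_mono (s := {(a, b)}) (by simp)))
    rw [← Set.singleton_prod_singleton, Measure.prod_prod]

theorem supp_dirac (z : Function.End V) : supp (Measure.dirac z) = {z} := by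
  ext x
  by_cases h : z = x
  · simp [supp, h]
  · simp [supp, h, Ne.symm h]

/-- If `η` is an idempotent probability and `z` is in its support, then `η δ_z η = η`: the function
`z ↦ η δ_z η` is harmonic for two-sided multiplication by `η`, so by the maximum principle each of
its coordinates is constant on the two-sided orbit of a maximizer and of a minimizer, and these
orbits meet. -/
theorem sandwich {η : Measure (Function.End V)} [IsProbabilityMeasure η] (h : η.mconv η = η)
    {z : Function.End V} (hz : z ∈ supp η) : rep η * pt z * rep η = rep η := by
  have hη : rep η * rep η = rep η := by rw [← rep_mconv, h]
  have hmul : ∀ {x y}, x ∈ supp η → y ∈ supp η → x * y ∈ supp η := by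
    intro x y hx hy
    rw [← h, supp_mconv]
    exact Set.mul_mem_mul hx hy
  ext a b
  set f : Function.End V → ℝ := fun z => (rep η * pt z * rep η) a b with hf
  have havg : ∀ z, f z = ∑ x, ∑ y, η.real {x} * (η.real {y} * f (x * z * y)) := by
    intro z
    have : rep η * pt z * rep η =
        ∑ x, ∑ y, η.real {x} • η.real {y} • (rep η * pt (x * z * y) * rep η) := by
      calc rep η * pt z * rep η = rep η * (rep η * pt z * rep η) * rep η := by
            simp only [mul_assoc, hη]
            rw [← mul_assoc (rep η) (rep η), hη]
        _ = rep η * ((∑ x, η.real {x} • pt x) * pt z * (∑ x, η.real {x} • pt x)) * rep η := by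
            rw [← rep_eq_sum]
        _ = _ := by
            simp only [Finset.sum_mul, Finset.mul_sum, smul_mul_assoc, mul_smul_comm, pt_mul]
            rw [Finset.sum_comm]
            simp only [Finset.smul_sum]
            refine Finset.sum_congr rfl fun x _ => Finset.sum_congr rfl fun y _ => ?_
            rw [smul_comm]
    simp only [hf]
    conv_lhs => rw [this]
    simp [Matrix.sum_apply, Matrix.smul_apply]
  have hsum : ∑ x, ∑ y, η.real {x} * η.real {y} = 1 := by
    simp only [← Finset.mul_sum, sum_singleton_eq_one, mul_one]
  -- equality in the averaging identity at an extremal point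
  have hext : ∀ z c, f z = c → (∀ x ∈ supp η, ∀ y ∈ supp η, 0 ≤ c - f (x * z * y)) ∨
      (∀ x ∈ supp η, ∀ y ∈ supp η, c - f (x * z * y) ≤ 0) →
      ∀ x ∈ supp η, ∀ y ∈ supp η, f (x * z * y) = c := by
    intro z c hzc hle x hx y hy
    have h0 : ∑ x, ∑ y, η.real {x} * (η.real {y} * (c - f (x * z * y))) = 0 := by
      simp only [mul_sub, Finset.sum_sub_distrib]
      rw [← havg z, hzc]
      simp only [← mul_assoc, ← Finset.sum_mul, hsum]
      ring
    have key : ∀ g : Function.End V → Function.End V → ℝ,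
        (∀ x ∈ supp η, ∀ y ∈ supp η, 0 ≤ g x y) →
        ∑ x, ∑ y, η.real {x} * (η.real {y} * g x y) = 0 → g x y = 0 := by
      intro g hg h0
      have hnn : ∀ x y, 0 ≤ η.real {x} * (η.real {y} * g x y) := by
        intro x y
        by_cases hx : x ∈ supp η
        · by_cases hy : y ∈ supp η
          · exact mul_nonneg measureReal_nonneg (mul_nonneg measureReal_nonneg (hg x hx y hy))
          · simp [real_eq_zero_of_notMem_supp hy]
        · simp [real_eq_zero_of_notMem_supp hx]
      have h1 := (Finset.sum_eq_zero_iff_of_nonneg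
        (fun x _ => Finset.sum_nonneg fun y _ => hnn x y)).1 h0 x (Finset.mem_univ _)
      have h2 := (Finset.sum_eq_zero_iff_of_nonneg (fun y _ => hnn x y)).1 h1 y (Finset.mem_univ _)
      rcases mul_eq_zero.1 h2 with h3 | h3
      · exact absurd h3 (mem_supp_iff.1 hx).ne'
      rcases mul_eq_zero.1 h3 with h4 | h4
      · exact absurd h4 (mem_supp_iff.1 hy).ne'
      exact h4
    rcases hle with hle | hle
    · have := key (fun x y => c - f (x * z * y)) hle h0
      linarith
    · have := key (fun x y => -(c - f (x * z * y))) (fun x hx y hy => by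
        have := hle x hx y hy
        linarith) (by simpa only [mul_neg, Finset.sum_neg_distrib, neg_eq_zero] using h0)
      linarith
  obtain ⟨z₀, hz₀, hmax⟩ := Set.exists_max_image (supp η) f (Set.toFinite _) ⟨z, hz⟩
  obtain ⟨z₁, hz₁, hmin⟩ := Set.exists_min_image (supp η) f (Set.toFinite _) ⟨z, hz⟩
  have e1 := hext z₀ _ rfl (Or.inl fun x hx y hy =>
    sub_nonneg.2 (hmax _ (hmul (hmul hx hz₀) hy))) z₀ hz₀ (z₁ * z₀) (hmul hz₁ hz₀)
  have e2 := hext z₁ _ rfl (Or.inr fun x hx y hy =>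
    sub_nonpos.2 (hmin _ (hmul (hmul hx hz₁) hy))) (z₀ * z₀) (hmul hz₀ hz₀) z₀ hz₀
  have hconst : ∀ x ∈ supp η, f x = f z := by
    intro x hx
    have e3 : f z₀ = f z₁ := by
      rw [← e1, ← e2]
      simp only [mul_assoc]
    have := hmax x hx
    have := hmin x hx
    have := hmax z hz
    have := hmin z hz
    linarith
  have h3 : rep η a b = ∑ x, η.real {x} • f x := by
    have : rep η = rep η * (∑ x, η.real {x} • pt x) * rep η := by
      rw [← rep_eq_sum, hη, hη]
    conv_lhs => rw [this]
    simp [Finset.mul_sum, Finset.sum_mul, Matrix.sum_apply, Matrix.smul_apply, hf]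
  rw [h3, sum_supp_eq η f (f z) hconst]

end Representation

/-! ### Convolution powers and idempotent limits -/

section Limits

open scoped Classical

variable {V : Type*} [Finite V] {μ η : Measure (Function.End V)} [IsProbabilityMeasure μ]

instance convPow_prob (n : ℕ) : IsProbabilityMeasure (convPow μ n) := by
  induction n with
  | zero => exact Measure.dirac.isProbabilityMeasure
  | succ n ih => exact mconv_prob

theorem rep_convPow (n : ℕ) : rep (convPow μ n) = rep μ ^ n := by
  induction n with
  | zero => exact pt_one
  | succ n ih => rw [convPow, rep_mconv, ih, pow_succ']

theorem IsSubseqLimit.isProbabilityMeasure (h : IsSubseqLimit μ η) : IsProbabilityMeasure η := by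
  obtain ⟨φ, -, h⟩ := h
  refine ⟨tendsto_nhds_unique (h Set.univ) ?_⟩
  simp

theorem tendsto_rep {κ : ℕ → Measure (Function.End V)} [IsFiniteMeasure η]
    (h : ∀ A, Tendsto (fun n => κ n A) atTop (𝓝 (η A))) :
    Tendsto (fun n => rep (κ n)) atTop (𝓝 (rep η)) :=
  tendsto_pi_nhds.2 fun _ => tendsto_pi_nhds.2 fun _ =>
    (ENNReal.tendsto_toReal (measure_ne_top _ _)).comp (h _)

theorem IsSubseqLimit.tendsto_pow [IsFiniteMeasure η] (h : IsSubseqLimit μ η) :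
    ∃ φ : ℕ → ℕ, StrictMono φ ∧ Tendsto (fun n => rep μ ^ φ n) atTop (𝓝 (rep η)) := by
  obtain ⟨φ, hφ, h⟩ := h
  exact ⟨φ, hφ, by simpa only [rep_convPow] using tendsto_rep h⟩

theorem rep_mem_Icc (κ : Measure (Function.End V)) [IsProbabilityMeasure κ] :
    rep κ ∈ (Set.Icc 0 1 : Set (Function.End V → Function.End V → ℝ)) :=
  ⟨fun _ _ => measureReal_nonneg, fun _ _ => measureReal_le_one⟩

theorem isCompact_matrix_Icc {n : Type*} :
    IsCompact (show Set (Matrix n n ℝ) from (Set.Icc 0 1 : Set (n → n → ℝ))) := by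
  have : (Set.Icc 0 1 : Set (n → n → ℝ)) =
      Set.univ.pi fun _ => Set.univ.pi fun _ => Set.Icc (0 : ℝ) 1 := by
    ext f
    simp only [Set.mem_Icc, Pi.le_def, Set.mem_pi, Set.mem_univ, forall_true_left, Pi.zero_apply,
      Pi.one_apply]
    exact ⟨fun h i j => ⟨h.1 i j, h.2 i j⟩, fun h => ⟨fun i j => (h i j).1, fun i j => (h i j).2⟩⟩
  exact this ▸ isCompact_univ_pi fun _ => isCompact_univ_pi fun _ => isCompact_Icc

instance matrixFirstCountable {n : Type*} [Finite n] :
    FirstCountableTopology (Matrix n n ℝ) :=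
  inferInstanceAs (FirstCountableTopology (n → n → ℝ))

theorem exists_tendsto_subseq (κ : ℕ → Measure (Function.End V))
    [∀ n, IsProbabilityMeasure (κ n)] :
    ∃ (B : Matrix (Function.End V) (Function.End V) ℝ) (ψ : ℕ → ℕ), StrictMono ψ ∧
      Tendsto (fun n => rep (κ (ψ n))) atTop (𝓝 B) := by
  obtain ⟨B, -, ψ, hψ, h⟩ := isCompact_matrix_Icc.tendsto_subseq
    (x := fun n => rep (κ n)) fun n => rep_mem_Icc (κ n)
  exact ⟨B, ψ, hψ, h⟩

/-- Limits of probabilities, in the regular representation, are probabilities. -/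
theorem exists_measure_of_tendsto {κ : ℕ → Measure (Function.End V)}
    [∀ n, IsProbabilityMeasure (κ n)] {B : Matrix (Function.End V) (Function.End V) ℝ}
    (h : Tendsto (fun n => rep (κ n)) atTop (𝓝 B)) :
    ∃ ρ : Measure (Function.End V), IsProbabilityMeasure ρ ∧ rep ρ = B ∧
      ∀ A, Tendsto (fun n => κ n A) atTop (𝓝 (ρ A)) := by
  set ρ : Measure (Function.End V) := ∑ z, ENNReal.ofReal (B 1 z) • Measure.dirac z with hρ
  have hsum : ∀ (κ : Measure (Function.End V)) A,
      κ A = ∑ z ∈ Finset.univ.filter (· ∈ A), κ {z} := by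
    intro κ A
    rw [sum_measure_singleton]
    congr 1
    ext
    simp
  have hz : ∀ z, ρ {z} = ENNReal.ofReal (B 1 z) := by
    intro z
    simp [hρ, Set.indicator_apply]
  have htend : ∀ A, Tendsto (fun n => κ n A) atTop (𝓝 (ρ A)) := by
    intro A
    rw [hsum ρ A]
    simp_rw [hsum (κ _) A]
    refine tendsto_finsetSum _ fun z _ => ?_
    rw [hz]
    have := (tendsto_pi_nhds.1 (tendsto_pi_nhds.1 h 1) z)
    simp only [rep_one_apply] at this
    have h2 := ENNReal.tendsto_ofReal this
    simpa using h2
  have hprob : IsProbabilityMeasure ρ := ⟨tendsto_nhds_unique (htend Set.univ) (by simp)⟩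
  exact ⟨ρ, hprob, tendsto_nhds_unique (tendsto_rep htend) h, htend⟩

/-- The limit points of `(μⁿ)` form a compact semigroup, which contains an idempotent. -/
theorem exists_idempotent_limit (μ : Measure (Function.End V)) [IsProbabilityMeasure μ] :
    ∃ η, IsSubseqLimit μ η ∧ η.mconv η = η := by
  set s : Set (Matrix (Function.End V) (Function.End V) ℝ) :=
    {B | MapClusterPt B atTop fun n : ℕ => rep μ ^ n} with hs
  have hmem : ∀ n, rep μ ^ n ∈ show Set (Matrix (Function.End V) (Function.End V) ℝ) from
      (Set.Icc 0 1 : Set (Function.End V → Function.End V → ℝ)) := by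
    intro n
    rw [← rep_convPow]
    exact rep_mem_Icc _
  have hsub : ∀ B ∈ s, ∃ φ : ℕ → ℕ, StrictMono φ ∧
      Tendsto (fun n => rep μ ^ φ n) atTop (𝓝 B) := by
    intro B hB
    obtain ⟨ψ, hψ, h⟩ := MapClusterPt.tendsto_subseq hB
    exact ⟨ψ, hψ, h⟩
  have hof : ∀ (φ : ℕ → ℕ) B, StrictMono φ → Tendsto (fun n => rep μ ^ φ n) atTop (𝓝 B) → B ∈ s :=
    fun φ B hφ h => h.mapClusterPt.of_comp hφ.tendsto_atTop
  obtain ⟨B, hBs, hB⟩ := exists_idempotent_in_compact_subsemigroup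
    (M := Matrix (Function.End V) (Function.End V) ℝ) (fun r => by fun_prop) s
    (by
      obtain ⟨B, -, φ, hφ, h⟩ := isCompact_matrix_Icc.tendsto_subseq hmem
      exact ⟨B, hof φ B hφ h⟩)
    (isCompact_matrix_Icc.of_isClosed_subset isClosed_setOfPred_clusterPt fun B hB => by
      obtain ⟨φ, -, h⟩ := hsub B hB
      exact isCompact_matrix_Icc.isClosed.mem_of_tendsto h (Eventually.of_forall fun n => hmem _))
    (fun A hA B hB => by
      obtain ⟨φ, hφ, h⟩ := hsub A hA
      obtain ⟨ψ, hψ, h'⟩ := hsub B hB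
      refine hof (fun n => φ n + ψ n) _ (fun a b hab => add_lt_add (hφ hab) (hψ hab)) ?_
      simp only [pow_add]
      exact h.mul h')
  obtain ⟨φ, hφ, h⟩ := hsub B hBs
  simp only [← rep_convPow] at h
  obtain ⟨ρ, hρ, rfl, hlim⟩ := exists_measure_of_tendsto h
  exact ⟨ρ, ⟨φ, hφ, hlim⟩, rep_injective (by rw [rep_mconv, hB])⟩

/-- An element of the support of a law that is invertible relative to `η` determines the law. -/
theorem mul_pt_mul_eq_of_inverse {κ ρ : Measure (Function.End V)} [IsProbabilityMeasure η]
    [IsProbabilityMeasure κ] [IsProbabilityMeasure ρ] (hη : η.mconv η = η)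
    (h1 : rep η * rep κ = rep κ) (h2 : rep κ * rep ρ = rep η) (h3 : rep ρ * rep κ = rep η)
    (h4 : rep ρ * rep η = rep ρ) {a : Function.End V} (ha : a ∈ supp κ) :
    rep η * pt a * rep η = rep κ := by
  have hκρ : κ.mconv ρ = η := rep_injective (by rw [rep_mconv, h2])
  have e1 : rep η * pt a * rep ρ * rep η = rep η := by
    refine mul_rep_mul_eq fun b hb => ?_
    rw [mul_assoc (rep η), ← pt_mul]
    refine sandwich hη ?_
    rw [← hκρ, supp_mconv]
    exact Set.mul_mem_mul ha hb
  rw [mul_assoc, h4] at e1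
  calc rep η * pt a * rep η = rep η * pt a * (rep ρ * rep κ) := by rw [h3]
    _ = rep κ := by rw [← mul_assoc, e1, h1]

variable [IsProbabilityMeasure η]

theorem IsSubseqLimit.commute (h : IsSubseqLimit μ η) : Commute (rep μ) (rep η) := by
  obtain ⟨φ, -, h⟩ := h.tendsto_pow
  refine tendsto_nhds_unique (h.const_mul (rep μ)) ((h.mul_const (rep μ)).congr fun n => ?_)
  exact (Commute.refl (rep μ)).pow_left _

/-- Along a subsequence with `μ^{φ n} → η`, eventually `μ^{φ n} η = η`: once `μ^{φ n} η` charges a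
point of the support of `η`, it equals `η`, by the existence of an inverse of `μ^{φ n} η`. -/
theorem eventually_pow_mul_eq (h : IsSubseqLimit μ η) (hη : η.mconv η = η) {φ : ℕ → ℕ}
    (hφ : StrictMono φ) (ht : Tendsto (fun n => rep μ ^ φ n) atTop (𝓝 (rep η))) :
    ∀ᶠ n in atTop, rep μ ^ φ n * rep η = rep η := by
  have hη' : rep η * rep η = rep η := by rw [← rep_mconv, hη]
  have hcomm := h.commute
  obtain ⟨e, he⟩ := supp_nonempty η
  have h1 : Tendsto (fun n => rep μ ^ φ n * rep η) atTop (𝓝 (rep η)) := by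
    simpa [hη'] using ht.mul_const (rep η)
  have h2 : ∀ᶠ n in atTop, 0 < (rep μ ^ φ n * rep η) 1 e := by
    refine (tendsto_pi_nhds.1 (tendsto_pi_nhds.1 h1 1) e).eventually (lt_mem_nhds ?_)
    rw [rep_one_apply]
    exact mem_supp_iff.1 he
  filter_upwards [h2] with n hn
  set κ := (convPow μ (φ n)).mconv η with hκ
  have hrκ : rep κ = rep μ ^ φ n * rep η := by rw [hκ, rep_mconv, rep_convPow]
  rw [← hrκ, rep_one_apply, ← mem_supp_iff] at hn
  have hc : ∀ m, rep μ ^ m * rep η = rep η * rep μ ^ m := fun m => (hcomm.pow_left m)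
  -- a limit point of `μ^{φ j - φ n}` gives an inverse of `μ^{φ n} η`
  obtain ⟨B, ψ, hψ, hB⟩ := exists_tendsto_subseq fun j => convPow μ (φ j - φ n)
  obtain ⟨ρ, hρ, rfl, -⟩ := exists_measure_of_tendsto hB
  simp only [rep_convPow] at hB
  have h3 : rep μ ^ φ n * rep ρ = rep η := by
    refine tendsto_nhds_unique (hB.const_mul _) ((ht.comp hψ.tendsto_atTop).congr' ?_)
    filter_upwards [(hφ.tendsto_atTop.comp hψ.tendsto_atTop).eventually_ge_atTop (φ n)] with j hj
    have hj' : φ n ≤ φ (ψ j) := hj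
    rw [← pow_add, Nat.add_sub_cancel' hj']
    rfl
  have h4 : rep ρ * rep μ ^ φ n = rep η := by
    rw [← h3]
    refine tendsto_nhds_unique (hB.mul_const _) ((hB.const_mul _).congr fun j => ?_)
    rw [← pow_add, ← pow_add, add_comm]
  have h5 : rep ρ * rep η = rep η * rep ρ := by
    refine tendsto_nhds_unique (hB.mul_const _) ((hB.const_mul _).congr fun j => ?_)
    exact (hc _).symm
  have key := mul_pt_mul_eq_of_inverse (κ := κ) (ρ := ρ.mconv η) hη
    (by rw [hrκ, hc, ← mul_assoc, hη'])
    (by rw [hrκ, rep_mconv, mul_assoc, ← mul_assoc (rep η), ← h5, mul_assoc (rep ρ), hη',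
      ← mul_assoc, h3, hη'])
    (by rw [hrκ, rep_mconv, hc, mul_assoc, ← mul_assoc (rep η), hη', ← mul_assoc, h5, mul_assoc,
      h4, hη'])
    (by rw [rep_mconv, mul_assoc, hη']) hn
  rw [← hrκ, ← key, sandwich hη he]

end Limits

/-! ### The cyclic group of phases and the group `G` -/

section Corner

variable {V : Type*}

/-- The monoid `e · End(V) · e`, whose unit is the idempotent `e`. -/
def Corner (e : Function.End V) : Type _ := {x : Function.End V // e * x = x ∧ x * e = x}

variable {e : Function.End V}

instance [Finite V] : Finite (Corner e) := Subtype.finite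

instance [he : Fact (IsIdempotentElem e)] : Monoid (Corner e) where
  mul x y := ⟨x.1 * y.1, by rw [← mul_assoc, x.2.1], by rw [mul_assoc, y.2.2]⟩
  one := ⟨e, he.out, he.out⟩
  mul_assoc x y z := Subtype.ext (mul_assoc x.1 y.1 z.1)
  one_mul x := Subtype.ext x.2.1
  mul_one x := Subtype.ext x.2.2

variable [he : Fact (IsIdempotentElem e)]

/-- The map underlying a unit of `e · End(V) · e`. -/
def uval (g : (Corner e)ˣ) : Function.End V := g.1.1

theorem uval_injective : Function.Injective (uval : (Corner e)ˣ → Function.End V) :=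
  fun _ _ h => Units.ext (Subtype.ext h)

theorem uval_mul (g h : (Corner e)ˣ) : uval (g * h) = uval g * uval h := rfl

theorem uval_one : uval (1 : (Corner e)ˣ) = e := rfl

theorem mul_uval (g : (Corner e)ˣ) : e * uval g = uval g := g.1.2.1

theorem uval_mul_self (g : (Corner e)ˣ) : uval g * e = uval g := g.1.2.2

theorem localInv_uval (g : (Corner e)ˣ) : localInv e (uval g) = uval g⁻¹ := by
  have h : ∃ x, e * x = x ∧ x * e = x ∧ uval g * x = e ∧ x * uval g = e :=
    ⟨uval g⁻¹, mul_uval _, uval_mul_self _, by rw [← uval_mul, mul_inv_cancel, uval_one],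
      by rw [← uval_mul, inv_mul_cancel, uval_one]⟩
  rw [localInv, dif_pos h]
  obtain ⟨h1, -, -, h4⟩ := h.choose_spec
  calc h.choose = h.choose * (uval g * uval g⁻¹) := by
        rw [← uval_mul, mul_inv_cancel, uval_one, h.choose_spec.2.1]
    _ = uval g⁻¹ := by rw [← mul_assoc, h4, mul_uval]

theorem uval_pow (g : (Corner e)ˣ) (n : ℕ) : uval (g ^ n) = e * uval g ^ n := by
  induction n with
  | zero => simp [uval_one]
  | succ n ih => rw [pow_succ, uval_mul, ih, pow_succ, mul_assoc]

theorem localPow_uval (g : (Corner e)ˣ) (k : ℤ) : localPow e (uval g) k = uval (g ^ k) := by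
  cases k with
  | ofNat n => rw [localPow, Int.ofNat_eq_natCast, zpow_natCast, uval_pow]
  | negSucc n =>
    have : uval g ^ (n + 1) = uval (g ^ (n + 1)) := by
      rw [uval_pow, pow_succ', ← mul_assoc, mul_uval]
    rw [localPow, this, localInv_uval, zpow_negSucc]

end Corner

/-- The data on which the algebraic structure rests: an idempotent `e` in the support of an
idempotent subsequential limit `η` of `(μⁿ)`. -/
structure IsCore {V : Type*} (μ η : Measure (Function.End V)) (e : Function.End V) : Prop where
  isLimit : IsSubseqLimit μ η
  idem : η.mconv η = η
  e_mem : e ∈ supp η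

/-- The law `μᵏ η`. -/
noncomputable def phase {V : Type*} (μ η : Measure (Function.End V)) (k : ℕ) :
    Measure (Function.End V) :=
  (convPow μ k).mconv η

namespace IsCore

open scoped Classical

variable {V : Type*} [Finite V] {μ η : Measure (Function.End V)} {e : Function.End V}
  [IsProbabilityMeasure μ] [IsProbabilityMeasure η] [he : Fact (IsIdempotentElem e)]

instance (k : ℕ) : IsProbabilityMeasure (phase μ η k) := mconv_prob

theorem rep_phase (k : ℕ) : rep (phase μ η k) = rep μ ^ k * rep η := by
  rw [phase, rep_mconv, rep_convPow]

theorem phase_zero (μ η : Measure (Function.End V)) [IsProbabilityMeasure μ]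
    [IsProbabilityMeasure η] : phase μ η 0 = η :=
  rep_injective (by rw [rep_phase, pow_zero, one_mul])

theorem mem_phase_zero (μ : Measure (Function.End V)) [IsProbabilityMeasure μ]
    {a : Function.End V} : a ∈ supp (phase μ η 0) ↔ a ∈ supp η := by
  rw [phase_zero]

theorem iterate_eq_phase (k : ℕ) : (fun κ => μ.mconv κ)^[k] η = phase μ η k := by
  induction k with
  | zero => exact (phase_zero μ η).symm
  | succ k ih =>
    rw [Function.iterate_succ', Function.comp, ih]
    exact rep_injective (by rw [rep_mconv, rep_phase, rep_phase, pow_succ', mul_assoc])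

variable (c : IsCore μ η e)
include c

theorem rep_mul_self : rep η * rep η = rep η := by rw [← rep_mconv, c.idem]

theorem rep_phase_mul (j k : ℕ) :
    rep (phase μ η j) * rep (phase μ η k) = rep (phase μ η (j + k)) := by
  have := (c.isLimit.commute.pow_left k)
  rw [rep_phase, rep_phase, rep_phase, mul_assoc, ← mul_assoc (rep η), ← this.eq, mul_assoc,
    c.rep_mul_self, pow_add, mul_assoc]

theorem mul_mem_phase {j k : ℕ} {a b : Function.End V} (ha : a ∈ supp (phase μ η j))
    (hb : b ∈ supp (phase μ η k)) : a * b ∈ supp (phase μ η (j + k)) := by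
  rw [← rep_injective ((rep_mconv _ _).trans (c.rep_phase_mul j k)), supp_mconv]
  exact Set.mul_mem_mul ha hb

theorem mul_mem {a b : Function.End V} (ha : a ∈ supp η)
    (hb : b ∈ supp η) : a * b ∈ supp η := by
  have := c.mul_mem_phase (j := 0) (k := 0) ((mem_phase_zero μ).2 ha) ((mem_phase_zero μ).2 hb)
  rwa [phase_zero] at this

theorem mul_mem_phase_left {k : ℕ} {a b : Function.End V} (ha : a ∈ supp η)
    (hb : b ∈ supp (phase μ η k)) : a * b ∈ supp (phase μ η k) := by
  have := c.mul_mem_phase (j := 0) ((mem_phase_zero μ).2 ha) hb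
  rwa [zero_add] at this

theorem mul_mem_phase_right {k : ℕ} {a b : Function.End V} (ha : a ∈ supp (phase μ η k))
    (hb : b ∈ supp η) : a * b ∈ supp (phase μ η k) :=
  c.mul_mem_phase (k := 0) ha ((mem_phase_zero μ).2 hb)

theorem step_mem_phase {k : ℕ} {f a : Function.End V} (hf : f ∈ supp μ)
    (ha : a ∈ supp (phase μ η k)) : f * a ∈ supp (phase μ η (k + 1)) := by
  have : phase μ η (k + 1) = μ.mconv (phase μ η k) :=
    rep_injective (by rw [rep_mconv, rep_phase, rep_phase, pow_succ', mul_assoc])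
  rw [this, supp_mconv]
  exact Set.mul_mem_mul hf ha

theorem period_pos : 0 < period μ η := by
  obtain ⟨φ, hφ, ht⟩ := c.isLimit.tendsto_pow
  obtain ⟨n, hn, hn1⟩ := ((eventually_pow_mul_eq c.isLimit c.idem hφ ht).and
    (hφ.tendsto_atTop.eventually_ge_atTop 1)).exists
  refine Function.minimalPeriod_pos_of_mem_periodicPts ⟨φ n, hn1, ?_⟩
  rw [Function.IsPeriodicPt, Function.IsFixedPt, iterate_eq_phase]
  exact rep_injective (by rw [rep_phase, hn])

theorem phase_eq_iff_dvd (k : ℕ) : phase μ η k = η ↔ period μ η ∣ k := by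
  rw [← iterate_eq_phase]
  exact Function.isPeriodicPt_iff_minimalPeriod_dvd

theorem phase_congr {j k : ℕ} (h : j ≡ k [MOD period μ η]) : phase μ η j = phase μ η k := by
  have key : ∀ j, phase μ η j = phase μ η (j % period μ η) := by
    intro j
    have := c.rep_phase_mul (j % period μ η) (period μ η * (j / period μ η))
    rw [Nat.mod_add_div, (c.phase_eq_iff_dvd _).2 (dvd_mul_right _ _), rep_phase, mul_assoc,
      c.rep_mul_self, ← rep_phase] at this
    exact (rep_injective this).symm
  rw [key j, key k, h]

theorem mul_pt_mul_eq_phase {k : ℕ} {a : Function.End V} (ha : a ∈ supp (phase μ η k)) :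
    rep η * pt a * rep η = rep (phase μ η k) := by
  set k' := period μ η * k - k with hk'
  have hkk : phase μ η (k + k') = η := by
    rw [c.phase_eq_iff_dvd, hk', Nat.add_sub_cancel' (Nat.le_mul_of_pos_left k c.period_pos)]
    exact dvd_mul_right _ _
  refine mul_pt_mul_eq_of_inverse (ρ := phase μ η k') c.idem ?_ ?_ ?_ ?_ ha
  · have := c.rep_phase_mul 0 k
    rwa [phase_zero, zero_add] at this
  · rw [c.rep_phase_mul, hkk]
  · rw [c.rep_phase_mul, add_comm, hkk]
  · exact c.rep_phase_mul k' 0 |> fun h => by rwa [phase_zero] at h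

/-- The supports of the laws `μᵏ η` are equal or disjoint. -/
theorem phase_eq_of_mem {j k : ℕ} {a : Function.End V} (hj : a ∈ supp (phase μ η j))
    (hk : a ∈ supp (phase μ η k)) : phase μ η j = phase μ η k :=
  rep_injective (by rw [← c.mul_pt_mul_eq_phase hj, c.mul_pt_mul_eq_phase hk])

theorem mem_supp_cyclicMean {z : Function.End V} :
    z ∈ supp (cyclicMean μ η) ↔ ∃ k, z ∈ supp (phase μ η k) := by
  have hp := c.period_pos
  have : z ∈ supp (cyclicMean μ η) ↔ ∃ k < period μ η, z ∈ supp (phase μ η k) := by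
    simp [supp, cyclicMean, pos_iff_ne_zero, phase]
  rw [this]
  refine ⟨fun ⟨k, _, h⟩ => ⟨k, h⟩, fun ⟨k, h⟩ => ⟨k % period μ η, Nat.mod_lt _ hp, ?_⟩⟩
  rwa [c.phase_congr (Nat.mod_modEq k _)]

theorem exists_mul_eq {a b : Function.End V} (ha : a ∈ supp η) (hb : b ∈ supp η) :
    ∃ x ∈ supp η, ∃ y ∈ supp η, x * a * y = b := by
  have h : (η.mconv (Measure.dirac a)).mconv η = η :=
    rep_injective (by rw [rep_mconv, rep_mconv, rep_dirac, sandwich c.idem ha])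
  rw [← h, supp_mconv, supp_mconv, supp_dirac] at hb
  obtain ⟨_, ⟨x, hx, _, rfl, rfl⟩, y, hy, rfl⟩ := hb
  exact ⟨x, hx, y, hy, rfl⟩

/-- The sets `e · supp(μᵏ η) · e` consist of units of `e · End(V) · e`. -/
theorem exists_unit {k : ℕ} {a : Function.End V} (ha : a ∈ supp (phase μ η k)) :
    ∃ g : (Corner e)ˣ, uval g = e * a * e := by
  have hee : e * e = e := he.out
  set k' := period μ η * k - k with hk'
  have hkk : phase μ η (k + k') = η := by
    rw [c.phase_eq_iff_dvd, hk', Nat.add_sub_cancel' (Nat.le_mul_of_pos_left k c.period_pos)]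
    exact dvd_mul_right _ _
  obtain ⟨b, hb⟩ := supp_nonempty (phase μ η k')
  have h1 : (e * a * e) * b ∈ supp η := by
    rw [← hkk]
    exact c.mul_mem_phase (c.mul_mem_phase_right (c.mul_mem_phase_left c.e_mem ha) c.e_mem) hb
  obtain ⟨x, -, y, -, hxy⟩ := c.exists_mul_eq h1 c.e_mem
  have cor : ∀ z : Function.End V, e * (e * z * e) = e * z * e ∧ e * z * e * e = e * z * e :=
    fun z => ⟨by simp only [← mul_assoc, hee], by simp only [mul_assoc, hee]⟩
  let x' : Corner e := ⟨e * x * e, cor x⟩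
  let a' : Corner e := ⟨e * a * e, cor a⟩
  let b' : Corner e := ⟨e * (b * y) * e, cor _⟩
  have h2 : x' * (a' * b') = 1 := by
    refine Subtype.ext ?_
    change (e * x * e) * ((e * a * e) * (e * (b * y) * e)) = e
    calc (e * x * e) * ((e * a * e) * (e * (b * y) * e)) = e * (x * (e * a * e * b) * y) * e := by
          simp only [mul_assoc]
          simp only [← mul_assoc e e, hee]
      _ = e := by rw [hxy, hee, hee]
  have h3 : a' * (b' * x') = 1 := by rw [← mul_assoc]; exact mul_eq_one_comm.1 h2
  exact ⟨⟨a', b' * x', h3, mul_eq_one_comm.1 h3⟩, rfl⟩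

theorem uval_mem_phase_pow {k : ℕ} {g : (Corner e)ˣ} (hg : uval g ∈ supp (phase μ η k)) (n : ℕ) :
    uval (g ^ n) ∈ supp (phase μ η (k * n)) := by
  induction n with
  | zero => rw [pow_zero, uval_one, mul_zero, phase_zero]; exact c.e_mem
  | succ n ih => rw [pow_succ, uval_mul, mul_add, mul_one]; exact c.mul_mem_phase ih hg

theorem exists_inv_mem_phase {k : ℕ} {g : (Corner e)ˣ} (hg : uval g ∈ supp (phase μ η k)) :
    ∃ j, phase μ η (k + j) = η ∧ uval g⁻¹ ∈ supp (phase μ η j) := by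
  have hn := orderOf_pos g
  have h1 : g⁻¹ = g ^ (orderOf g - 1) := by
    rw [inv_eq_iff_mul_eq_one, ← pow_succ', Nat.sub_add_cancel hn, pow_orderOf_eq_one]
  have h2 := c.uval_mem_phase_pow hg (orderOf g - 1)
  refine ⟨k * (orderOf g - 1), ?_, h1 ▸ h2⟩
  have h3 := c.mul_mem_phase hg h2
  rw [← uval_mul, ← h1, mul_inv_cancel, uval_one] at h3
  rw [c.phase_eq_of_mem h3 ((mem_phase_zero μ).2 c.e_mem), phase_zero]

theorem inv_mem {g : (Corner e)ˣ} (hg : uval g ∈ supp η) : uval g⁻¹ ∈ supp η := by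
  obtain ⟨j, hj, h⟩ := c.exists_inv_mem_phase (k := 0) ((mem_phase_zero μ).2 hg)
  rw [zero_add] at hj
  rwa [hj] at h

/-- The group `H`, that is, `e · supp(η) · e` as a subgroup of the units of `e · End(V) · e`. -/
def subgroup : Subgroup (Corner e)ˣ where
  carrier := {g | uval g ∈ supp η}
  mul_mem' := c.mul_mem
  one_mem' := c.e_mem
  inv_mem' := c.inv_mem

theorem mem_subgroup {g : (Corner e)ˣ} : g ∈ c.subgroup ↔ uval g ∈ supp η := Iff.rfl

theorem conj_mem {k : ℕ} {g h : (Corner e)ˣ} (hg : uval g ∈ supp (phase μ η k))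
    (hh : h ∈ c.subgroup) : g * h * g⁻¹ ∈ c.subgroup := by
  obtain ⟨j, hj, h'⟩ := c.exists_inv_mem_phase hg
  rw [mem_subgroup, ← hj]
  exact c.mul_mem_phase (c.mul_mem_phase_right hg hh) h'

theorem inv_conj_mem {k : ℕ} {g h : (Corner e)ˣ} (hg : uval g ∈ supp (phase μ η k))
    (hh : h ∈ c.subgroup) : g⁻¹ * h * g ∈ c.subgroup := by
  obtain ⟨j, -, h'⟩ := c.exists_inv_mem_phase hg
  have := c.conj_mem h' hh
  rwa [inv_inv] at this

/-- Two elements of the same `e · supp(μᵏ η) · e` are in the same coset of `e · supp(η) · e`. -/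
theorem inv_mul_mem {k : ℕ} {g h : (Corner e)ˣ} (hg : uval g ∈ supp (phase μ η k))
    (hh : uval h ∈ supp (phase μ η k)) : g⁻¹ * h ∈ c.subgroup := by
  obtain ⟨j, hj, h'⟩ := c.exists_inv_mem_phase hg
  rw [mem_subgroup, ← hj, add_comm]
  exact c.mul_mem_phase h' hh

theorem mem_groupFactor {x : Function.End V} :
    x ∈ groupFactor η e ↔ ∃ g ∈ c.subgroup, uval g = x := by
  constructor
  · rintro ⟨_, ⟨_, rfl, a, ha, rfl⟩, _, rfl, rfl⟩
    obtain ⟨g, hg⟩ := c.exists_unit (k := 0) ((mem_phase_zero μ).2 ha)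
    refine ⟨g, ?_, hg⟩
    rw [mem_subgroup, hg]
    exact c.mul_mem (c.mul_mem c.e_mem ha) c.e_mem
  · rintro ⟨g, hg, rfl⟩
    exact ⟨_, ⟨_, rfl, _, hg, rfl⟩, _, rfl, by simp only [mul_uval, uval_mul_self]⟩

theorem mem_groupFactor_cyclicMean {x : Function.End V} :
    x ∈ groupFactor (cyclicMean μ η) e ↔
      ∃ (k : ℕ) (g : (Corner e)ˣ), uval g ∈ supp (phase μ η k) ∧ uval g = x := by
  constructor
  · rintro ⟨_, ⟨_, rfl, a, ha, rfl⟩, _, rfl, rfl⟩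
    obtain ⟨k, hk⟩ := c.mem_supp_cyclicMean.1 ha
    obtain ⟨g, hg⟩ := c.exists_unit hk
    refine ⟨k, g, ?_, hg⟩
    rw [hg]
    exact c.mul_mem_phase_right (c.mul_mem_phase_left c.e_mem hk) c.e_mem
  · rintro ⟨k, g, hg, rfl⟩
    exact ⟨_, ⟨_, rfl, _, c.mem_supp_cyclicMean.2 ⟨k, hg⟩, rfl⟩, _, rfl,
      by simp only [mul_uval, uval_mul_self]⟩

end IsCore

/-! ### Uniform laws on `H` -/

namespace IsCore

open scoped Classical

variable {V : Type*} [Finite V] {μ η : Measure (Function.End V)} {e : Function.End V}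
  [IsProbabilityMeasure μ] [IsProbabilityMeasure η] [he : Fact (IsIdempotentElem e)]

/-- The uniform law on the group `e · supp(η) · e`. -/
noncomputable abbrev haar (η : Measure (Function.End V)) (e : Function.End V) :
    Measure (Function.End V) :=
  uniformOn (groupFactor η e)

omit he in
theorem haar_real_singleton (x : Function.End V) :
    (haar η e).real {x} = if x ∈ groupFactor η e then ((groupFactor η e).ncard : ℝ)⁻¹ else 0 := by
  rw [measureReal_def, show haar η e = cond Measure.count (groupFactor η e) from rfl,
    cond_apply .of_discrete, Measure.count_apply .of_discrete,
    Measure.count_apply .of_discrete]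
  split_ifs with h
  · rw [Set.inter_eq_right.2 (Set.singleton_subset_iff.2 h)]
    simp only [Set.encard_singleton, ENat.toENNReal_one, mul_one, ENNReal.toReal_inv]
    rw [← (Set.toFinite (groupFactor η e)).cast_ncard_eq, ENat.toENNReal_coe,
      ENNReal.toReal_natCast]
  · rw [Set.inter_singleton_eq_empty.2 h]
    simp

variable (c : IsCore μ η e)
include c

theorem haar_prob : IsProbabilityMeasure (haar η e) :=
  isProbabilityMeasure_uniformOn (Set.toFinite _) ⟨e, c.mem_groupFactor.2 ⟨1, c.e_mem, rfl⟩⟩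

theorem supp_haar : supp (haar η e) = groupFactor η e := by
  have := c.haar_prob
  ext x
  rw [mem_supp_iff, haar_real_singleton]
  have h1 : e ∈ groupFactor η e := c.mem_groupFactor.2 ⟨1, c.e_mem, rfl⟩
  have h2 : 0 < (groupFactor η e).ncard := (Set.ncard_pos).2 ⟨e, h1⟩
  split_ifs with h <;> simp [h, h2]

theorem haar_real_uval {g : (Corner e)ˣ} (hg : g ∈ c.subgroup) :
    (haar η e).real {uval g} = ((groupFactor η e).ncard : ℝ)⁻¹ := by
  rw [haar_real_singleton, if_pos (c.mem_groupFactor.2 ⟨g, hg, rfl⟩)]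

noncomputable instance subgroupFintype : Fintype c.subgroup := Fintype.ofFinite _

theorem rep_haar : rep (haar η e) =
    ((groupFactor η e).ncard : ℝ)⁻¹ • ∑ g : c.subgroup, pt (uval g.1) := by
  have := c.haar_prob
  have hinj : Function.Injective fun g : c.subgroup => uval g.1 :=
    fun g h hgh => Subtype.ext (uval_injective hgh)
  rw [rep_eq_sum, Finset.smul_sum]
  have h : ∑ z ∈ Finset.univ.image (fun g : c.subgroup => uval g.1), (haar η e).real {z} • pt z =
      ∑ z, (haar η e).real {z} • pt z := by
    refine Finset.sum_subset (Finset.subset_univ _) fun z _ hz => ?_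
    rw [haar_real_singleton, if_neg, zero_smul]
    intro h
    obtain ⟨g, hg, rfl⟩ := c.mem_groupFactor.1 h
    exact hz (Finset.mem_image.2 ⟨⟨g, hg⟩, Finset.mem_univ _, rfl⟩)
  rw [← h, Finset.sum_image fun a _ b _ hab => hinj hab]
  exact Finset.sum_congr rfl fun g _ => by rw [c.haar_real_uval g.2]

theorem pt_mul_haar {g : (Corner e)ˣ} (hg : g ∈ c.subgroup) :
    pt (uval g) * rep (haar η e) = rep (haar η e) := by
  rw [c.rep_haar, mul_smul_comm, Finset.mul_sum]
  congr 1
  exact Fintype.sum_equiv (Equiv.mulLeft ⟨g, hg⟩) _ _ fun h => by rw [← pt_mul]; rfl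

theorem haar_mul_pt {g : (Corner e)ˣ} (hg : g ∈ c.subgroup) :
    rep (haar η e) * pt (uval g) = rep (haar η e) := by
  rw [c.rep_haar, smul_mul_assoc, Finset.sum_mul]
  congr 1
  exact Fintype.sum_equiv (Equiv.mulRight ⟨g, hg⟩) _ _ fun h => by rw [← pt_mul]; rfl

/-- The uniform law on the group is invariant under conjugation by the elements of
`e · supp(μᵏ η) · e`. -/
theorem haar_mul_pt_comm {k : ℕ} {g : (Corner e)ˣ} (hg : uval g ∈ supp (phase μ η k)) :
    rep (haar η e) * pt (uval g) = pt (uval g) * rep (haar η e) := by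
  rw [c.rep_haar, smul_mul_assoc, mul_smul_comm, Finset.sum_mul, Finset.mul_sum]
  congr 1
  refine Fintype.sum_equiv ⟨fun h : c.subgroup => ⟨g⁻¹ * h.1 * g, c.inv_conj_mem hg h.2⟩,
    fun h : c.subgroup => ⟨g * h.1 * g⁻¹, c.conj_mem hg h.2⟩,
    fun h => Subtype.ext (by simp [mul_assoc]), fun h => Subtype.ext (by simp [mul_assoc])⟩
    _ _ fun h => ?_
  rw [← pt_mul, ← pt_mul, ← uval_mul, ← uval_mul]
  simp [mul_assoc]

theorem haar_mul_self : rep (haar η e) * rep (haar η e) = rep (haar η e) := by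
  have := c.haar_prob
  have h := mul_rep_mul_eq (κ := haar η e) (A := 1) (B := rep (haar η e)) (C := rep (haar η e)) ?_
  · rwa [one_mul] at h
  · intro z hz
    rw [c.supp_haar] at hz
    obtain ⟨g, hg, rfl⟩ := c.mem_groupFactor.1 hz
    rw [one_mul, c.pt_mul_haar hg]

omit c in
theorem pt_e_mul_self : pt e * pt e = pt e := by rw [← pt_mul, he.out]

theorem exists_unit_of_mem {z : Function.End V} (hz : z ∈ supp η) :
    ∃ g ∈ c.subgroup, uval g = e * z * e := by
  obtain ⟨g, hg⟩ := c.exists_unit (k := 0) ((mem_phase_zero μ).2 hz)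
  exact ⟨g, by rw [mem_subgroup, hg]; exact c.mul_mem (c.mul_mem c.e_mem hz) c.e_mem, hg⟩

theorem haar_mul_corner {z : Function.End V} (hz : z ∈ supp η) :
    rep (haar η e) * (pt e * pt z * pt e) = rep (haar η e) := by
  obtain ⟨g, hg, h⟩ := c.exists_unit_of_mem hz
  rw [← pt_mul, ← pt_mul, ← h, c.haar_mul_pt hg]

theorem corner_mul_haar {z : Function.End V} (hz : z ∈ supp η) :
    (pt e * pt z * pt e) * rep (haar η e) = rep (haar η e) := by
  obtain ⟨g, hg, h⟩ := c.exists_unit_of_mem hz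
  rw [← pt_mul, ← pt_mul, ← h, c.pt_mul_haar hg]

/-- `e η e` is the uniform law on the group `e · supp(η) · e`. -/
theorem corner_eq_haar : pt e * rep η * pt e = rep (haar η e) := by
  have := c.haar_prob
  set τ := pt e * rep η * pt e with hτ
  have h1 : τ * rep (haar η e) = rep (haar η e) := by
    have := mul_rep_mul_eq (κ := η) (A := pt e) (B := pt e * rep (haar η e))
      (C := rep (haar η e)) fun z hz => by rw [← mul_assoc, c.corner_mul_haar hz]
    rw [hτ, mul_assoc, this]
  have h2 : τ * rep (haar η e) * τ = τ := by
    refine mul_rep_mul_eq fun z hz => ?_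
    rw [c.supp_haar] at hz
    obtain ⟨g, hg, rfl⟩ := c.mem_groupFactor.1 hz
    calc τ * pt (uval g) * τ = pt e * (rep η * pt (e * uval g * e) * rep η) * pt e := by
          simp only [hτ, pt_mul, mul_assoc]
      _ = τ := by rw [mul_uval, uval_mul_self, sandwich c.idem hg]
  have h3 : rep (haar η e) * τ = rep (haar η e) := by
    have := mul_rep_mul_eq (κ := η) (A := rep (haar η e) * pt e) (B := pt e)
      (C := rep (haar η e)) fun z hz => by
        rw [mul_assoc, mul_assoc, ← mul_assoc (pt e), c.haar_mul_corner hz]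
    rw [hτ, ← mul_assoc, ← mul_assoc, this]
  rw [h1, h3] at h2
  exact h2.symm

/-- `η e = η^L ω_H`, by absorbing the unit `(e z e)⁻¹` of `H` into `ω_H`. -/
theorem rep_mul_pt_e : rep η * pt e = rep (η.map (leftPart e)) * rep (haar η e) := by
  have h1 : rep η * pt e = rep η * pt e * rep (haar η e) := by
    calc rep η * pt e = rep η * pt e * rep η * pt e := by rw [sandwich c.idem c.e_mem]
      _ = rep η * (pt e * pt e) * rep η * pt e := by rw [pt_e_mul_self]
      _ = rep η * pt e * (pt e * rep η * pt e) := by simp only [mul_assoc]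
      _ = _ := by rw [c.corner_eq_haar]
  rw [h1, rep_map, rep_eq_sum, Finset.sum_mul, Finset.sum_mul, Finset.sum_mul]
  refine Finset.sum_congr rfl fun z _ => ?_
  by_cases hz : z ∈ supp η
  · obtain ⟨g, hg, h⟩ := c.exists_unit_of_mem hz
    rw [leftPart, ← h, localInv_uval, pt_mul, smul_mul_assoc, smul_mul_assoc, smul_mul_assoc,
      mul_assoc _ (pt (uval g⁻¹)), c.pt_mul_haar (c.inv_mem hg), pt_mul]
  · simp [real_eq_zero_of_notMem_supp hz]

/-- `e η = ω_H η^R`. -/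
theorem pt_e_mul_rep : pt e * rep η = rep (haar η e) * rep (η.map (rightPart e)) := by
  have h1 : pt e * rep η = rep (haar η e) * (pt e * rep η) := by
    calc pt e * rep η = pt e * (rep η * pt e * rep η) := by rw [sandwich c.idem c.e_mem]
      _ = pt e * (rep η * (pt e * pt e) * rep η) := by rw [pt_e_mul_self]
      _ = (pt e * rep η * pt e) * (pt e * rep η) := by simp only [mul_assoc]
      _ = _ := by rw [c.corner_eq_haar]
  rw [h1, rep_map, rep_eq_sum η, Finset.mul_sum, Finset.mul_sum, Finset.mul_sum]
  refine Finset.sum_congr rfl fun z _ => ?_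
  by_cases hz : z ∈ supp η
  · obtain ⟨g, hg, h⟩ := c.exists_unit_of_mem hz
    rw [rightPart, ← h, localInv_uval, pt_mul, mul_smul_comm, mul_smul_comm, mul_smul_comm,
      ← mul_assoc (rep (haar η e)) (pt (uval g⁻¹)), c.haar_mul_pt (c.inv_mem hg), pt_mul]
  · simp [real_eq_zero_of_notMem_supp hz]

/-- Inserting a point of the support of `η` before `e` does not change `η e`. -/
theorem rep_mul_pt_mul_pt_e {z : Function.End V} (hz : z ∈ supp η) :
    rep η * pt z * pt e = rep η * pt e := by
  have h : rep (haar η e) * (pt e * rep η * pt z * pt e) = rep (haar η e) := by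
    have := mul_rep_mul_eq (κ := η) (A := rep (haar η e) * pt e) (B := pt z * pt e)
      (C := rep (haar η e)) fun x hx => by
        refine Eq.trans ?_ (c.haar_mul_corner (c.mul_mem hx hz))
        simp only [mul_assoc, pt_mul]
    refine Eq.trans ?_ this
    simp only [mul_assoc]
  calc rep η * pt z * pt e = rep η * pt e * rep η * pt z * pt e := by
        rw [sandwich c.idem c.e_mem]
    _ = rep η * (pt e * pt e) * rep η * pt z * pt e := by rw [pt_e_mul_self]
    _ = rep η * pt e * (pt e * rep η * pt z * pt e) := by simp only [mul_assoc]
    _ = rep η * pt e := by rw [c.rep_mul_pt_e, mul_assoc, h]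

/-- `μᵏ η = η^L g ω_H η^R` for every `g` in `e · supp(μᵏ η) · e`. -/
theorem rep_phase_eq_mul {k : ℕ} {g : (Corner e)ˣ} (hg : uval g ∈ supp (phase μ η k)) :
    rep (phase μ η k) = rep (η.map (leftPart e)) *
      (pt (uval g) * (rep (haar η e) * rep (η.map (rightPart e)))) := by
  rw [← c.mul_pt_mul_eq_phase hg]
  have : pt (uval g) = pt e * pt (uval g) * pt e := by
    rw [← pt_mul, ← pt_mul, mul_uval, uval_mul_self]
  rw [this]
  calc rep η * (pt e * pt (uval g) * pt e) * rep η
      = (rep η * pt e) * pt (uval g) * (pt e * rep η) := by simp only [mul_assoc]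
    _ = rep (η.map (leftPart e)) * (rep (haar η e) * pt (uval g)) * (rep (haar η e) *
          rep (η.map (rightPart e))) := by
        rw [c.rep_mul_pt_e, c.pt_e_mul_rep]; simp only [mul_assoc]
    _ = _ := by
        rw [c.haar_mul_pt_comm hg, ← this, mul_assoc, mul_assoc, ← mul_assoc (rep (haar η e)),
          c.haar_mul_self]

end IsCore

/-! ### Left parts -/

namespace IsCore

open scoped Classical

variable {V : Type*} [Finite V] {μ η : Measure (Function.End V)} {e : Function.End V}
  [IsProbabilityMeasure μ] [IsProbabilityMeasure η] [he : Fact (IsIdempotentElem e)]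

theorem leftPart_eq {z : Function.End V} {g : (Corner e)ˣ} (hg : uval g = e * z * e) :
    leftPart e z = z * e * uval g⁻¹ := by
  rw [leftPart, ← hg, localInv_uval]

variable (c : IsCore μ η e)
include c

theorem mul_e_mem_phase {k : ℕ} {z : Function.End V} (hz : z ∈ supp (phase μ η k)) :
    z * e ∈ supp (phase μ η k) :=
  c.mul_mem_phase_right hz c.e_mem

theorem exists_unit_phase {k : ℕ} {z : Function.End V} (hz : z ∈ supp (phase μ η k)) :
    ∃ g : (Corner e)ˣ, uval g ∈ supp (phase μ η k) ∧ uval g = e * z * e := by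
  obtain ⟨g, hg⟩ := c.exists_unit hz
  exact ⟨g, hg ▸ c.mul_e_mem_phase (c.mul_mem_phase_left c.e_mem hz), hg⟩

theorem mem_leftIdempotents {l : Function.End V} :
    l ∈ leftIdempotents η e ↔ l ∈ supp η ∧ l * e = l ∧ e * l = e := by
  constructor
  · rintro ⟨h, hl⟩
    rw [Set.mul_singleton] at h
    obtain ⟨a, ha, h⟩ := h
    have h1 : l ∈ supp η := h ▸ c.mul_mem ha c.e_mem
    have h2 : l * e = l := by rw [← h, mul_assoc, he.out]
    refine ⟨h1, h2, ?_⟩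
    obtain ⟨g, -, hg⟩ := c.exists_unit_of_mem h1
    have h3 : e * l = uval g := by rw [hg, mul_assoc, h2]
    have h4 : g * g = g := by
      refine uval_injective ?_
      rw [uval_mul, ← h3, mul_assoc, ← mul_assoc l, h2, hl]
    rw [h3, mul_eq_left.1 h4, uval_one]
  · rintro ⟨h1, h2, h3⟩
    refine ⟨⟨l, h1, e, rfl, h2⟩, ?_⟩
    calc l * l = l * (e * l) := by rw [← mul_assoc, h2]
      _ = l := by rw [h3, h2]

theorem leftPart_mem {k : ℕ} {z : Function.End V} (hz : z ∈ supp (phase μ η k)) :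
    leftPart e z ∈ leftIdempotents η e := by
  obtain ⟨g, hgk, hg⟩ := c.exists_unit_phase hz
  obtain ⟨j, hj, hgj⟩ := c.exists_inv_mem_phase hgk
  rw [leftPart_eq hg, c.mem_leftIdempotents]
  refine ⟨?_, by rw [mul_assoc, uval_mul_self], ?_⟩
  · rw [← hj]
    exact c.mul_mem_phase (c.mul_e_mem_phase hz) hgj
  · rw [← mul_assoc, ← mul_assoc, ← hg, ← uval_mul, mul_inv_cancel, uval_one]

omit c in
theorem leftPart_mul_corner {z : Function.End V} {g : (Corner e)ˣ} (hg : uval g = e * z * e) :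
    leftPart e z * uval g = z * e := by
  rw [leftPart_eq hg, mul_assoc, ← uval_mul, inv_mul_cancel, uval_one, mul_assoc, he.out]

/-- The identity `η δ_e η = η` allows `e` to be inserted into a factorization. -/
theorem exists_mul_e_mul {k : ℕ} {z : Function.End V} (hz : z ∈ supp (phase μ η k)) :
    ∃ a ∈ supp (phase μ η k), ∃ b ∈ supp η, z = a * e * b := by
  have h : phase μ η k = ((phase μ η k).mconv (Measure.dirac e)).mconv η := by
    refine rep_injective ?_
    rw [rep_mconv, rep_mconv, rep_dirac]
    conv_lhs => rw [rep_phase, ← sandwich c.idem c.e_mem]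
    rw [rep_phase]
    simp only [mul_assoc]
  rw [h, supp_mconv, supp_mconv, supp_dirac] at hz
  obtain ⟨_, ⟨a, ha, _, rfl, rfl⟩, b, hb, rfl⟩ := hz
  exact ⟨a, ha, b, hb, rfl⟩

/-- The Rees factorization `z = z e (e z e)⁻¹ e z`. -/
theorem leftPart_mul_e_mul {k : ℕ} {z : Function.End V} (hz : z ∈ supp (phase μ η k)) :
    leftPart e z * (e * z) = z := by
  obtain ⟨a, ha, b, hb, rfl⟩ := c.exists_mul_e_mul hz
  obtain ⟨g, hg⟩ := c.exists_unit ha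
  obtain ⟨h, -, hh⟩ := c.exists_unit_of_mem hb
  have hgh : uval (g * h) = e * (a * e * b) * e := by
    rw [uval_mul, hg, hh]
    simp only [← mul_assoc]
    rw [mul_assoc _ e e, he.out]
  have hee : ∀ x, e * (e * x) = e * x := fun x => by rw [← mul_assoc, he.out]
  rw [leftPart_eq hgh, mul_inv_rev, uval_mul]
  calc a * e * b * e * (uval h⁻¹ * uval g⁻¹) * (e * (a * e * b))
      = a * ((e * b * e) * uval h⁻¹) * (uval g⁻¹ * (e * a * e)) * (e * b) := by
        simp only [mul_assoc, hee]
    _ = a * e * b := by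
        rw [← hg, ← hh, ← uval_mul, ← uval_mul, mul_inv_cancel, inv_mul_cancel, uval_one]
        simp only [mul_assoc, hee]

/-- The left part of a product is that of its first factor. -/
theorem leftPart_mul {j k : ℕ} {z x : Function.End V} (hz : z ∈ supp (phase μ η j))
    (hx : x ∈ supp (phase μ η k)) : leftPart e (z * x) = leftPart e z := by
  obtain ⟨g, hg⟩ := c.exists_unit (c.mul_mem_phase hz hx)
  rw [leftPart_eq hg]
  conv_lhs => rw [← c.leftPart_mul_e_mul hz]
  calc leftPart e z * (e * z) * x * e * uval g⁻¹
      = leftPart e z * ((e * (z * x) * e) * uval g⁻¹) := by simp only [mul_assoc]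
    _ = leftPart e z * e := by rw [← hg, ← uval_mul, mul_inv_cancel, uval_one]
    _ = leftPart e z := ((c.mem_leftIdempotents.1 (c.leftPart_mem hz)).2.1)

/-! ### Maps of minimal rank -/

omit c he in
theorem rank_mul_le (f g : Function.End V) :
    (Set.range fun v : V => (f * g) • v).ncard ≤ (Set.range fun v : V => g • v).ncard := by
  have : (Set.range fun v : V => (f * g) • v) =
      (fun v => f • v) '' Set.range fun v : V => g • v := by
    rw [← Set.range_comp]
    simp only [Function.comp_def, mul_smul]
  rw [this]
  exact Set.ncard_image_le (Set.toFinite _)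

omit c he in
theorem rank_mul_le' (f g : Function.End V) :
    (Set.range fun v : V => (f * g) • v).ncard ≤ (Set.range fun v : V => f • v).ncard := by
  refine Set.ncard_le_ncard ?_ (Set.toFinite _)
  rintro _ ⟨v, rfl⟩
  exact ⟨g • v, (mul_smul f g v).symm⟩

theorem supp_convPow_subset (n : ℕ) : supp (convPow μ (n + 1)) ⊆ semigroupOf μ := by
  induction n with
  | zero =>
    intro z hz
    rw [convPow, supp_mconv, convPow, supp_dirac] at hz
    obtain ⟨a, ha, _, rfl, rfl⟩ := hz
    change a * 1 ∈ semigroupOf μ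
    rw [mul_one]
    exact Subsemigroup.subset_closure ha
  | succ n ih =>
    intro z hz
    rw [convPow, supp_mconv] at hz
    obtain ⟨a, ha, b, hb, rfl⟩ := hz
    exact Subsemigroup.mul_mem _ (Subsemigroup.subset_closure ha) (ih hb)

theorem supp_subset_semigroup : supp η ⊆ semigroupOf μ := by
  intro z hz
  obtain ⟨φ, hφ, h⟩ := c.isLimit
  obtain ⟨n, hn, hn1⟩ := (((h {z}).eventually (lt_mem_nhds hz)).and
    (hφ.tendsto_atTop.eventually_ge_atTop 1)).exists
  obtain ⟨m, hm⟩ := Nat.exists_eq_succ_of_ne_zero (Nat.one_le_iff_ne_zero.1 hn1)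
  rw [hm] at hn
  exact c.supp_convPow_subset m hn

theorem supp_phase_subset_semigroup (k : ℕ) : supp (phase μ η k) ⊆ semigroupOf μ := by
  intro z hz
  cases k with
  | zero => exact c.supp_subset_semigroup ((mem_phase_zero μ).1 hz)
  | succ k =>
    rw [phase, supp_mconv] at hz
    obtain ⟨a, ha, b, hb, rfl⟩ := hz
    exact Subsemigroup.mul_mem _ (c.supp_convPow_subset k ha) (c.supp_subset_semigroup hb)

theorem exists_mul_mem_phase {g : Function.End V} (hg : g ∈ semigroupOf μ) :
    ∀ k, ∀ a ∈ supp (phase μ η k), ∃ k', g * a ∈ supp (phase μ η k') := by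
  induction hg using Subsemigroup.closure_induction with
  | mem x hx => exact fun k a ha => ⟨k + 1, c.step_mem_phase hx ha⟩
  | mul x y _ _ hx hy =>
    intro k a ha
    obtain ⟨k', h'⟩ := hy k a ha
    obtain ⟨k'', h''⟩ := hx k' _ h'
    exact ⟨k'', by rwa [mul_assoc]⟩

theorem exists_phase_add (k : ℕ) : ∃ k', phase μ η (k + k') = η := by
  refine ⟨period μ η * k - k, ?_⟩
  rw [c.phase_eq_iff_dvd, Nat.add_sub_cancel' (Nat.le_mul_of_pos_left k c.period_pos)]
  exact dvd_mul_right _ _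

omit c he in
theorem minRank_le {g : Function.End V} (hg : g ∈ semigroupOf μ) :
    minRank μ ≤ (Set.range fun v : V => g • v).ncard :=
  Nat.sInf_le ⟨g, hg, rfl⟩

/-- The maps in the supports of the laws `μᵏ η` have minimal rank. -/
theorem rank_eq {k : ℕ} {z : Function.End V} (hz : z ∈ supp (phase μ η k)) :
    (Set.range fun v : V => z • v).ncard = minRank μ := by
  refine le_antisymm ?_ (minRank_le (c.supp_phase_subset_semigroup k hz))
  obtain ⟨g, hg, hgm⟩ : minRank μ ∈
      {n | ∃ g ∈ semigroupOf μ, n = (Set.range (fun v : V => g • v)).ncard} :=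
    Nat.sInf_mem ⟨_, e, c.supp_subset_semigroup c.e_mem, rfl⟩
  obtain ⟨k', hk'⟩ := c.exists_mul_mem_phase hg 0 e ((mem_phase_zero μ).2 c.e_mem)
  obtain ⟨k'', hk''⟩ := c.exists_phase_add k'
  obtain ⟨b, hb⟩ := supp_nonempty (phase μ η k'')
  have hy : g * e * b ∈ supp η := hk'' ▸ c.mul_mem_phase hk' hb
  obtain ⟨a, -, b', hb', rfl⟩ := c.exists_mul_e_mul hz
  obtain ⟨s, -, t, -, rfl⟩ := c.exists_mul_eq hy hb'
  rw [hgm]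
  refine (rank_mul_le _ _).trans ((rank_mul_le' _ _).trans ((rank_mul_le _ _).trans ?_))
  rw [mul_assoc]
  exact rank_mul_le' _ _

/-- The maps of the semigroup are injective on the ranges of maps of minimal rank. -/
theorem injOn_range {k : ℕ} {f z : Function.End V} (hf : f ∈ semigroupOf μ)
    (hz : z ∈ supp (phase μ η k)) :
    Set.InjOn (fun v : V => f • v) (Set.range fun v : V => z • v) := by
  obtain ⟨k', h'⟩ := c.exists_mul_mem_phase hf k z hz
  refine Set.injOn_of_ncard_image_eq ?_ (Set.toFinite _)
  rw [c.rank_eq hz, ← c.rank_eq h', ← Set.range_comp]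
  simp only [Function.comp_def, mul_smul]

/-- The vectors of `e W_μ` are those with distinct entries in `eV`: maps of the semigroup are
injective on `eV`. -/
theorem mem_smul_deadlocked {x : Fin (minRank μ) → V} :
    x ∈ e • deadlocked μ (minRank μ) ↔ Function.Injective x ∧ e • x = x := by
  constructor
  · rintro ⟨y, hy, rfl⟩
    refine ⟨hy.2 e (c.supp_subset_semigroup c.e_mem), ?_⟩
    change e • e • y = e • y
    rw [← mul_smul, he.out]
  · rintro ⟨h1, h2⟩
    refine ⟨x, ⟨h1, fun f hf i j hij => h1 ?_⟩, h2⟩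
    refine c.injOn_range hf ((mem_phase_zero μ).2 c.e_mem) ⟨x i, ?_⟩ ⟨x j, ?_⟩ hij
    · exact congrFun h2 i
    · exact congrFun h2 j

/-- A vector of distinct points of `eV` enumerates `eV`, so a map is determined on `eV` by its
value at such a vector. -/
theorem mul_e_eq_of_smul_eq {x : Fin (minRank μ) → V} (hx : Function.Injective x) (hex : e • x = x)
    {f g : Function.End V} (h : f • x = g • x) : f * e = g * e := by
  have h1 : Set.range x = Set.range fun v : V => e • v := by
    refine Set.eq_of_subset_of_ncard_le ?_ ?_ (Set.toFinite _)
    · rintro _ ⟨i, rfl⟩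
      exact ⟨x i, congrFun hex i⟩
    · rw [c.rank_eq ((mem_phase_zero μ).2 c.e_mem), Set.ncard_range_of_injective hx]
      simp
  funext v
  obtain ⟨i, hi⟩ : (e • v : V) ∈ Set.range x := h1 ▸ ⟨v, rfl⟩
  have := congrFun h i
  change f (x i) = g (x i) at this
  rw [hi] at this
  exact this

theorem uval_smul_injective {k : ℕ} {g : (Corner e)ˣ} (hg : uval g ∈ supp (phase μ η k))
    {x : Fin (minRank μ) → V} (hx : Function.Injective x) (hex : e • x = x) :
    Function.Injective (uval g • x) ∧ e • uval g • x = uval g • x :=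
  ⟨((c.mem_smul_deadlocked.2 ⟨hx, hex⟩).elim fun y hy => by
      obtain ⟨hy, rfl⟩ := hy
      have := hy.2 (uval g) (c.supp_phase_subset_semigroup k hg)
      change Function.Injective (uval g • e • y)
      rwa [← mul_smul, uval_mul_self]), by rw [← mul_smul, mul_uval]⟩

/-- The group `G`: the units of `e · End(V) · e` in the supports of the laws `μᵏ η`. -/
def bigSubgroup : Subgroup (Corner e)ˣ where
  carrier := {g | ∃ k, uval g ∈ supp (phase μ η k)}
  mul_mem' := fun ⟨j, hj⟩ ⟨k, hk⟩ => ⟨j + k, c.mul_mem_phase hj hk⟩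
  one_mem' := ⟨0, (mem_phase_zero μ).2 c.e_mem⟩
  inv_mem' := fun ⟨_, hj⟩ => (c.exists_inv_mem_phase hj).imp fun _ h => h.2

theorem mem_groupFactor_cyclicMean_iff {x : Function.End V} :
    x ∈ groupFactor (cyclicMean μ η) e ↔ ∃ g ∈ c.bigSubgroup, uval g = x := by
  rw [c.mem_groupFactor_cyclicMean]
  exact ⟨fun ⟨k, g, h, h'⟩ => ⟨g, ⟨k, h⟩, h'⟩, fun ⟨g, ⟨k, h⟩, h'⟩ => ⟨k, g, h, h'⟩⟩

/-! ### Orbit representatives and the existence of a frame -/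

/-- The orbit equivalence of the group on the vectors of `eV` with distinct entries. -/
def orbitSetoid : Setoid {x : Fin (minRank μ) → V // Function.Injective x ∧ e • x = x} where
  r x y := ∃ g ∈ c.bigSubgroup, uval g • x.1 = y.1
  iseqv :=
    ⟨fun x => ⟨1, one_mem _, x.2.2⟩,
      fun {x y} ⟨g, hg, h⟩ => ⟨g⁻¹, c.bigSubgroup.inv_mem hg, by
        rw [← h, ← mul_smul, ← uval_mul, inv_mul_cancel, uval_one, x.2.2]⟩,
      fun {x y z} ⟨g, hg, h⟩ ⟨g', hg', h'⟩ => ⟨g' * g, c.bigSubgroup.mul_mem hg' hg, by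
        rw [uval_mul, mul_smul, h, h']⟩⟩

/-- Uniqueness of the factors in `f g w`, if `w` and `w'` represent orbits of `G`. -/
theorem smul_inj {f f' : Function.End V} {g g' : (Corner e)ˣ} {w w' : Fin (minRank μ) → V}
    (hf : f ∈ leftIdempotents η e) (hf' : f' ∈ leftIdempotents η e)
    (hg : g ∈ c.bigSubgroup) (hew : e • w = w) (hw : Function.Injective w)
    (hew' : e • w' = w')
    (hww : ∀ a ∈ c.bigSubgroup, uval a • w = w' → w = w') (hg' : g' ∈ c.bigSubgroup)
    (h : (f * uval g) • w = (f' * uval g') • w') : f = f' ∧ g = g' ∧ w = w' := by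
  rw [c.mem_leftIdempotents] at hf hf'
  have h1 : uval g • w = uval g' • w' := by
    have := congrArg (e • ·) h
    simp only [← mul_smul, ← mul_assoc, hf.2.2, hf'.2.2, mul_uval] at this
    exact this
  have h2 : w = w' := by
    refine hww (g'⁻¹ * g) (c.bigSubgroup.mul_mem (c.bigSubgroup.inv_mem hg') hg) ?_
    rw [uval_mul, mul_smul, h1, ← mul_smul, ← uval_mul, inv_mul_cancel, uval_one, hew']
  subst h2
  have h3 : g = g' := by
    have := c.mul_e_eq_of_smul_eq hw hew h1
    rw [uval_mul_self, uval_mul_self] at this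
    exact uval_injective this
  subst h3
  refine ⟨?_, rfl, rfl⟩
  obtain ⟨k, hk⟩ := hg
  obtain ⟨h4, h5⟩ := c.uval_smul_injective hk hw hew
  have := c.mul_e_eq_of_smul_eq h4 h5 (f := f) (g := f') (by rw [← mul_smul, ← mul_smul, h])
  rwa [hf.2.1, hf'.2.1] at this

end IsCore

theorem exists_idempotent_mem_supp {V : Type*} [Finite V] {η : Measure (Function.End V)}
    [IsProbabilityMeasure η] (h : η.mconv η = η) : ∃ e ∈ supp η, IsIdempotentElem e := by
  let _ : TopologicalSpace (Function.End V) := ⊥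
  have : DiscreteTopology (Function.End V) := ⟨rfl⟩
  exact exists_idempotent_in_compact_subsemigroup (fun r => continuous_of_discreteTopology)
    (supp η) (supp_nonempty η) (Set.toFinite _).isCompact fun x hx y hy => by
      rw [← h, supp_mconv]
      exact Set.mul_mem_mul hx hy

theorem frame_nonempty {V : Type*} [Finite V] (μ : Measure (Function.End V))
    [IsProbabilityMeasure μ] : Nonempty (Frame μ) := by
  obtain ⟨η, hlim, hidem⟩ := exists_idempotent_limit μ
  have := hlim.isProbabilityMeasure
  obtain ⟨e, he, hee⟩ := exists_idempotent_mem_supp hidem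
  have : Fact (IsIdempotentElem e) := ⟨hee⟩
  have c : IsCore μ η e := ⟨hlim, hidem, he⟩
  obtain ⟨a, ha⟩ := supp_nonempty (phase μ η 1)
  obtain ⟨γ, hγ, -⟩ := c.exists_unit_phase ha
  have hG : ∀ g : c.bigSubgroup, uval g.1 ∈ groupFactor (cyclicMean μ η) e := fun g =>
    c.mem_groupFactor_cyclicMean_iff.2 ⟨g.1, g.2, rfl⟩
  set W : Set (Fin (minRank μ) → V) :=
    Set.range fun q : Quotient c.orbitSetoid => q.out.1 with hW
  have hprob := c.haar_prob
  refine ⟨⟨η, hlim, hidem, e, he, hee, uval γ,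
    c.mem_groupFactor_cyclicMean_iff.2 ⟨γ, ⟨1, hγ⟩, rfl⟩, fun k _ => ?_, W, ?_, ?_, ?_⟩⟩
  · refine rep_injective ?_
    rw [localPow_uval, zpow_natCast, rep_mconv _ (Measure.mconv _ _),
      rep_mconv _ (Measure.mconv _ _), rep_mconv _ (Measure.map _ _), rep_dirac]
    refine c.rep_phase_eq_mul (k := k) ?_
    have := c.uval_mem_phase_pow hγ k
    rwa [one_mul] at this
  · rintro _ ⟨q, rfl⟩
    exact c.mem_smul_deadlocked.2 q.out.2
  · ext x
    constructor
    · intro hx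
      rw [c.mem_smul_deadlocked] at hx
      obtain ⟨g, hg, h⟩ := @Quotient.exact _ c.orbitSetoid _ _
        (@Quotient.out_eq _ c.orbitSetoid (@Quotient.mk _ c.orbitSetoid ⟨x, hx⟩))
      exact ⟨_, hG ⟨g, hg⟩, _, ⟨_, rfl⟩, h⟩
    · rintro ⟨_, hg, _, ⟨q, rfl⟩, rfl⟩
      obtain ⟨g, ⟨k, hk⟩, rfl⟩ := c.mem_groupFactor_cyclicMean_iff.1 hg
      exact c.mem_smul_deadlocked.2 (c.uval_smul_injective hk q.out.2.1 q.out.2.2)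
  · rintro ⟨f, g, w⟩ ⟨hf, hg, ⟨q, rfl⟩⟩ ⟨f', g', w'⟩ ⟨hf', hg', ⟨q', rfl⟩⟩ h
    obtain ⟨g, hgG, rfl⟩ := c.mem_groupFactor_cyclicMean_iff.1 hg
    obtain ⟨g', hgG', rfl⟩ := c.mem_groupFactor_cyclicMean_iff.1 hg'
    obtain ⟨h1, h2, h3⟩ := c.smul_inj hf hf' hgG q.out.2.2 q.out.2.1 q'.out.2.2
      (fun a ha h => by
        have : q = q' := by
          rw [← Quotient.out_eq q, ← Quotient.out_eq q']
          exact Quotient.sound ⟨a, ha, h⟩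
        rw [this]) hgG' h
    exact Prod.ext h1 (Prod.ext (congrArg uval h2) h3)

/-! ### Coordinates in `L × G × W` -/

namespace Frame

open scoped Classical
open IsCore

variable {V : Type*} [Finite V] [Nonempty V] {μ : Measure (Function.End V)}
  [IsProbabilityMeasure μ] (F : Frame μ)

instance : IsProbabilityMeasure F.η := F.isLimit.isProbabilityMeasure

instance : Fact (IsIdempotentElem F.e) := ⟨F.e_idem⟩

theorem core : IsCore μ F.η F.e := ⟨F.isLimit, F.idem, F.e_mem⟩

theorem mem_G {x : Function.End V} : x ∈ F.G ↔ ∃ g ∈ F.core.bigSubgroup, uval g = x :=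
  F.core.mem_groupFactor_cyclicMean_iff

theorem mem_H {x : Function.End V} : x ∈ F.H ↔ ∃ g ∈ F.core.subgroup, uval g = x :=
  F.core.mem_groupFactor

theorem subgroup_le : F.core.subgroup ≤ F.core.bigSubgroup :=
  fun _ hg => ⟨0, (mem_phase_zero μ).2 hg⟩

/-- The element `γ` lies in the support of `μη`. -/
theorem γ_mem_phase : F.γ ∈ supp (phase μ F.η 1) := by
  have c := F.core
  obtain ⟨k, g, hk, hg⟩ := c.mem_groupFactor_cyclicMean.1 F.γ_mem
  rcases Nat.lt_or_ge 1 (period μ F.η) with hp | hp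
  · have h := F.γ_spec 1 hp
    have hprob := c.haar_prob
    have e1 : F.e ∈ supp (F.η.map (leftPart F.e)) := by
      refine lt_of_lt_of_le (show 0 < F.η {F.e} from c.e_mem) ?_
      rw [Measure.map_apply .of_discrete .of_discrete]
      refine measure_mono fun z (hz : z = F.e) => ?_
      change leftPart F.e z = F.e
      have : uval (1 : (Corner F.e)ˣ) = F.e * z * F.e := by
        rw [hz, F.e_idem, F.e_idem, uval_one]
      rw [leftPart_eq this, inv_one, uval_one, hz, F.e_idem, F.e_idem]
    have e2 : F.e ∈ supp (F.η.map (rightPart F.e)) := by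
      refine lt_of_lt_of_le (show 0 < F.η {F.e} from c.e_mem) ?_
      rw [Measure.map_apply .of_discrete .of_discrete]
      refine measure_mono fun z (hz : z = F.e) => ?_
      change rightPart F.e z = F.e
      have : uval (1 : (Corner F.e)ˣ) = F.e * z * F.e := by
        rw [hz, F.e_idem, F.e_idem, uval_one]
      rw [rightPart, ← this, localInv_uval, inv_one, uval_one, hz, F.e_idem, F.e_idem]
    have e3 : localPow F.e F.γ (1 : ℕ) = F.γ := by
      rw [← hg, localPow_uval, Nat.cast_one, zpow_one]
    rw [e3] at h
    rw [phase, h, supp_mconv, supp_mconv, supp_mconv, supp_dirac]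
    refine ⟨F.e, e1, F.γ, ⟨F.γ, rfl, F.e, ⟨F.e, ?_, F.e, e2, F.e_idem⟩, ?_⟩, ?_⟩
    · rw [c.supp_haar]
      exact c.mem_groupFactor.2 ⟨1, one_mem _, rfl⟩
    · change F.γ * F.e = F.γ
      rw [← hg, uval_mul_self]
    · change F.e * F.γ = F.γ
      rw [← hg, mul_uval]
  · have h1 : period μ F.η = 1 := le_antisymm hp c.period_pos
    rw [c.phase_congr (k := k) (by rw [h1]; exact Nat.modEq_one), ← hg]
    exact hk

theorem exists_gam : ∃ g : (Corner F.e)ˣ, uval g = F.γ := by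
  obtain ⟨g, -, hg⟩ := F.mem_G.1 F.γ_mem
  exact ⟨g, hg⟩

/-- The element `γ` as a unit of `e · End(V) · e`. -/
noncomputable def gam : (Corner F.e)ˣ := F.exists_gam.choose

theorem uval_gam : uval F.gam = F.γ := F.exists_gam.choose_spec

theorem gam_mem_phase : uval F.gam ∈ supp (phase μ F.η 1) := F.uval_gam ▸ F.γ_mem_phase

theorem gam_pow_mem_phase (n : ℕ) : uval (F.gam ^ n) ∈ supp (phase μ F.η n) := by
  simpa using F.core.uval_mem_phase_pow F.gam_mem_phase n

theorem gam_zpow_mem (k : ℤ) : F.gam ^ k ∈ F.core.bigSubgroup :=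
  F.core.bigSubgroup.zpow_mem ⟨1, F.gam_mem_phase⟩ k

theorem γpow_eq (k : ℤ) : F.γpow k = uval (F.gam ^ k) := by
  rw [γpow, ← F.uval_gam, localPow_uval]

theorem p_pos : 0 < F.p := F.core.period_pos

theorem conj_mem {g h : (Corner F.e)ˣ} (hg : g ∈ F.core.bigSubgroup) (hh : h ∈ F.core.subgroup) :
    g * h * g⁻¹ ∈ F.core.subgroup := by
  obtain ⟨k, hk⟩ := hg
  exact F.core.conj_mem hk hh

theorem inv_conj_mem {g h : (Corner F.e)ˣ} (hg : g ∈ F.core.bigSubgroup)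
    (hh : h ∈ F.core.subgroup) : g⁻¹ * h * g ∈ F.core.subgroup := by
  obtain ⟨k, hk⟩ := hg
  exact F.core.inv_conj_mem hk hh

/-! ### The cosets of `H` in `G` -/

theorem exists_index {g : (Corner F.e)ˣ} (hg : g ∈ F.core.bigSubgroup) :
    ∃ i < F.p, (F.gam ^ i)⁻¹ * g ∈ F.core.subgroup := by
  obtain ⟨k, hk⟩ := hg
  refine ⟨k % F.p, Nat.mod_lt _ F.p_pos, F.core.inv_mul_mem (F.gam_pow_mem_phase _) ?_⟩
  rwa [F.core.phase_congr (j := k % F.p) (k := k) (Nat.mod_modEq _ _)]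

/-- The elements of `C` are in different cosets of `H`, by minimality of the period. -/
theorem index_unique {i j : ℕ} (hi : i < F.p) (hj : j < F.p)
    (h : (F.gam ^ i)⁻¹ * F.gam ^ j ∈ F.core.subgroup) : i = j := by
  have h1 : uval (F.gam ^ j) ∈ supp (phase μ F.η i) := by
    have := F.core.mul_mem_phase_right (F.gam_pow_mem_phase i) h
    rwa [← uval_mul, mul_inv_cancel_left] at this
  have h2 := F.core.phase_eq_of_mem h1 (F.gam_pow_mem_phase j)
  rw [← iterate_eq_phase, ← iterate_eq_phase] at h2
  exact Function.iterate_injOn_Iio_minimalPeriod hi hj h2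

/-- The index `i < p` of the coset `γⁱ H` that contains `g`. -/
noncomputable def index (g : (Corner F.e)ˣ) : ℕ :=
  if h : ∃ i < F.p, (F.gam ^ i)⁻¹ * g ∈ F.core.subgroup then h.choose else 0

theorem index_lt (g : (Corner F.e)ˣ) : F.index g < F.p := by
  rw [index]
  split_ifs with h
  · exact h.choose_spec.1
  · exact F.p_pos

theorem index_spec {g : (Corner F.e)ˣ} (hg : g ∈ F.core.bigSubgroup) :
    (F.gam ^ F.index g)⁻¹ * g ∈ F.core.subgroup := by
  have h := F.exists_index hg
  rw [index, dif_pos h]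
  exact h.choose_spec.2

theorem index_eq {g : (Corner F.e)ˣ} {i : ℕ} (hi : i < F.p)
    (h : (F.gam ^ i)⁻¹ * g ∈ F.core.subgroup) : F.index g = i := by
  have h1 : ∃ i < F.p, (F.gam ^ i)⁻¹ * g ∈ F.core.subgroup := ⟨i, hi, h⟩
  have h2 := h1.choose_spec
  rw [index, dif_pos h1]
  refine F.index_unique h2.1 hi ?_
  have := F.core.subgroup.mul_mem h2.2 (F.core.subgroup.inv_mem h)
  simpa [mul_assoc] using this

/-! ### The coordinates of a vector in `LGW` -/

theorem mem_W {w : Fin (minRank μ) → V} (hw : w ∈ F.W) : Function.Injective w ∧ F.e • w = w :=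
  F.core.mem_smul_deadlocked.1 (F.W_sub hw)

/-- The set `LGW`. -/
def good : Set (Fin (minRank μ) → V) := F.prodMap '' F.box

theorem mem_good {x : Fin (minRank μ) → V} : x ∈ F.good ↔
    ∃ l ∈ F.L, ∃ g ∈ F.core.bigSubgroup, ∃ w ∈ F.W, x = (l * uval g) • w := by
  constructor
  · rintro ⟨⟨l, a, w⟩, ⟨hl, ha, hw⟩, rfl⟩
    obtain ⟨g, hg, rfl⟩ := F.mem_G.1 ha
    exact ⟨l, hl, g, hg, w, hw, rfl⟩
  · rintro ⟨l, hl, g, hg, w, hw, rfl⟩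
    exact ⟨(l, uval g, w), ⟨hl, F.mem_G.2 ⟨g, hg, rfl⟩, hw⟩, rfl⟩

theorem coord_mul_smul {l : Function.End V} (hl : l ∈ F.L) {g : (Corner F.e)ˣ}
    (hg : g ∈ F.core.bigSubgroup) {w : Fin (minRank μ) → V} (hw : w ∈ F.W) :
    F.coord ((l * uval g) • w) = (l, uval g, w) :=
  F.W_inj.leftInvOn_invFunOn
    (show (l, uval g, w) ∈ F.box from ⟨hl, F.mem_G.2 ⟨g, hg, rfl⟩, hw⟩)

/-- The coordinate `x^G` as a unit of `e · End(V) · e`. -/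
noncomputable def gU (x : Fin (minRank μ) → V) : (Corner F.e)ˣ :=
  if h : ∃ g ∈ F.core.bigSubgroup, uval g = F.xG x then h.choose else 1

theorem gU_mem (x : Fin (minRank μ) → V) : F.gU x ∈ F.core.bigSubgroup := by
  rw [gU]
  split_ifs with h
  · exact h.choose_spec.1
  · exact one_mem _

section coords

variable {l : Function.End V} {g : (Corner F.e)ˣ} {w : Fin (minRank μ) → V}

theorem xL_mul_smul (hl : l ∈ F.L) (hg : g ∈ F.core.bigSubgroup) (hw : w ∈ F.W) :
    F.xL ((l * uval g) • w) = l := by rw [xL, F.coord_mul_smul hl hg hw]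

theorem xG_mul_smul (hl : l ∈ F.L) (hg : g ∈ F.core.bigSubgroup) (hw : w ∈ F.W) :
    F.xG ((l * uval g) • w) = uval g := by rw [xG, F.coord_mul_smul hl hg hw]

theorem xW_mul_smul (hl : l ∈ F.L) (hg : g ∈ F.core.bigSubgroup) (hw : w ∈ F.W) :
    F.xW ((l * uval g) • w) = w := by rw [xW, F.coord_mul_smul hl hg hw]

theorem gU_mul_smul (hl : l ∈ F.L) (hg : g ∈ F.core.bigSubgroup) (hw : w ∈ F.W) :
    F.gU ((l * uval g) • w) = g := by
  have h : ∃ g' ∈ F.core.bigSubgroup, uval g' = F.xG ((l * uval g) • w) :=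
    ⟨g, hg, (F.xG_mul_smul hl hg hw).symm⟩
  rw [gU, dif_pos h]
  exact uval_injective (h.choose_spec.2.trans (F.xG_mul_smul hl hg hw))

end coords

theorem good_eq {x : Fin (minRank μ) → V} (hx : x ∈ F.good) :
    F.xL x ∈ F.L ∧ F.xG x = uval (F.gU x) ∧ F.xW x ∈ F.W ∧
      x = (F.xL x * uval (F.gU x)) • F.xW x := by
  obtain ⟨l, hl, g, hg, w, hw, rfl⟩ := F.mem_good.1 hx
  rw [F.xL_mul_smul hl hg hw, F.xG_mul_smul hl hg hw, F.xW_mul_smul hl hg hw,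
    F.gU_mul_smul hl hg hw]
  exact ⟨hl, rfl, hw, rfl⟩

theorem L_spec {l : Function.End V} (hl : l ∈ F.L) :
    l ∈ supp F.η ∧ l * F.e = l ∧ F.e * l = F.e := F.core.mem_leftIdempotents.1 hl

/-- A vector of distinct points in the image of a map of the support of `η` is in `LGW`. -/
theorem smul_mem_good {z : Function.End V} (hz : z ∈ supp F.η) {x : Fin (minRank μ) → V}
    (hx : Function.Injective (z • x)) : z • x ∈ F.good := by
  have c := F.core
  have hz' := (mem_phase_zero μ).2 hz
  have h1 : z = leftPart F.e z * (F.e * z) := (c.leftPart_mul_e_mul hz').symm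
  have h2 : (F.e * z) • x ∈ F.e • deadlocked μ (minRank μ) := by
    rw [c.mem_smul_deadlocked, ← mul_smul, ← mul_assoc, F.e_idem]
    refine ⟨?_, rfl⟩
    intro i j hij
    refine hx ?_
    rw [h1, mul_smul]
    change leftPart F.e z • ((F.e * z) • x) i = leftPart F.e z • ((F.e * z) • x) j
    rw [hij]
  rw [F.W_span] at h2
  obtain ⟨a, ha, w, hw, h⟩ := h2
  obtain ⟨g, hg, rfl⟩ := F.mem_G.1 ha
  refine F.mem_good.2 ⟨leftPart F.e z, c.leftPart_mem hz', g, hg, w, hw, ?_⟩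
  rw [mul_smul]
  conv_lhs => rw [h1, mul_smul, ← h]

theorem injective_of_good {x : Fin (minRank μ) → V} (hx : x ∈ F.good) : Function.Injective x := by
  obtain ⟨l, hl, g, ⟨k, hk⟩, w, hw, rfl⟩ := F.mem_good.1 hx
  obtain ⟨h1, h2⟩ := F.core.uval_smul_injective hk (F.mem_W hw).1 (F.mem_W hw).2
  intro i j hij
  refine h1 (F.core.injOn_range (F.core.supp_subset_semigroup (F.L_spec hl).1)
    ((mem_phase_zero μ).2 F.e_mem) ⟨_, congrFun h2 i⟩ ⟨_, congrFun h2 j⟩ ?_)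
  rw [mul_smul] at hij
  exact hij

theorem mul_mem_phase_of_mem_L {n : ℕ} {f l : Function.End V} (hf : f ∈ supp (convPow μ n))
    (hl : l ∈ F.L) : f * l ∈ supp (phase μ F.η n) := by
  rw [phase, supp_mconv]
  exact Set.mul_mem_mul hf (F.L_spec hl).1

/-- The action of a map on the coordinates. -/
theorem smul_coords {n : ℕ} {f : Function.End V} (hf : f ∈ supp (convPow μ n))
    {x : Fin (minRank μ) → V} (hx : x ∈ F.good) :
    ∃ h : (Corner F.e)ˣ, uval h ∈ supp (phase μ F.η n) ∧ uval h = F.e * f * F.xL x ∧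
      f • x ∈ F.good ∧ F.xL (f • x) = leftPart F.e (f * F.xL x) ∧ F.gU (f • x) = h * F.gU x ∧
      F.xW (f • x) = F.xW x := by
  obtain ⟨hl, -, hw, hx⟩ := F.good_eq hx
  obtain ⟨h, hh, he⟩ := F.core.exists_unit_phase (F.mul_mem_phase_of_mem_L hf hl)
  have h1 : f • x = (leftPart F.e (f * F.xL x) * uval (h * F.gU x)) • F.xW x := by
    conv_lhs => rw [hx]
    rw [uval_mul, ← mul_assoc, leftPart_mul_corner he, mul_assoc f, (F.L_spec hl).2.1, ← mul_smul,
      mul_assoc]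
  have h2 := F.core.leftPart_mem (F.mul_mem_phase_of_mem_L hf hl)
  have h3 : h * F.gU x ∈ F.core.bigSubgroup := mul_mem ⟨n, hh⟩ (F.gU_mem x)
  refine ⟨h, hh, ?_, ?_, ?_, ?_, ?_⟩
  · rw [he, ← mul_assoc, mul_assoc _ (F.xL x), (F.L_spec hl).2.1]
  · exact F.mem_good.2 ⟨_, h2, _, h3, _, hw, h1⟩
  · rw [h1, F.xL_mul_smul h2 h3 hw]
  · rw [h1, F.gU_mul_smul h2 h3 hw]
  · rw [h1, F.xW_mul_smul h2 h3 hw]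

/-! ### The law of `f x` for `f ∼ η` -/

instance : IsProbabilityMeasure F.ηL := Measure.isProbabilityMeasure_map (by fun_prop)

instance : IsProbabilityMeasure (uniformOn F.H) := F.core.haar_prob

theorem supp_ηL : supp F.ηL ⊆ F.L := by
  intro l hl
  rw [supp, Set.mem_ofPred_eq, ηL, Measure.map_apply .of_discrete .of_discrete] at hl
  by_contra h
  refine hl.ne' (measure_eq_zero_of_forall_notMem fun z hz hzl => h ?_)
  have hzl : leftPart F.e z = l := hzl
  rw [← hzl]
  exact F.core.leftPart_mem ((mem_phase_zero μ).2 hz)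

/-- `η^L δ_g ω_H = η δ_g` for `g ∈ G`. -/
theorem ηL_mconv_eq {g : (Corner F.e)ˣ} (hg : g ∈ F.core.bigSubgroup) :
    F.ηL.mconv ((Measure.dirac (uval g)).mconv (uniformOn F.H)) =
      F.η.mconv (Measure.dirac (uval g)) := by
  obtain ⟨k, hk⟩ := hg
  have := F.core.haar_prob
  refine rep_injective ?_
  rw [rep_mconv, rep_mconv, rep_mconv, rep_dirac]
  change _ * (_ * rep (haar F.η F.e)) = _
  rw [← F.core.haar_mul_pt_comm hk, ← mul_assoc]
  change rep (F.η.map (leftPart F.e)) * _ * _ = _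
  rw [← F.core.rep_mul_pt_e, mul_assoc, ← pt_mul, mul_uval]

theorem mconv_dirac_real (b : Function.End V) (w x : Fin (minRank μ) → V) :
    (F.η.mconv (Measure.dirac b)).real {f | f • w = x} = F.η.real {f | f • b • w = x} := by
  rw [Measure.mconv_dirac, map_measureReal_apply .of_discrete .of_discrete]
  congr 1

/-- The law of `f x`, `f ∼ η`, depends on `x ∈ LGW` only through the coset of `x^G` and `x^W`. -/
theorem real_smul_eq_of_good {x y : Fin (minRank μ) → V} (hx : x ∈ F.good) {a : (Corner F.e)ˣ}
    (ha : a ∈ F.core.bigSubgroup) (h : a⁻¹ * F.gU x ∈ F.core.subgroup) :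
    F.η.real {f | f • x = y} = F.η.real {f | f • uval a • F.xW x = y} := by
  obtain ⟨hl, -, hw, hx⟩ := F.good_eq hx
  set l := F.xL x
  set w := F.xW x
  set b := a⁻¹ * F.gU x
  have hb : F.gU x = (a * b * a⁻¹) * a := by simp [b]
  have h1 : a * b * a⁻¹ ∈ F.core.subgroup := F.conj_mem ha h
  rw [hx, ← mconv_dirac_real, ← mconv_dirac_real]
  congr 1
  refine rep_injective ?_
  rw [rep_mconv, rep_mconv, rep_dirac, rep_dirac, hb, uval_mul, ← mul_uval a, pt_mul, pt_mul,
    pt_mul, ← (F.L_spec hl).2.1, pt_mul]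
  simp only [← mul_assoc]
  rw [F.core.rep_mul_pt_mul_pt_e (F.L_spec hl).1, mul_assoc (rep F.η), ← pt_mul, mul_uval,
    F.core.rep_mul_pt_mul_pt_e h1]

/-- The law of `f γʲ y w`, `f ∼ η`, in coordinates. -/
theorem real_smul_eq_mul {l : Function.End V} (hl : l ∈ F.L) {a h : (Corner F.e)ˣ}
    (ha : a ∈ F.core.bigSubgroup) (hh : h ∈ F.core.subgroup) {w : Fin (minRank μ) → V}
    (hw : w ∈ F.W) :
    F.η.real {f | f • uval a • w = (l * uval (a * h)) • w} =
      F.ηL.real {l} * (uniformOn F.H).real {uval h} := by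
  have c := F.core
  have := c.haar_prob
  obtain ⟨k, hk⟩ := ha
  obtain ⟨hi, he⟩ := c.uval_smul_injective hk (F.mem_W hw).1 (F.mem_W hw).2
  set h' := a * h * a⁻¹ with hh'
  have hmem : h' ∈ c.subgroup := F.conj_mem ⟨k, hk⟩ hh
  have hah : a * h = h' * a := by simp [hh']
  have hset : {f : Function.End V | f • uval a • w = (l * uval (a * h)) • w} =
      {f | f * F.e = l * uval h'} := by
    ext f
    rw [Set.mem_ofPred_eq, Set.mem_ofPred_eq, hah, uval_mul, ← mul_assoc, mul_smul _ (uval a)]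
    constructor
    · intro hf
      have := c.mul_e_eq_of_smul_eq hi he hf
      rwa [mul_assoc, uval_mul_self] at this
    · intro hf
      rw [← hf, mul_smul, he]
  have h1 : F.η.real {f | f * F.e = l * uval h'} = (rep F.η * pt F.e) 1 (l * uval h') := by
    rw [← rep_dirac, ← rep_mconv, rep_one_apply, Measure.mconv_dirac,
      map_measureReal_apply .of_discrete .of_discrete]
    rfl
  rw [hset, h1, c.rep_mul_pt_e, rep_eq_sum, Finset.sum_mul, Matrix.sum_apply]
  have h2 : ∀ l' ∈ supp F.ηL, l' ≠ l →
      (pt l' * rep (haar F.η F.e)) 1 (l * uval h') = 0 := by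
    intro l' hl' hne
    rw [← rep_dirac, ← rep_mconv, rep_one_apply]
    refine real_eq_zero_of_notMem_supp fun hmem' => hne ?_
    rw [supp_mconv, supp_dirac, c.supp_haar] at hmem'
    obtain ⟨_, rfl, b, hb, hb'⟩ := hmem'
    obtain ⟨b, hbH, rfl⟩ := c.mem_groupFactor.1 hb
    have := congrArg F.xL (congrArg (· • w) hb')
    change F.xL ((_ * uval b) • w) = _ at this
    rwa [F.xL_mul_smul (F.supp_ηL hl') (F.subgroup_le hbH) hw,
      F.xL_mul_smul hl (F.subgroup_le hmem) hw] at this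
  have h3 : (pt l * rep (haar F.η F.e)) 1 (l * uval h') = (uniformOn F.H).real {uval h} := by
    rw [← rep_dirac, ← rep_mconv, rep_one_apply, Measure.dirac_mconv,
      map_measureReal_apply .of_discrete .of_discrete]
    change _ = (haar F.η F.e).real _
    rw [c.haar_real_uval hh, ← c.haar_real_uval hmem]
    refine measureReal_congr ?_
    have : ∀ᵐ z ∂(haar F.η F.e), z ∈ groupFactor F.η F.e := by
      refine measure_eq_zero_of_forall_notMem (κ := haar F.η F.e) fun z hz hz' => hz' ?_
      rwa [c.supp_haar] at hz
    filter_upwards [this] with z hz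
    obtain ⟨b, hb, rfl⟩ := c.mem_groupFactor.1 hz
    refine propext ⟨fun hb' => ?_, fun hb' => ?_⟩
    · have hb' : l * uval b = l * uval h' := hb'
      have := congrArg (F.e * ·) hb'
      simp only [← mul_assoc, (F.L_spec hl).2.2, mul_uval] at this
      exact this
    · exact congrArg (l * ·) hb'
  rw [Finset.sum_eq_single l]
  · rw [smul_mul_assoc, Matrix.smul_apply, h3]
    rfl
  · intro l' _ hne
    rw [smul_mul_assoc, Matrix.smul_apply]
    by_cases hl' : l' ∈ supp F.ηL
    · rw [h2 l' hl' hne, smul_zero]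
    · change F.ηL.real {l'} • _ = _
      rw [real_eq_zero_of_notMem_supp hl', zero_smul]
  · exact fun h => absurd (Finset.mem_univ _) h

end Frame

/-! ### Null events, windows and the Markov property -/

section NullField

variable {Ω : Type*} {mΩ : MeasurableSpace Ω} {P : Measure Ω}

theorem nullField_le : nullField P ≤ mΩ :=
  MeasurableSpace.generateFrom_le fun _ h => h.1

/-- A σ-field that contains the null events is closed under a.e. equality of events. -/
theorem measurableSet_of_ae_eq {m : MeasurableSpace Ω} (hm : m ≤ mΩ) (hn : nullField P ≤ m)
    {A B : Set Ω} (hA : MeasurableSet[m] A) (hB : MeasurableSet[mΩ] B) (h : A =ᵐ[P] B) :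
    MeasurableSet[m] B := by
  have hnull : ∀ s, MeasurableSet[mΩ] s → P s = 0 → MeasurableSet[m] s :=
    fun s hs h0 => hn s (MeasurableSpace.measurableSet_generateFrom ⟨hs, h0⟩)
  have h1 := hnull (A \ B) ((hm A hA).diff hB) (ae_le_set.1 h.le)
  have h2 := hnull (B \ A) (hB.diff (hm A hA)) (ae_le_set.1 h.symm.le)
  have : B = (A \ (A \ B)) ∪ (B \ A) := by
    ext x
    simp only [Set.mem_union, Set.mem_sdiff]
    tauto
  rw [this]
  exact (hA.diff h1).union h2

theorem measurable_of_ae_eq {α : Type*} [MeasurableSpace α] {m : MeasurableSpace Ω} (hm : m ≤ mΩ)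
    (hn : nullField P ≤ m) {f g : Ω → α} (hf : Measurable[m] f) (hg : Measurable[mΩ] g)
    (h : f =ᵐ[P] g) : Measurable[m] g :=
  fun _ hs => measurableSet_of_ae_eq hm hn (hf hs) (hg hs) (h.preimage _)

theorem generateFrom_image2_inter (m₁ m₂ : MeasurableSpace Ω) :
    m₁ ⊔ m₂ = MeasurableSpace.generateFrom
      (Set.image2 (· ∩ ·) {s | MeasurableSet[m₁] s} {s | MeasurableSet[m₂] s}) := by
  refine le_antisymm (sup_le (fun s hs => ?_) fun s hs => ?_)
    (MeasurableSpace.generateFrom_le ?_)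
  · exact MeasurableSpace.measurableSet_generateFrom
      ⟨s, hs, Set.univ, MeasurableSet.univ, Set.inter_univ s⟩
  · exact MeasurableSpace.measurableSet_generateFrom
      ⟨Set.univ, MeasurableSet.univ, s, hs, Set.univ_inter s⟩
  · rintro _ ⟨s, hs, t, ht, rfl⟩
    exact (le_sup_left (a := m₁) (b := m₂) s hs).inter (le_sup_right (a := m₁) (b := m₂) t ht)

theorem isPiSystem_image2_inter (m₁ m₂ : MeasurableSpace Ω) :
    IsPiSystem (Set.image2 (· ∩ ·) {s | MeasurableSet[m₁] s} {s | MeasurableSet[m₂] s}) := by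
  rintro _ ⟨s, hs, t, ht, rfl⟩ _ ⟨s', hs', t', ht', rfl⟩ -
  exact ⟨s ∩ s', MeasurableSet.inter hs hs', t ∩ t', MeasurableSet.inter ht ht',
    Set.inter_inter_inter_comm _ _ _ _⟩

theorem indep_sup_right_of_forall [IsProbabilityMeasure P] {m₁ m₂ m₃ : MeasurableSpace Ω}
    (h1 : m₁ ≤ mΩ) (h2 : m₂ ≤ mΩ) (h3 : m₃ ≤ mΩ)
    (h : ∀ A B C, MeasurableSet[m₁] A → MeasurableSet[m₂] B → MeasurableSet[m₃] C →
      P (A ∩ (B ∩ C)) = P A * P (B ∩ C)) : Indep m₁ (m₂ ⊔ m₃) P := by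
  refine IndepSets.indep (p1 := {s | MeasurableSet[m₁] s}) h1 (sup_le h2 h3)
    (fun s (hs : MeasurableSet[m₁] s) t (ht : MeasurableSet[m₁] t) _ => MeasurableSet.inter hs ht)
    (isPiSystem_image2_inter m₂ m₃) (@MeasurableSpace.generateFrom_measurableSet Ω m₁).symm
    (generateFrom_image2_inter m₂ m₃) ?_
  rw [IndepSets_iff]
  rintro A _ hA ⟨B, hB, C, hC, rfl⟩
  exact h A B C hA hB hC

theorem Indep.sup_right [IsProbabilityMeasure P] {m₁ m₂ m₃ : MeasurableSpace Ω}
    (h1 : m₁ ≤ mΩ) (h2 : m₂ ≤ mΩ) (h3 : m₃ ≤ mΩ) (h12 : Indep m₁ m₂ P)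
    (h123 : Indep (m₁ ⊔ m₂) m₃ P) : Indep m₁ (m₂ ⊔ m₃) P := by
  refine indep_sup_right_of_forall h1 h2 h3 fun A B C hA hB hC => ?_
  rw [Indep_iff] at h12 h123
  have hA' := le_sup_left (a := m₁) (b := m₂) A hA
  have hB' := le_sup_right (a := m₁) (b := m₂) B hB
  rw [← Set.inter_assoc, h123 _ _ (MeasurableSet.inter hA' hB') hC, h12 A B hA hB,
    h123 B C hB' hC, mul_assoc]

end NullField

section Past

variable {Ω α : Type*} [MeasurableSpace α]

theorem comap_le_past (Z : ℤ → Ω → α) {j k : ℤ} (h : j ≤ k) :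
    MeasurableSpace.comap (Z j) inferInstance ≤ past Z k :=
  le_iSup₂_of_le j h le_rfl

theorem measurable_past (Z : ℤ → Ω → α) {j k : ℤ} (h : j ≤ k) : Measurable[past Z k] (Z j) :=
  measurable_iff_comap_le.2 (comap_le_past Z h)

theorem past_mono (Z : ℤ → Ω → α) {j k : ℤ} (h : j ≤ k) : past Z j ≤ past Z k :=
  iSup₂_le fun _ hi => comap_le_past Z (hi.trans h)

theorem past_le [mΩ : MeasurableSpace Ω] {Z : ℤ → Ω → α} (h : ∀ k, Measurable (Z k)) (k : ℤ) :
    past Z k ≤ mΩ :=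
  iSup₂_le fun j _ => measurable_iff_comap_le.1 (h j)

theorem remotePast_le_past (Z : ℤ → Ω → α) (k : ℤ) : remotePast Z ≤ past Z k := iInf_le _ k

/-- The σ-field `σ(Z_j : i < j ≤ k)`. -/
@[reducible] def window (Z : ℤ → Ω → α) (i k : ℤ) : MeasurableSpace Ω :=
  ⨆ j : ℤ, ⨆ _ : i < j ∧ j ≤ k, MeasurableSpace.comap (Z j) inferInstance

theorem window_mono (Z : ℤ → Ω → α) {i i' k k' : ℤ} (hi : i' ≤ i) (hk : k ≤ k') :
    window Z i k ≤ window Z i' k' :=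
  iSup₂_le fun j hj => le_iSup₂_of_le j ⟨by omega, by omega⟩ le_rfl

theorem window_le_past (Z : ℤ → Ω → α) (i k : ℤ) : window Z i k ≤ past Z k :=
  iSup₂_le fun _ hj => comap_le_past Z hj.2

theorem measurable_window (Z : ℤ → Ω → α) {i j k : ℤ} (h1 : i < j) (h2 : j ≤ k) :
    Measurable[window Z i k] (Z j) :=
  measurable_iff_comap_le.2 (le_iSup₂_of_le j ⟨h1, h2⟩ le_rfl)

theorem window_self (Z : ℤ → Ω → α) (i : ℤ) : window Z i i = ⊥ :=
  le_bot_iff.1 (iSup₂_le fun j hj => by omega)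

theorem window_add_one (Z : ℤ → Ω → α) {i k : ℤ} (h : i ≤ k) :
    window Z i (k + 1) = window Z i k ⊔ MeasurableSpace.comap (Z (k + 1)) inferInstance := by
  refine le_antisymm (iSup₂_le fun j hj => ?_) (sup_le (window_mono Z le_rfl (by omega)) ?_)
  · rcases eq_or_lt_of_le hj.2 with rfl | h'
    · exact le_sup_right
    · exact le_sup_of_le_left (le_iSup₂_of_le j ⟨hj.1, by omega⟩ le_rfl)
  · exact le_iSup₂_of_le (k + 1) ⟨by omega, le_rfl⟩ le_rfl

theorem iSup_window (Z : ℤ → Ω → α) (k : ℤ) : ⨆ n : ℕ, window Z (k - n) k = past Z k := by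
  refine le_antisymm (iSup_le fun n => window_le_past Z _ _) (iSup₂_le fun j hj => ?_)
  refine le_iSup_of_le (k - j + 1).toNat (le_iSup₂_of_le j ⟨?_, hj⟩ le_rfl)
  omega

end Past

section Noise

open scoped Classical

variable {V : Type*} [Finite V] {Ω : Type*}

/-- The product `N_{i+n} ⋯ N_{i+1}`. -/
def noiseProd (N : ℤ → Ω → Function.End V) (i : ℤ) : ℕ → Ω → Function.End V
  | 0, _ => 1
  | n + 1, ω => N (i + n + 1) ω * noiseProd N i n ω

theorem measurable_noiseProd (N : ℤ → Ω → Function.End V) (i : ℤ) (n : ℕ) :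
    Measurable[window N i (i + n)] (noiseProd N i n) := by
  induction n with
  | zero => exact @measurable_const _ _ _ (window N i _) _
  | succ n ih =>
    have h1 : Measurable[window N i (i + (n + 1 : ℕ))] (N (i + n + 1)) :=
      measurable_window N (by omega) (by push_cast; omega)
    have h2 := ih.mono (window_mono N (i := i) (k := i + n) (k' := i + (n + 1 : ℕ)) le_rfl
      (by push_cast; omega)) le_rfl
    exact (Measurable.of_discrete (f := fun q : Function.End V × Function.End V => q.1 * q.2)).comp
      (h1.prodMk h2)

variable [MeasurableSpace V] [DiscreteMeasurableSpace V] [MeasurableSpace Ω] {m : ℕ}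
  {μ : Measure (Function.End V)} [IsProbabilityMeasure μ] {P : Measure Ω} [IsProbabilityMeasure P]
  {X : ℤ → Ω → Fin m → V} {N : ℤ → Ω → Function.End V}

namespace IsEvolution

variable (h : IsEvolution μ P X N)
include h

theorem window_le (i k : ℤ) : window N i k ≤ ‹MeasurableSpace Ω› :=
  (window_le_past N i k).trans (past_le h.measurable_N k)

/-- The noise after time `i` is independent of everything up to time `i`. -/
theorem indep_window (i : ℤ) (n : ℕ) : Indep (past X i ⊔ past N i) (window N i (i + n)) P := by
  induction n with
  | zero =>
    rw [Nat.cast_zero, add_zero, window_self]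
    exact indep_bot_right _
  | succ n ih =>
    rw [Nat.cast_add, Nat.cast_one, ← add_assoc, window_add_one N (by omega)]
    refine Indep.sup_right (sup_le (past_le h.measurable_X i) (past_le h.measurable_N i))
      (h.window_le _ _) (measurable_iff_comap_le.1 (h.measurable_N _)) ih ?_
    refine indep_of_indep_of_le_left (h.indep_past _).symm ?_
    rw [add_sub_cancel_right]
    exact sup_le (sup_le_sup (past_mono X (by omega)) (past_mono N (by omega)))
      (le_sup_of_le_right (window_le_past N _ _))

theorem map_noiseProd (i : ℤ) (n : ℕ) : P.map (noiseProd N i n) = convPow μ n := by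
  induction n with
  | zero =>
    rw [convPow]
    exact (Measure.map_const _ _).trans (by simp; rfl)
  | succ n ih =>
    have hm := (measurable_noiseProd N i n).mono (h.window_le _ _) le_rfl
    have hind : N (i + n + 1) ⟂ᵢ[P] noiseProd N i n := by
      rw [IndepFun_iff_Indep]
      refine indep_of_indep_of_le_right (h.indep_past _) ?_
      rw [add_sub_cancel_right]
      exact le_sup_of_le_right
        ((measurable_iff_comap_le.1 (measurable_noiseProd N i n)).trans (window_le_past N _ _))
    have := hind.map_mul_eq_map_mconv_map (h.measurable_N _) hm
    rw [h.law_N, ih] at this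
    exact this

theorem ae_step_supp : ∀ᵐ ω ∂P, ∀ k, X k ω = N k ω • X (k - 1) ω ∧ N k ω ∈ supp μ := by
  rw [ae_all_iff]
  intro k
  have h1 : ∀ᵐ z ∂(P.map (N k)), z ∈ supp μ := by
    rw [h.law_N]
    exact measure_eq_zero_of_forall_notMem fun z hz hz' => hz' hz
  filter_upwards [h.step k, ae_of_ae_map (h.measurable_N k).aemeasurable h1] with ω h2 h3
  exact ⟨h2, h3⟩

omit h [Finite V] [MeasurableSpace V] [DiscreteMeasurableSpace V] [MeasurableSpace Ω]
  [IsProbabilityMeasure μ] in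
theorem eq_noiseProd_smul {ω : Ω} (hω : ∀ k, X k ω = N k ω • X (k - 1) ω) (i : ℤ) (n : ℕ) :
    X (i + n) ω = noiseProd N i n ω • X i ω := by
  induction n with
  | zero => simp [noiseProd]
  | succ n ih =>
    rw [noiseProd, mul_smul, ← ih, Nat.cast_add, Nat.cast_one, ← add_assoc, hω,
      add_sub_cancel_right]

omit h [MeasurableSpace V] [DiscreteMeasurableSpace V] [MeasurableSpace Ω] in
theorem noiseProd_mem_supp {ω : Ω} (hω : ∀ k, N k ω ∈ supp μ) (i : ℤ) (n : ℕ) :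
    noiseProd N i n ω ∈ supp (convPow μ n) := by
  induction n with
  | zero => rw [convPow, supp_dirac]; rfl
  | succ n ih =>
    rw [convPow, supp_mconv]
    exact Set.mul_mem_mul (hω _) ih

/-- The Markov property over several steps. -/
theorem markov {i : ℤ} {n : ℕ} {B : Set Ω} (hB : MeasurableSet[past X i] B) (x : Fin m → V) :
    P.real (B ∩ {ω | X (i + n) ω = x}) =
      ∑ᶠ y, P.real (B ∩ {ω | X i ω = y}) * (convPow μ n).real {f | f • y = x} := by
  have : Fintype (Fin m → V) := Fintype.ofFinite _
  rw [finsum_eq_sum_of_fintype]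
  have h1 : (B ∩ {ω | X (i + n) ω = x} : Set Ω) =ᵐ[P]
      (⋃ y ∈ (Finset.univ : Finset (Fin m → V)),
        (B ∩ {ω | X i ω = y}) ∩ (noiseProd N i n ⁻¹' {f | f • y = x}) : Set Ω) := by
    rw [Filter.eventuallyEq_set]
    filter_upwards [h.ae_step_supp] with ω hω
    have := eq_noiseProd_smul (fun k => (hω k).1) i n
    simp [this]
  have hBX : ∀ y, MeasurableSet[past X i] (B ∩ {ω | X i ω = y}) := fun y =>
    MeasurableSet.inter hB (measurable_past X le_rfl (measurableSet_singleton y))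
  have hmN := measurable_noiseProd N i n
  rw [measureReal_congr h1, measureReal_biUnion_finset]
  · refine Finset.sum_congr rfl fun y _ => ?_
    have := (Indep_iff _ _ _).1 (h.indep_window i n) (B ∩ {ω | X i ω = y})
      (noiseProd N i n ⁻¹' {f | f • y = x}) (le_sup_left (a := past X i) _ (hBX y))
      (hmN .of_discrete)
    rw [measureReal_def, this, ENNReal.toReal_mul, ← h.map_noiseProd i n,
      map_measureReal_apply (hmN.mono (h.window_le _ _) le_rfl) .of_discrete]
    rfl
  · intro y _ y' _ hne
    refine Set.disjoint_left.2 fun ω hω hω' => hne ?_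
    exact hω.1.2.symm.trans hω'.1.2
  · intro y _
    exact (past_le h.measurable_X i _ (hBX y)).inter
      (hmN.mono (h.window_le _ _) le_rfl .of_discrete)

end IsEvolution

end Noise

/-! ### Regular trajectories -/

theorem eq_zero_of_forall_eq_sub_one {α : Type*} {f : ℤ → α} (h : ∀ k, f k = f (k - 1)) (k : ℤ) :
    f k = f 0 := by
  induction k using Int.induction_on with
  | zero => rfl
  | succ i ih => rw [h, add_sub_cancel_right, ih]
  | pred i ih => rw [← h, ih]

theorem convPow_one {V : Type*} [Finite V] (μ : Measure (Function.End V)) [IsProbabilityMeasure μ] :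
    convPow μ 1 = μ := Measure.mconv_dirac_one μ

namespace Frame

open scoped Classical
open IsCore

variable {V : Type*} [Finite V] [Nonempty V] {μ : Measure (Function.End V)}
  [IsProbabilityMeasure μ] (F : Frame μ) {Ω : Type*}

/-- The trajectories that stay in `LGW` and satisfy the evolution equation at all times. -/
structure Regular (X : ℤ → Ω → Fin (minRank μ) → V) (N : ℤ → Ω → Function.End V) (ω : Ω) :
    Prop where
  good : ∀ k, X k ω ∈ F.good
  step : ∀ k, X k ω = N k ω • X (k - 1) ω
  supp : ∀ k, N k ω ∈ supp μ

/-- The vectors `x ∈ LGW` with `x^G ∈ γʲ γⁱ H` and `x^W = w`. -/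
def cell (j : ℤ) (i : ℕ) (w : Fin (minRank μ) → V) : Set (Fin (minRank μ) → V) :=
  {x | x ∈ F.good ∧ (F.gam ^ j * F.gam ^ i)⁻¹ * F.gU x ∈ F.core.subgroup ∧ F.xW x = w}

/-- The representative `γⁱ`, `i < p`, of the coset of `x^G`, as a unit of `e · End(V) · e`. -/
noncomputable def cosetRep (x : Fin (minRank μ) → V) : (Corner F.e)ˣ := F.gam ^ F.index (F.gU x)

/-- The coordinate `x^W`, with an arbitrary value in `W` outside `LGW`. -/
noncomputable def wPart (x : Fin (minRank μ) → V) : Fin (minRank μ) → V :=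
  if F.xW x ∈ F.W then F.xW x else Classical.epsilon (· ∈ F.W)

/-- The `H`-part `(γᵏ y)⁻¹ x^G` of `x`, where `y` represents the coset of `x₀^G`; it is set to the
unit where this is not in `H`. -/
noncomputable def hPart (k : ℤ) (x x₀ : Fin (minRank μ) → V) : (Corner F.e)ˣ :=
  if (F.gam ^ k * F.cosetRep x₀)⁻¹ * F.gU x ∈ F.core.subgroup then
    (F.gam ^ k * F.cosetRep x₀)⁻¹ * F.gU x else 1

theorem hPart_mem (k : ℤ) (x x₀ : Fin (minRank μ) → V) : F.hPart k x x₀ ∈ F.core.subgroup := by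
  rw [hPart]
  split_ifs with h
  · exact h
  · exact one_mem _

theorem cosetRep_mem (x : Fin (minRank μ) → V) : F.cosetRep x ∈ F.core.bigSubgroup := by
  have := F.gam_zpow_mem (F.index (F.gU x))
  rwa [zpow_natCast] at this

theorem gam_pow_mul_mem (j : ℤ) (i : ℕ) : F.gam ^ j * F.gam ^ i ∈ F.core.bigSubgroup := by
  rw [← zpow_natCast, ← zpow_add]
  exact F.gam_zpow_mem _

theorem cosetRep_mem_C (x : Fin (minRank μ) → V) : uval (F.cosetRep x) ∈ F.C :=
  ⟨F.index (F.gU x), F.index_lt _, by rw [γpow_eq, zpow_natCast]; rfl⟩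

theorem mem_cell_iff {x : Fin (minRank μ) → V} (hx : x ∈ F.good) {i : ℕ} (hi : i < F.p)
    {w : Fin (minRank μ) → V} : x ∈ F.cell 0 i w ↔ F.cosetRep x = F.gam ^ i ∧ F.xW x = w := by
  rw [cell, Set.mem_ofPred_eq, zpow_zero, one_mul]
  constructor
  · rintro ⟨-, h1, h2⟩
    exact ⟨by rw [cosetRep, F.index_eq hi h1], h2⟩
  · rintro ⟨h1, h2⟩
    refine ⟨hx, ?_, h2⟩
    rw [← h1]
    exact F.index_spec (F.gU_mem x)

namespace Regular

variable {F} {X : ℤ → Ω → Fin (minRank μ) → V} {N : ℤ → Ω → Function.End V} {ω : Ω}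
  (r : F.Regular X N ω)
include r

/-- The coordinate `x^W` does not move. -/
theorem xW_eq (k : ℤ) : F.xW (X k ω) = F.xW (X 0 ω) := by
  refine eq_zero_of_forall_eq_sub_one (f := fun k => F.xW (X k ω)) (fun k => ?_) k
  obtain ⟨h, -, -, -, -, -, hW⟩ := F.smul_coords (n := 1)
    (by rw [convPow_one]; exact r.supp k) (r.good (k - 1))
  rw [r.step k, hW]

/-- The coset of `X_k^G` moves deterministically. -/
theorem coset_iff (a : (Corner F.e)ˣ) (ha : a ∈ F.core.bigSubgroup) (k : ℤ) :
    (F.gam ^ k * a)⁻¹ * F.gU (X k ω) ∈ F.core.subgroup ↔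
      a⁻¹ * F.gU (X 0 ω) ∈ F.core.subgroup := by
  have key := eq_zero_of_forall_eq_sub_one
    (f := fun k => (F.gam ^ k * a)⁻¹ * F.gU (X k ω) ∈ F.core.subgroup) (fun k => ?_) k
  · simpa using key
  obtain ⟨h, hh, -, -, -, hG, -⟩ := F.smul_coords (n := 1)
    (by rw [convPow_one]; exact r.supp k) (r.good (k - 1))
  have h1 : F.gam⁻¹ * h ∈ F.core.subgroup := F.core.inv_mul_mem F.gam_mem_phase hh
  set b := F.gam ^ (k - 1) * a with hb
  have hbm : b ∈ F.core.bigSubgroup := mul_mem (F.gam_zpow_mem _) ha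
  have h2 : F.gam ^ k * a = F.gam * b := by
    rw [hb, ← mul_assoc, ← zpow_one_add, add_sub_cancel]
  have h3 : (F.gam ^ k * a)⁻¹ * F.gU (X k ω) =
      (b⁻¹ * (F.gam⁻¹ * h) * b) * (b⁻¹ * F.gU (X (k - 1) ω)) := by
    rw [h2, r.step k, hG]
    simp [mul_assoc]
  refine propext ?_
  rw [h3]
  exact Subgroup.mul_mem_cancel_left _ (F.inv_conj_mem hbm h1)

theorem mem_cell (j : ℤ) {i : ℕ} {w : Fin (minRank μ) → V} :
    X j ω ∈ F.cell j i w ↔ X 0 ω ∈ F.cell 0 i w := by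
  have hi : F.gam ^ i ∈ F.core.bigSubgroup := ⟨i, F.gam_pow_mem_phase i⟩
  simp only [cell, Set.mem_ofPred_eq, r.good, true_and, r.xW_eq j, r.coset_iff _ hi j, zpow_zero,
    one_mul]

theorem hPart_eq (k : ℤ) :
    F.hPart k (X k ω) (X 0 ω) = (F.gam ^ k * F.cosetRep (X 0 ω))⁻¹ * F.gU (X k ω) := by
  rw [hPart, if_pos]
  rw [r.coset_iff _ (F.cosetRep_mem _)]
  exact F.index_spec (F.gU_mem _)

theorem gU_eq (k : ℤ) : F.gU (X k ω) =
    F.gam ^ k * F.cosetRep (X 0 ω) * F.hPart k (X k ω) (X 0 ω) := by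
  rw [r.hPart_eq, mul_inv_cancel_left]

theorem wPart_eq (k : ℤ) : F.wPart (X 0 ω) = F.xW (X k ω) := by
  rw [wPart, if_pos (F.good_eq (r.good 0)).2.2.1, r.xW_eq k]

theorem MG_eq (j k : ℤ) : F.MG X k j ω = uval (F.gU (X k ω) * (F.gU (X j ω))⁻¹) := by
  rw [MG, inv, (F.good_eq (r.good k)).2.1, (F.good_eq (r.good j)).2.1, localInv_uval, uval_mul]

theorem MGprod_eq (j : ℤ) (n : ℕ) :
    F.MGprod X j n ω = uval (F.gU (X (j + n) ω) * (F.gU (X j ω))⁻¹) := by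
  induction n with
  | zero => simp [MGprod, uval_one]
  | succ n ih =>
    rw [MGprod, ih, r.MG_eq, ← uval_mul, Nat.cast_add, Nat.cast_one, ← add_assoc]
    simp [mul_assoc]

end Regular

variable [MeasurableSpace V] [DiscreteMeasurableSpace V] [MeasurableSpace Ω] {P : Measure Ω}
  [IsProbabilityMeasure P] {X : ℤ → Ω → Fin (minRank μ) → V} {N : ℤ → Ω → Function.End V}

/-- The products of the noise up to time `k` reach the support of `η`, as the law of such a product
is close to `η` along a sequence of lengths. -/
theorem ae_exists_noiseProd_mem (h : IsEvolution μ P X N) :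
    ∀ᵐ ω ∂P, ∀ k, ∃ n : ℕ, noiseProd N (k - n) n ω ∈ supp F.η := by
  rw [ae_all_iff]
  intro k
  obtain ⟨φ, -, hφ⟩ := F.isLimit
  have h0 : F.η (supp F.η)ᶜ = 0 := measure_eq_zero_of_forall_notMem fun z hz hz' => hz' hz
  have hle : ∀ n, P {ω | ¬ ∃ n : ℕ, noiseProd N (k - n) n ω ∈ supp F.η} ≤
      convPow μ (φ n) (supp F.η)ᶜ := by
    intro n
    rw [← h.map_noiseProd (k - φ n) (φ n),
      Measure.map_apply ((measurable_noiseProd N _ _).mono (h.window_le _ _) le_rfl) .of_discrete]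
    exact measure_mono fun ω hω hz => hω ⟨_, hz⟩
  have := ge_of_tendsto (hφ (supp F.η)ᶜ) (Eventually.of_forall hle)
  rw [h0] at this
  exact le_antisymm this zero_le

/-- Particles that are distinct at one time are distinct at all times, as the maps that act are
injective on the images of maps of minimal rank. -/
theorem ae_regular (h : IsEvolution μ P X N)
    (hX : ∀ᵐ ω ∂P, Function.Injective (fun (i : Fin (minRank μ)) (k : ℤ) => X k ω i)) :
    ∀ᵐ ω ∂P, F.Regular X N ω := by
  filter_upwards [F.ae_exists_noiseProd_mem h, h.ae_step_supp, hX] with ω h0 h2 h3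
  have h1 : ∀ k, ∃ z ∈ supp F.η, ∃ y, X k ω = z • y := by
    intro k
    obtain ⟨n, hn⟩ := h0 k
    refine ⟨_, hn, X (k - n) ω, ?_⟩
    have := IsEvolution.eq_noiseProd_smul (fun k => (h2 k).1) (k - n) n
    rwa [sub_add_cancel] at this
  refine ⟨fun k => ?_, fun k => (h2 k).1, fun k => (h2 k).2⟩
  have h4 : ∀ a b, ∀ k, (X k ω a = X k ω b) = (X 0 ω a = X 0 ω b) := by
    intro a b
    refine eq_zero_of_forall_eq_sub_one (f := fun k => X k ω a = X k ω b) fun k => ?_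
    obtain ⟨z, hz, y, hy⟩ := h1 (k - 1)
    have hinj := F.core.injOn_range (Subsemigroup.subset_closure (h2 k).2)
      ((mem_phase_zero μ).2 hz)
    refine propext ⟨fun hab => ?_, fun hab => ?_⟩
    · refine hinj (x₁ := X (k - 1) ω a) (x₂ := X (k - 1) ω b) ⟨y a, ?_⟩ ⟨y b, ?_⟩ ?_
      · rw [hy]; rfl
      · rw [hy]; rfl
      · rw [(h2 k).1] at hab
        exact hab
    · rw [(h2 k).1]
      change N k ω • X (k - 1) ω a = N k ω • X (k - 1) ω b
      rw [hab]
  have h5 : Function.Injective (X k ω) := by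
    intro a b hab
    refine h3 (funext fun j => ?_)
    change X j ω a = X j ω b
    rw [h4 a b j, ← h4 a b k]
    exact hab
  obtain ⟨z, hz, y, hy⟩ := h1 k
  rw [hy] at h5 ⊢
  exact F.smul_mem_good hz h5

end Frame

/-! ### The law of the evolution given the remote past -/

/-- The events that, up to null events, belong to the past at every time. -/
def IsRemote {Ω α : Type*} [MeasurableSpace α] [MeasurableSpace Ω] (P : Measure Ω) (X : ℤ → Ω → α)
    (B : Set Ω) : Prop :=
  ∀ k, ∃ B', MeasurableSet[past X k] B' ∧ B =ᵐ[P] B'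

section Remote

variable {Ω α : Type*} [MeasurableSpace α] [MeasurableSpace Ω] {P : Measure Ω} {X : ℤ → Ω → α}

theorem IsRemote.inter {A B : Set Ω} (hA : IsRemote P X A) (hB : IsRemote P X B) :
    IsRemote P X (A ∩ B) := by
  intro k
  obtain ⟨A', hA', hA⟩ := hA k
  obtain ⟨B', hB', hB⟩ := hB k
  exact ⟨A' ∩ B', MeasurableSet.inter hA' hB', hA.inter hB⟩

theorem isRemote_univ : IsRemote P X Set.univ := fun _ => ⟨_, MeasurableSet.univ, ae_eq_refl _⟩

theorem isRemote_of_remotePast {B : Set Ω} (hB : MeasurableSet[remotePast X] B) :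
    IsRemote P X B :=
  fun k => ⟨B, remotePast_le_past X k B hB, ae_eq_refl B⟩

theorem IsRemote.nullMeasurableSet (hX : ∀ k, Measurable (X k)) {B : Set Ω}
    (hB : IsRemote P X B) : NullMeasurableSet B P := by
  obtain ⟨B', hB', h⟩ := hB 0
  exact ((past_le hX 0 B' hB').nullMeasurableSet).congr h.symm

/-- A family of events that determine each other up to null events, one from each past, agrees with
an event of the remote past: take the upper limit at `-∞`. -/
theorem exists_remotePast_of_ae_eq {A : ℤ → Set Ω} (hA : ∀ k, MeasurableSet[past X k] (A k))
    (h : ∀ k, A k =ᵐ[P] A 0) : ∃ B, MeasurableSet[remotePast X] B ∧ A 0 =ᵐ[P] B := by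
  refine ⟨⋂ n : ℕ, ⋃ j : ℕ, A (-(n : ℤ) - j), ?_, ?_⟩
  · rw [MeasurableSpace.measurableSet_iInf]
    intro k
    have : (⋂ n : ℕ, ⋃ j : ℕ, A (-(n : ℤ) - j)) =
        ⋂ n : ℕ, ⋃ j : ℕ, A (-((n + (-k).toNat : ℕ) : ℤ) - j) := by
      ext ω
      simp only [Set.mem_iInter, Set.mem_iUnion]
      refine ⟨fun h n => h _, fun h n => ?_⟩
      obtain ⟨j, hj⟩ := h n
      refine ⟨(-k).toNat + j, ?_⟩
      rwa [show (-(n : ℤ) - ((-k).toNat + j : ℕ)) = -((n + (-k).toNat : ℕ) : ℤ) - j by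
        push_cast; ring]
    rw [this]
    refine MeasurableSet.iInter fun n => MeasurableSet.iUnion fun j => ?_
    exact past_mono X (by omega) _ (hA _)
  · have : ∀ᵐ ω ∂P, ∀ k, ω ∈ A k ↔ ω ∈ A 0 :=
      ae_all_iff.2 fun k => Filter.eventuallyEq_set.1 (h k)
    rw [Filter.eventuallyEq_set]
    filter_upwards [this] with ω hω
    simp [hω]

end Remote

theorem sum_real_inter {Ω α : Type*} [MeasurableSpace Ω] [MeasurableSpace α]
    [DiscreteMeasurableSpace α] [Fintype α] {Q : Measure Ω} [IsFiniteMeasure Q] {f : Ω → α}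
    (hf : Measurable f) {B : Set Ω}
    (hB : NullMeasurableSet B Q) : Q.real B = ∑ a, Q.real (B ∩ {ω | f ω = a}) := by
  rw [← measureReal_biUnion_finset₀]
  · congr 1
    ext ω
    simp
  · intro y _ y' _ hne
    refine (Set.disjoint_left.2 fun ω hω hω' => hne ?_).aedisjoint
    exact hω.2.symm.trans hω'.2
  · intro y _
    exact hB.inter (hf (measurableSet_singleton y)).nullMeasurableSet

/-- The noise after time `j` is independent of the remote events and of `X_j`. -/
theorem IsEvolution.real_window_inter {V Ω : Type*} [Finite V] [MeasurableSpace V]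
    [DiscreteMeasurableSpace V] [MeasurableSpace Ω] {m : ℕ} {μ : Measure (Function.End V)}
    [IsProbabilityMeasure μ] {P : Measure Ω} [IsProbabilityMeasure P] {X : ℤ → Ω → Fin m → V}
    {N : ℤ → Ω → Function.End V} (h : IsEvolution μ P X N) {A B : Set Ω} (hB : IsRemote P X B)
    (j : ℤ) (n : ℕ) (hA : MeasurableSet[window N j (j + n)] A) (D : Set (Fin m → V)) :
    P.real (A ∩ (B ∩ X j ⁻¹' D)) = P.real A * P.real (B ∩ X j ⁻¹' D) := by
  obtain ⟨B', hB', hBB⟩ := hB j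
  have h1 : MeasurableSet[past X j] (B' ∩ X j ⁻¹' D) :=
    MeasurableSet.inter hB' (measurable_past X le_rfl .of_discrete)
  have := (Indep_iff _ _ _).1 (h.indep_window j n).symm A _ hA (le_sup_left (a := past X j) _ h1)
  have h2 := hBB.inter (ae_eq_refl (X j ⁻¹' D : Set Ω))
  rw [measureReal_congr h2, measureReal_congr ((ae_eq_refl A).inter h2), measureReal_def, this,
    ENNReal.toReal_mul]
  rfl

namespace Frame

open scoped Classical
open IsCore

variable {V : Type*} [Finite V] [Nonempty V] {μ : Measure (Function.End V)}
  [IsProbabilityMeasure μ] (F : Frame μ) {Ω : Type*} [MeasurableSpace V]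
  [DiscreteMeasurableSpace V] [MeasurableSpace Ω] {P : Measure Ω}
  [IsProbabilityMeasure P] {X : ℤ → Ω → Fin (minRank μ) → V} {N : ℤ → Ω → Function.End V}

/-- A trajectory is in the moving cell at one time if and only if it is so at all times. -/
theorem ae_eq_cell (hr : ∀ᵐ ω ∂P, F.Regular X N ω) (i : ℕ) (w : Fin (minRank μ) → V) (j : ℤ) :
    (X j ⁻¹' F.cell j i w : Set Ω) =ᵐ[P] (X 0 ⁻¹' F.cell 0 i w : Set Ω) := by
  rw [Filter.eventuallyEq_set]
  filter_upwards [hr] with ω r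
  exact r.mem_cell j

theorem exists_remotePast_cell (hr : ∀ᵐ ω ∂P, F.Regular X N ω) (i : ℕ)
    (w : Fin (minRank μ) → V) : ∃ B, MeasurableSet[remotePast X] B ∧
      (X 0 ⁻¹' F.cell 0 i w : Set Ω) =ᵐ[P] B :=
  exists_remotePast_of_ae_eq (X := X) (A := fun j => X j ⁻¹' F.cell j i w)
    (fun _ => measurable_past X le_rfl .of_discrete) fun j => F.ae_eq_cell hr i w j

theorem isRemote_cell (hr : ∀ᵐ ω ∂P, F.Regular X N ω) (i : ℕ) (w : Fin (minRank μ) → V) :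
    IsRemote P X (X 0 ⁻¹' F.cell 0 i w) :=
  fun j => ⟨X j ⁻¹' F.cell j i w, measurable_past X le_rfl .of_discrete,
    (F.ae_eq_cell hr i w j).symm⟩

/-- Given the remote past, `X_j` has the law of `f γʲ y w` with `f ∼ η`, where `y` and `w` are the
values of `Y_C` and `Z_W`: let the starting time of the Markov property tend to `-∞` along a
sequence with `μ^{φ r} → η`. -/
theorem real_inter_eq (h : IsEvolution μ P X N) {B : Set Ω}
    (hB : IsRemote P X B) (hr : ∀ᵐ ω ∂P, F.Regular X N ω) {i : ℕ} {w : Fin (minRank μ) → V}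
    (hBc : ∀ᵐ ω ∂P, ω ∈ B → X 0 ω ∈ F.cell 0 i w) (j : ℤ) (x : Fin (minRank μ) → V) :
    P.real (B ∩ {ω | X j ω = x}) =
      P.real B * F.η.real {f | f • uval (F.gam ^ j * F.gam ^ i) • w = x} := by
  have : Fintype (Fin (minRank μ) → V) := Fintype.ofFinite _
  obtain ⟨φ, hφ, hlim⟩ := F.isLimit
  have hrep : Tendsto (fun n => rep μ ^ φ n) atTop (𝓝 (rep F.η)) := by
    simpa only [rep_convPow] using tendsto_rep hlim
  set q := F.η.real {f | f • uval (F.gam ^ j * F.gam ^ i) • w = x} with hq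
  -- the Markov property
  have h1 : ∀ n : ℕ, P.real (B ∩ {ω | X j ω = x}) =
      ∑ y, P.real (B ∩ {ω | X (j - n) ω = y}) * (convPow μ n).real {f | f • y = x} := by
    intro n
    obtain ⟨B', hB', hBB⟩ := hB (j - n)
    have := h.markov (n := n) hB' x
    rw [sub_add_cancel, finsum_eq_sum_of_fintype] at this
    rw [measureReal_congr (hBB.inter (ae_eq_refl ({ω | X j ω = x} : Set Ω))), this]
    refine Finset.sum_congr rfl fun y _ => ?_
    rw [measureReal_congr (hBB.inter (ae_eq_refl ({ω | X (j - n) ω = y} : Set Ω)))]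
  -- the same sum with `η` in place of the power of `μ`
  have h2 : ∀ᶠ r in atTop,
      ∑ y, P.real (B ∩ {ω | X (j - φ r) ω = y}) * F.η.real {f | f • y = x} = P.real B * q := by
    filter_upwards [eventually_pow_mul_eq F.isLimit F.idem hφ hrep] with r hrr
    have hph : phase μ F.η (φ r) = F.η := rep_injective (by rw [rep_phase, hrr])
    have hsum : P.real B = ∑ y, P.real (B ∩ {ω | X (j - φ r) ω = y}) := by
      rw [← measureReal_biUnion_finset₀]
      · congr 1
        ext ω
        simp
      · intro y _ y' _ hne
        refine (Set.disjoint_left.2 fun ω hω hω' => hne ?_).aedisjoint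
        exact hω.2.symm.trans hω'.2
      · intro y _
        exact (hB.nullMeasurableSet h.measurable_X).inter
          (h.measurable_X _ (measurableSet_singleton y)).nullMeasurableSet
    rw [hsum, Finset.sum_mul]
    refine Finset.sum_congr rfl fun y _ => ?_
    by_cases hy : y ∈ F.cell (j - φ r) i w
    · obtain ⟨hyg, hyc, hyw⟩ := hy
      congr 1
      have hmem := F.gam_pow_mul_mem j i
      rw [hq, ← hyw]
      refine F.real_smul_eq_of_good hyg hmem ?_
      set b := F.gam ^ (j - φ r) * F.gam ^ i with hb
      have hbm : b ∈ F.core.bigSubgroup := F.gam_pow_mul_mem _ _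
      have h3 : F.gam ^ j * F.gam ^ i = F.gam ^ φ r * b := by
        rw [hb, ← mul_assoc, ← zpow_natCast F.gam (φ r), ← zpow_add, add_sub_cancel]
      have h4 : F.gam ^ φ r ∈ F.core.subgroup := by
        rw [mem_subgroup, ← hph]
        exact F.gam_pow_mem_phase _
      have h5 : (F.gam ^ j * F.gam ^ i)⁻¹ * F.gU y =
          (b⁻¹ * (F.gam ^ φ r)⁻¹ * b) * (b⁻¹ * F.gU y) := by
        rw [h3]
        simp [mul_assoc]
      rw [h5]
      exact mul_mem (F.inv_conj_mem hbm (inv_mem h4)) hyc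
    · have : P.real (B ∩ {ω | X (j - φ r) ω = y}) = 0 := by
        rw [measureReal_def, measure_mono_null (t := {ω | ¬ (ω ∈ B → X 0 ω ∈ F.cell 0 i w)} ∪
          {ω | ¬ F.Regular X N ω}), ENNReal.toReal_zero]
        · rintro ω ⟨hω, hωy⟩
          by_contra hcon
          simp only [Set.mem_union, Set.mem_ofPred_eq, not_or, not_not] at hcon
          refine hy ?_
          rw [← show X (j - φ r) ω = y from hωy, hcon.2.mem_cell]
          exact hcon.1 hω
        · exact measure_union_null hBc hr
      rw [this, zero_mul, zero_mul]
  -- the difference of the two sums tends to zero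
  have h3 : Tendsto (fun r => ∑ y, P.real (B ∩ {ω | X (j - φ r) ω = y}) *
      ((convPow μ (φ r)).real {f | f • y = x} - F.η.real {f | f • y = x})) atTop (𝓝 0) := by
    rw [← Finset.sum_const_zero (s := (Finset.univ : Finset (Fin (minRank μ) → V)))]
    refine tendsto_finsetSum _ fun y _ => ?_
    have h4 : Tendsto (fun r => |(convPow μ (φ r)).real {f | f • y = x} -
        F.η.real {f | f • y = x}|) atTop (𝓝 0) := by
      have := ((ENNReal.tendsto_toReal (measure_ne_top _ _)).comp
        (hlim {f | f • y = x})).sub_const (F.η.real {f | f • y = x})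
      rw [← measureReal_def, sub_self] at this
      simpa [measureReal_def] using this.abs
    refine squeeze_zero_norm (fun r => ?_) h4
    rw [norm_mul, Real.norm_eq_abs, Real.norm_eq_abs, abs_of_nonneg measureReal_nonneg]
    exact mul_le_of_le_one_left (abs_nonneg _) measureReal_le_one
  have h4 : Tendsto (fun _ : ℕ => P.real (B ∩ {ω | X j ω = x}) - P.real B * q) atTop (𝓝 0) := by
    refine h3.congr' ?_
    filter_upwards [h2] with r h2r
    rw [← h2r, h1 (φ r), ← Finset.sum_sub_distrib]
    simp only [mul_sub]
  have := tendsto_nhds_unique h4 tendsto_const_nhds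
  linarith

/-- The preceding law, in the coordinates of `L × G × W`. -/
theorem real_inter_coords (h : IsEvolution μ P X N) {B : Set Ω}
    (hB : IsRemote P X B) (hr : ∀ᵐ ω ∂P, F.Regular X N ω) {i : ℕ} {w : Fin (minRank μ) → V}
    (hw : w ∈ F.W) (hBc : ∀ᵐ ω ∂P, ω ∈ B → X 0 ω ∈ F.cell 0 i w) (j : ℤ) {l : Function.End V}
    (hl : l ∈ F.L) {a : (Corner F.e)ˣ} (ha : a ∈ F.core.subgroup) :
    P.real (B ∩ {ω | X j ω = (l * uval (F.gam ^ j * F.gam ^ i * a)) • w}) =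
      P.real B * (F.ηL.real {l} * (uniformOn F.H).real {uval a}) := by
  rw [F.real_inter_eq h hB hr hBc, F.real_smul_eq_mul hl (F.gam_pow_mul_mem j i) ha hw]

/-- The index `i` of the coset `γⁱ H` that contains `x^G`, and `x^W`. -/
noncomputable def label (x : Fin (minRank μ) → V) : Fin F.p × (Fin (minRank μ) → V) :=
  (⟨F.index (F.gU x), F.index_lt _⟩, F.wPart x)

omit [MeasurableSpace V] [DiscreteMeasurableSpace V] in
theorem label_mem (hW : F.W.Nonempty) (x : Fin (minRank μ) → V) : (F.label x).2 ∈ F.W := by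
  change F.wPart x ∈ F.W
  rw [wPart]
  split_ifs with h
  · exact h
  · exact Classical.epsilon_spec (p := (· ∈ F.W)) hW

theorem ae_eq_label (hr : ∀ᵐ ω ∂P, F.Regular X N ω) (i : Fin F.p) (w : Fin (minRank μ) → V) :
    ({ω | F.label (X 0 ω) = (i, w)} : Set Ω) =ᵐ[P] (X 0 ⁻¹' F.cell 0 i w : Set Ω) := by
  rw [Filter.eventuallyEq_set]
  filter_upwards [hr] with ω r
  rw [Set.mem_preimage, F.mem_cell_iff (r.good 0) i.2, ← r.wPart_eq 0]
  simp only [label, Prod.mk.injEq]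
  refine and_congr_left fun _ => ⟨fun h => ?_, fun h => ?_⟩
  · rw [cosetRep, ← h]
  · refine Fin.ext (F.index_eq i.2 ?_)
    rw [← h]
    exact F.index_spec (F.gU_mem _)

theorem measurable_label (hX : ∀ k, Measurable (X k)) :
    Measurable fun ω => F.label (X 0 ω) :=
  (Measurable.of_discrete (f := F.label)).comp (hX 0)

theorem measurable_hPart (hX : ∀ k, Measurable (X k)) (k : ℤ) :
    Measurable fun ω => uval (F.hPart k (X k ω) (X 0 ω)) := by
  refine measurable_to_countable' fun f => ?_
  have : (fun ω => uval (F.hPart k (X k ω) (X 0 ω))) ⁻¹' {f} =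
      (fun ω => (X k ω, X 0 ω)) ⁻¹' {q | uval (F.hPart k q.1 q.2) = f} := rfl
  rw [this]
  exact ((hX k).prodMk (hX 0)) .of_discrete

/-- The triple independence on a cell of the remote past. -/
theorem real_triple_of_cell (h : IsEvolution μ P X N) {A B : Set Ω}
    (hB : IsRemote P X B) (hr : ∀ᵐ ω ∂P, F.Regular X N ω) {i : ℕ} (hi : i < F.p)
    {w : Fin (minRank μ) → V}
    (hw : w ∈ F.W) (hBc : ∀ᵐ ω ∂P, ω ∈ B → X 0 ω ∈ F.cell 0 i w) (j : ℤ) (n : ℕ)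
    (hA : MeasurableSet[window N j (j + n)] A) {u : (Corner F.e)ˣ} (hu : u ∈ F.core.subgroup) :
    P.real (A ∩ B ∩ {ω | uval (F.hPart (j + n) (X (j + n) ω) (X 0 ω)) = uval u}) =
      P.real A * P.real B * (uniformOn F.H).real {uval u} := by
  have hAm := h.window_le _ _ _ hA
  have hBm := hB.nullMeasurableSet h.measurable_X
  have hNm : Measurable (noiseProd N j n) :=
    (measurable_noiseProd N j n).mono (h.window_le _ _) le_rfl
  have hUm := F.measurable_hPart h.measurable_X (j + n)
  have hLm : Measurable fun ω => F.xL (X j ω) :=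
    (Measurable.of_discrete (f := F.xL)).comp (h.measurable_X j)
  set D := {ω | uval (F.hPart (j + n) (X (j + n) ω) (X 0 ω)) = uval u} with hD
  have hDm : MeasurableSet D := hUm (measurableSet_singleton (uval u))
  have key : ∀ f l, P.real (A ∩ B ∩ D ∩ {ω | noiseProd N j n ω = f} ∩ {ω | F.xL (X j ω) = l}) =
      P.real (A ∩ {ω | noiseProd N j n ω = f}) *
        (P.real B * (F.ηL.real {l} * (uniformOn F.H).real {uval u})) := by
    intro f l
    by_cases hf : f ∈ supp (convPow μ n)
    swap
    · have h0 : P.real {ω | noiseProd N j n ω = f} = 0 := by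
        have := real_eq_zero_of_notMem_supp hf
        rwa [← h.map_noiseProd j n, map_measureReal_apply hNm .of_discrete] at this
      rw [measureReal_mono_null (Set.inter_subset_right) h0, zero_mul,
        measureReal_mono_null (fun ω hω => hω.1.2) h0]
    by_cases hl : l ∈ F.L
    swap
    · have h0 : F.ηL.real {l} = 0 := real_eq_zero_of_notMem_supp fun h => hl (F.supp_ηL h)
      rw [h0, zero_mul, mul_zero, mul_zero, measureReal_def, ENNReal.toReal_eq_zero_iff]
      refine Or.inl (measure_mono_null (t := {ω | ¬ F.Regular X N ω}) (fun ω hω hr => hl ?_) hr)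
      rw [← show F.xL (X j ω) = l from hω.2]
      exact (F.good_eq (hr.good j)).1
    -- the unique element of `H` at time `j` that is moved to `u` at time `j + n`
    obtain ⟨m, hm, hme⟩ := F.core.exists_unit_phase (F.mul_mem_phase_of_mem_L hf hl)
    set b := F.gam ^ j * F.gam ^ i with hb
    set b' := F.gam ^ (j + n) * F.gam ^ i with hb'
    have hbm : b ∈ F.core.bigSubgroup := F.gam_pow_mul_mem j i
    have hb2 : b' = F.gam ^ n * b := by
      rw [hb', hb, add_comm, zpow_add, zpow_natCast, mul_assoc]
    set a := (m * b)⁻¹ * b' * u with ha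
    have hmu : m⁻¹ * F.gam ^ n ∈ F.core.subgroup := F.core.inv_mul_mem hm (F.gam_pow_mem_phase n)
    have haH : a ∈ F.core.subgroup := by
      have : a = (b⁻¹ * (m⁻¹ * F.gam ^ n) * b) * u := by
        rw [ha, hb2]
        simp [mul_assoc]
      rw [this]
      exact mul_mem (F.inv_conj_mem hbm hmu) hu
    have hmul : m * (b * a) = b' * u := by
      rw [ha]
      simp [mul_assoc]
    have hev : (A ∩ B ∩ D ∩ {ω | noiseProd N j n ω = f} ∩ {ω | F.xL (X j ω) = l} : Set Ω) =ᵐ[P]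
        ((A ∩ {ω | noiseProd N j n ω = f}) ∩
          (B ∩ X j ⁻¹' {(l * uval (b * a)) • w}) : Set Ω) := by
      rw [Filter.eventuallyEq_set]
      filter_upwards [hr, hBc] with ω r hωc
      by_cases hωB : ω ∈ B
      swap
      · simp [hωB]
      obtain ⟨hc, hxw⟩ := (F.mem_cell_iff (r.good 0) hi).1 (hωc hωB)
      simp only [Set.mem_inter_iff, hωB, true_and, and_true, Set.mem_ofPred_eq, Set.mem_preimage,
        Set.mem_singleton_iff, hD]
      have hnoise := IsEvolution.eq_noiseProd_smul r.step j n
      have hZ : F.wPart (X 0 ω) = w := by rw [r.wPart_eq 0, hxw]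
      constructor
      · rintro ⟨⟨⟨hωA, hωu⟩, hωf⟩, hωl⟩
        refine ⟨⟨hωA, hωf⟩, ?_⟩
        obtain ⟨m', -, hm', -, -, hG, -⟩ := F.smul_coords hf (r.good j)
        have hmm : m' = m := uval_injective (by
          rw [hm', hme, hωl, ← mul_assoc, mul_assoc _ l, (F.L_spec hl).2.1])
        rw [← hωf, ← hnoise, hmm, r.gU_eq, hc, uval_injective hωu, ← hb', ← hmul] at hG
        have hx := (F.good_eq (r.good j)).2.2.2
        rw [← mul_left_cancel hG, r.xW_eq j, hxw] at hx
        rwa [← hωl]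
      · rintro ⟨⟨hωA, hωf⟩, hωx⟩
        have hba : b * a ∈ F.core.bigSubgroup := mul_mem hbm (F.subgroup_le haH)
        have hωl : F.xL (X j ω) = l := by rw [hωx, F.xL_mul_smul hl hba hw]
        have hωg : F.gU (X j ω) = b * a := by rw [hωx, F.gU_mul_smul hl hba hw]
        refine ⟨⟨⟨hωA, ?_⟩, hωf⟩, hωl⟩
        obtain ⟨m', -, hm', -, -, hG, -⟩ := F.smul_coords hf (r.good j)
        have hmm : m' = m := uval_injective (by
          rw [hm', hme, hωl, ← mul_assoc, mul_assoc _ l, (F.L_spec hl).2.1])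
        rw [← hωf, ← hnoise, hmm, hωg, hmul] at hG
        rw [r.hPart_eq, hG, hc, ← hb']
        simp
    rw [measureReal_congr hev, h.real_window_inter hB j n
      (MeasurableSet.inter hA
        (show MeasurableSet[window N j (j + n)] {ω | noiseProd N j n ω = f} from
          measurable_noiseProd N j n (measurableSet_singleton f)))]
    congr 1
    have := F.real_inter_coords h hB hr hw hBc j hl haH
    rw [F.core.haar_real_uval haH |> fun h => (show (uniformOn F.H).real {uval a} = _ from h),
      ← F.core.haar_real_uval hu] at this
    exact this
  have hABD : NullMeasurableSet (A ∩ B ∩ D) P :=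
    (hAm.nullMeasurableSet.inter hBm).inter hDm.nullMeasurableSet
  have hNs : ∀ f, MeasurableSet {ω | noiseProd N j n ω = f} :=
    fun f => hNm (measurableSet_singleton f)
  rw [sum_real_inter hNm hABD]
  calc ∑ f, P.real (A ∩ B ∩ D ∩ {ω | noiseProd N j n ω = f})
      = ∑ f, ∑ l, P.real (A ∩ {ω | noiseProd N j n ω = f}) *
        (P.real B * (F.ηL.real {l} * (uniformOn F.H).real {uval u})) := by
        refine Finset.sum_congr rfl fun f _ => ?_
        rw [sum_real_inter hLm (hABD.inter (hNs f).nullMeasurableSet)]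
        exact Finset.sum_congr rfl fun l _ => key f l
    _ = P.real A * P.real B * (uniformOn F.H).real {uval u} := by
        simp only [← Finset.mul_sum, ← Finset.sum_mul]
        rw [sum_singleton_eq_one, one_mul, ← sum_real_inter hNm hAm.nullMeasurableSet, mul_assoc]

/-- The noise up to time `k`, a remote event and `U_k` are independent. -/
theorem real_triple (h : IsEvolution μ P X N) {A B : Set Ω}
    (hB : IsRemote P X B) (hr : ∀ᵐ ω ∂P, F.Regular X N ω) (j : ℤ) (n : ℕ)
    (hA : MeasurableSet[window N j (j + n)] A) {u : (Corner F.e)ˣ} (hu : u ∈ F.core.subgroup) :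
    P.real (A ∩ B ∩ {ω | uval (F.hPart (j + n) (X (j + n) ω) (X 0 ω)) = uval u}) =
      P.real A * P.real B * (uniformOn F.H).real {uval u} := by
  have : Fintype (Fin (minRank μ) → V) := Fintype.ofFinite _
  have hAm := h.window_le _ _ _ hA
  have hBm := hB.nullMeasurableSet h.measurable_X
  set D := {ω | uval (F.hPart (j + n) (X (j + n) ω) (X 0 ω)) = uval u} with hD
  have hDm : MeasurableSet D := F.measurable_hPart h.measurable_X (j + n)
    (measurableSet_singleton (uval u))
  set g : Ω → Fin F.p × (Fin (minRank μ) → V) := fun ω => F.label (X 0 ω)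
  have hgm : Measurable g := F.measurable_label h.measurable_X
  have key : ∀ q : Fin F.p × (Fin (minRank μ) → V), P.real (A ∩ B ∩ D ∩ {ω | g ω = q}) =
      P.real A * P.real (B ∩ {ω | g ω = q}) * (uniformOn F.H).real {uval u} := by
    rintro ⟨i, w⟩
    have hev := F.ae_eq_label hr i w
    rw [Set.inter_right_comm, Set.inter_assoc A B,
      measureReal_congr ((((ae_eq_refl A).inter ((ae_eq_refl B).inter hev)).inter (ae_eq_refl D))),
      measureReal_congr ((ae_eq_refl B).inter hev)]
    by_cases hw : w ∈ F.W
    · exact F.real_triple_of_cell h (hB.inter (F.isRemote_cell hr i w)) hr i.2 hw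
        (Eventually.of_forall fun ω hω => hω.2) j n hA hu
    · have h0 : P.real (B ∩ X 0 ⁻¹' F.cell 0 i w) = 0 := by
        have : B ∩ X 0 ⁻¹' F.cell 0 i w = ∅ := by
          ext ω
          simp only [Set.mem_inter_iff, Set.mem_empty_iff_false, iff_false]
          rintro ⟨-, hω⟩
          refine hw ?_
          rw [← hω.2.2]
          exact (F.good_eq hω.1).2.2.1
        rw [this, measureReal_empty]
      rw [h0, mul_zero, zero_mul]
      exact measureReal_mono_null (fun ω hω => hω.1.2) h0
  rw [sum_real_inter hgm ((hAm.nullMeasurableSet.inter hBm).inter hDm.nullMeasurableSet),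
    sum_real_inter hgm hBm, Finset.mul_sum, Finset.sum_mul]
  exact Finset.sum_congr rfl fun q _ => key q

end Frame

/-! ### Independence and the laws of the coordinates -/

/-- Independence of three σ-fields follows from the product formula on generating π-systems that
contain the whole space. -/
theorem iIndep_of_three {Ω : Type*} {mΩ : MeasurableSpace Ω} {P : Measure Ω}
    [IsProbabilityMeasure P] {m : Fin 3 → MeasurableSpace Ω} (hm : ∀ i, m i ≤ mΩ)
    {π : Fin 3 → Set (Set Ω)} (hπ : ∀ i, IsPiSystem (π i)) (huniv : ∀ i, Set.univ ∈ π i)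
    (hgen : ∀ i, m i = MeasurableSpace.generateFrom (π i))
    (h : ∀ A ∈ π 0, ∀ B ∈ π 1, ∀ C ∈ π 2, P (A ∩ B ∩ C) = P A * P B * P C) : iIndep m P := by
  classical
  refine iIndepSets.iIndep hm π hπ hgen ((iIndepSets_iff _ _).2 fun s f hf => ?_)
  set g : Fin 3 → Set Ω := fun i => if i ∈ s then f i else Set.univ with hg
  have hgπ : ∀ i, g i ∈ π i := by
    intro i
    by_cases hi : i ∈ s
    · simpa only [hg, if_pos hi] using hf i hi
    · simpa only [hg, if_neg hi] using huniv i
  have h1 : ⋂ i ∈ s, f i = g 0 ∩ g 1 ∩ g 2 := by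
    ext ω
    simp only [Set.mem_iInter, Set.mem_inter_iff]
    have : ∀ i, ω ∈ g i ↔ (i ∈ s → ω ∈ f i) := by
      intro i
      by_cases hi : i ∈ s <;> simp [hg, hi]
    rw [this, this, this, Fin.forall_fin_succ, Fin.forall_fin_two, and_assoc]
    rfl
  have h2 : ∏ i ∈ s, P (f i) = ∏ i, P (g i) := by
    rw [← Finset.prod_subset (Finset.subset_univ s)]
    · exact Finset.prod_congr rfl fun i hi => by simp only [hg, if_pos hi]
    · intro i _ hi
      simp only [hg, if_neg hi, measure_univ]
  rw [h1, h2, h _ (hgπ 0) _ (hgπ 1) _ (hgπ 2), Fin.prod_univ_three]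

namespace Frame

open scoped Classical
open IsCore

variable {V : Type*} [Finite V] [Nonempty V] {μ : Measure (Function.End V)}
  [IsProbabilityMeasure μ] (F : Frame μ) {Ω : Type*}

/-- For `f` in the support of `η`, the map `f` moves `x^G` within a coset of `H` and leaves `x^W`
unchanged. -/
theorem smul_coords_of_mem_supp {f : Function.End V} (hf : f ∈ supp F.η) {g : (Corner F.e)ˣ}
    (hg : g ∈ F.core.bigSubgroup) {w : Fin (minRank μ) → V} (hw : w ∈ F.W) :
    ∃ h ∈ F.core.subgroup, f • uval g • w ∈ F.good ∧ F.xL (f • uval g • w) = leftPart F.e f ∧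
      F.gU (f • uval g • w) = h * g ∧ F.xW (f • uval g • w) = w := by
  have hf' := (mem_phase_zero μ).2 hf
  obtain ⟨h, hh, he⟩ := F.core.exists_unit_of_mem hf
  have h1 : f • uval g • w = (leftPart F.e f * uval (h * g)) • w := by
    rw [uval_mul, ← mul_assoc, leftPart_mul_corner he, mul_assoc, mul_uval, mul_smul]
  have h2 : leftPart F.e f ∈ F.L := F.core.leftPart_mem hf'
  have h3 : h * g ∈ F.core.bigSubgroup := mul_mem (F.subgroup_le hh) hg
  rw [h1, F.xL_mul_smul h2 h3 hw, F.gU_mul_smul h2 h3 hw, F.xW_mul_smul h2 h3 hw]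
  exact ⟨h, hh, F.mem_good.2 ⟨_, h2, _, h3, _, hw, rfl⟩, rfl, rfl, rfl⟩

/-- The random variable `Y_C`: the element of `C` that represents the coset of `X_0^G`. -/
noncomputable def yVar (X : ℤ → Ω → Fin (minRank μ) → V) (ω : Ω) : Function.End V :=
  uval (F.cosetRep (X 0 ω))

/-- The random variable `U^H_k = (γᵏ Y_C)⁻¹ X_k^G`, with an arbitrary value in `H` outside regular
trajectories. -/
noncomputable def uVar (X : ℤ → Ω → Fin (minRank μ) → V) (k : ℤ) (ω : Ω) : Function.End V :=
  uval (F.hPart k (X k ω) (X 0 ω))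

/-- The random variable `Z_W`: the coordinate `X_0^W`, which on regular trajectories is the value
of `X_k^W` for all `k`. -/
noncomputable def zVar (X : ℤ → Ω → Fin (minRank μ) → V) (ω : Ω) : Fin (minRank μ) → V :=
  F.wPart (X 0 ω)

theorem uVar_mem (X : ℤ → Ω → Fin (minRank μ) → V) (k : ℤ) (ω : Ω) : F.uVar X k ω ∈ F.H :=
  F.mem_H.2 ⟨_, F.hPart_mem _ _ _, rfl⟩

theorem yVar_eq_iff {X : ℤ → Ω → Fin (minRank μ) → V} {i : Fin F.p}
    {w : Fin (minRank μ) → V} {ω : Ω} :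
    F.yVar X ω = F.γpow (i : ℕ) ∧ F.zVar X ω = w ↔ F.label (X 0 ω) = (i, w) := by
  rw [label, Prod.mk.injEq, zVar]
  refine and_congr_left fun _ => ?_
  rw [yVar, γpow_eq, zpow_natCast, uval_injective.eq_iff, cosetRep, Fin.ext_iff]
  refine ⟨fun h => F.index_unique (F.index_lt _) i.2 ?_, fun h => by rw [← h]⟩
  rw [h, inv_mul_cancel]
  exact one_mem _

variable [MeasurableSpace V] [DiscreteMeasurableSpace V] [MeasurableSpace Ω] {P : Measure Ω}
  [IsProbabilityMeasure P] {X : ℤ → Ω → Fin (minRank μ) → V} {N : ℤ → Ω → Function.End V}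

theorem measurable_yVar (hX : ∀ k, Measurable (X k)) : Measurable (F.yVar X) :=
  (Measurable.of_discrete (f := fun x => uval (F.cosetRep x))).comp (hX 0)

theorem measurable_zVar (hX : ∀ k, Measurable (X k)) : Measurable (F.zVar X) :=
  (Measurable.of_discrete (f := F.wPart)).comp (hX 0)

theorem measurable_uVar (hX : ∀ k, Measurable (X k)) (k : ℤ) : Measurable (F.uVar X k) :=
  F.measurable_hPart hX k

/-- On a noise event intersected with a remote event, `U_k` is still uniform on `H`. -/
theorem map_restrict_uVar (h : IsEvolution μ P X N) {A B : Set Ω}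
    (hB : IsRemote P X B) (hr : ∀ᵐ ω ∂P, F.Regular X N ω) (k : ℤ) (n : ℕ)
    (hA : MeasurableSet[window N (k - n) k] A) :
    (P.restrict (A ∩ B)).map (F.uVar X k) = (P A * P B) • uniformOn F.H := by
  refine Measure.ext_of_singleton fun f => ?_
  have hU := F.measurable_uVar h.measurable_X k
  have hfin : ((P A * P B) • uniformOn F.H) {f} ≠ ⊤ := by
    rw [Measure.smul_apply, smul_eq_mul]
    exact ENNReal.mul_ne_top (ENNReal.mul_ne_top (measure_ne_top _ _) (measure_ne_top _ _))
      (measure_ne_top _ _)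
  rw [Measure.map_apply hU (measurableSet_singleton f),
    Measure.restrict_apply (hU (measurableSet_singleton f)), Set.inter_comm,
    ← ENNReal.toReal_eq_toReal_iff' (measure_ne_top _ _) hfin, Measure.smul_apply, smul_eq_mul,
    ENNReal.toReal_mul, ENNReal.toReal_mul]
  by_cases hf : f ∈ F.H
  · obtain ⟨u, hu, rfl⟩ := F.mem_H.1 hf
    have := F.real_triple h hB hr (k - n) n (by rwa [sub_add_cancel]) hu
    rw [sub_add_cancel] at this
    exact this
  · have h1 : F.uVar X k ⁻¹' {f} = ∅ := by
      ext ω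
      simp only [Set.mem_preimage, Set.mem_singleton_iff, Set.mem_empty_iff_false, iff_false]
      rintro rfl
      exact hf (F.uVar_mem X k ω)
    have h2 : (uniformOn F.H).real {f} = 0 := by
      refine real_eq_zero_of_notMem_supp ?_
      rwa [show supp (uniformOn F.H) = F.H from F.core.supp_haar]
    rw [measureReal_def] at h2
    rw [h1, h2, Set.inter_empty, measure_empty, ENNReal.toReal_zero, mul_zero]

theorem map_uVar (h : IsEvolution μ P X N) (hr : ∀ᵐ ω ∂P, F.Regular X N ω) (k : ℤ) :
    P.map (F.uVar X k) = uniformOn F.H := by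
  have := F.map_restrict_uVar h isRemote_univ hr k 0 (A := Set.univ) MeasurableSet.univ
  rwa [Set.inter_univ, Measure.restrict_univ, measure_univ, one_mul, one_smul] at this

theorem measure_triple (h : IsEvolution μ P X N) {A B : Set Ω}
    (hB : IsRemote P X B) (hr : ∀ᵐ ω ∂P, F.Regular X N ω) (k : ℤ) (n : ℕ)
    (hA : MeasurableSet[window N (k - n) k] A) (D : Set (Function.End V)) :
    P (A ∩ B ∩ F.uVar X k ⁻¹' D) = P A * P B * P (F.uVar X k ⁻¹' D) := by
  have hU := F.measurable_uVar h.measurable_X k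
  have h1 := congrArg (fun κ : Measure (Function.End V) => κ D) (F.map_restrict_uVar h hB hr k n hA)
  have h2 := congrArg (fun κ : Measure (Function.End V) => κ D) (F.map_uVar h hr k)
  simp only [Measure.map_apply hU .of_discrete, Measure.restrict_apply (hU .of_discrete),
    Measure.smul_apply, smul_eq_mul] at h1 h2
  rw [Set.inter_comm, h1, h2]

/-- The noise up to time `k`, the remote past and `U_k` are independent. -/
theorem iIndep_past_remotePast (h : IsEvolution μ P X N) (hr : ∀ᵐ ω ∂P, F.Regular X N ω) (k : ℤ) :
    iIndep ![past N k, remotePast X, MeasurableSpace.comap (F.uVar X k) inferInstance] P := by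
  have hU := F.measurable_uVar h.measurable_X k
  have hmono : Monotone fun n : ℕ => window N (k - n) k :=
    fun a b hab => window_mono N (by omega) le_rfl
  refine iIndep_of_three
    (π := ![{A | ∃ n : ℕ, MeasurableSet[window N (k - n) k] A}, {B | MeasurableSet[remotePast X] B},
      {C | MeasurableSet[MeasurableSpace.comap (F.uVar X k) inferInstance] C}]) ?_ ?_ ?_ ?_ ?_
  · rw [Fin.forall_fin_succ, Fin.forall_fin_two]
    exact ⟨past_le h.measurable_N k, (remotePast_le_past X k).trans (past_le h.measurable_X k),
      hU.comap_le⟩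
  · rw [Fin.forall_fin_succ, Fin.forall_fin_two]
    refine ⟨?_, ?_, ?_⟩
    · rintro A ⟨a, ha⟩ B ⟨b, hb⟩ -
      exact ⟨max a b, MeasurableSet.inter (hmono (le_max_left a b) A ha)
        (hmono (le_max_right a b) B hb)⟩
    · exact @MeasurableSpace.isPiSystem_measurableSet Ω (remotePast X)
    · exact @MeasurableSpace.isPiSystem_measurableSet Ω
        (MeasurableSpace.comap (F.uVar X k) inferInstance)
  · rw [Fin.forall_fin_succ, Fin.forall_fin_two]
    exact ⟨⟨0, MeasurableSet.univ⟩, @MeasurableSet.univ Ω (remotePast X),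
      @MeasurableSet.univ Ω (MeasurableSpace.comap (F.uVar X k) inferInstance)⟩
  · rw [Fin.forall_fin_succ, Fin.forall_fin_two]
    refine ⟨?_, (@MeasurableSpace.generateFrom_measurableSet Ω (remotePast X)).symm,
      (@MeasurableSpace.generateFrom_measurableSet Ω
        (MeasurableSpace.comap (F.uVar X k) inferInstance)).symm⟩
    change past N k = MeasurableSpace.generateFrom
      {A | ∃ n : ℕ, MeasurableSet[window N (k - n) k] A}
    refine le_antisymm ?_ (MeasurableSpace.generateFrom_le ?_)
    · rw [← iSup_window N k]
      exact iSup_le fun n A hA => MeasurableSpace.measurableSet_generateFrom ⟨n, hA⟩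
    · rintro A ⟨n, hA⟩
      exact window_le_past N _ k A hA
  · rintro A ⟨n, hA⟩ B hB _ ⟨D, -, rfl⟩
    exact F.measure_triple h (isRemote_of_remotePast hB) hr k n hA D

/-- A probability is the sum of its values on the cells of the remote past. -/
theorem sum_label (hX : ∀ k, Measurable (X k)) {B : Set Ω} (hB : NullMeasurableSet B P)
    [Fintype (Fin (minRank μ) → V)] :
    P.real B = ∑ q : Fin F.p × (Fin (minRank μ) → V), P.real (B ∩ {ω | F.label (X 0 ω) = q}) :=
  sum_real_inter (F.measurable_label hX) hB

theorem nonempty_W (hr : ∀ᵐ ω ∂P, F.Regular X N ω) : F.W.Nonempty := by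
  obtain ⟨ω, r⟩ := hr.exists
  exact ⟨_, (F.good_eq (r.good 0)).2.2.1⟩

/-- Given the label of `X_0`, the law of `X_k` is that of `f γᵏ γⁱ w` for `f ∼ η`. -/
theorem real_inter_label (h : IsEvolution μ P X N) (hr : ∀ᵐ ω ∂P, F.Regular X N ω)
    (q : Fin F.p × (Fin (minRank μ) → V)) (k : ℤ) (D : Set (Fin (minRank μ) → V)) :
    P.real (X k ⁻¹' D ∩ {ω | F.label (X 0 ω) = q}) = P.real {ω | F.label (X 0 ω) = q} *
      F.η.real {f | f • uval (F.gam ^ k * F.gam ^ (q.1 : ℕ)) • q.2 ∈ D} := by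
  obtain ⟨i, w⟩ := q
  have hB : IsRemote P X {ω | F.label (X 0 ω) = (i, w)} := fun j => by
    obtain ⟨B', hB', hBB⟩ := F.isRemote_cell hr i w j
    exact ⟨B', hB', (F.ae_eq_label hr i w).trans hBB⟩
  have hBc : ∀ᵐ ω ∂P, ω ∈ {ω | F.label (X 0 ω) = (i, w)} → X 0 ω ∈ F.cell 0 i w := by
    filter_upwards [Filter.eventuallyEq_set.1 (F.ae_eq_label hr i w)] with ω hω using hω.1
  have hm : MeasurableSet {ω | F.label (X 0 ω) = (i, w)} :=
    F.measurable_label h.measurable_X (measurableSet_singleton (i, w))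
  have hXm := h.measurable_X k
  set T : Function.End V → Fin (minRank μ) → V :=
    fun f => f • uval (F.gam ^ k * F.gam ^ (i : ℕ)) • w
  have hT : Measurable T := .of_discrete
  have key : (P.restrict {ω | F.label (X 0 ω) = (i, w)}).map (X k) =
      P {ω | F.label (X 0 ω) = (i, w)} • F.η.map T := by
    refine Measure.ext_of_singleton fun x => ?_
    rw [Measure.map_apply hXm .of_discrete, Measure.restrict_apply (hXm .of_discrete),
      Measure.smul_apply, Measure.map_apply hT .of_discrete, smul_eq_mul,
      ← ENNReal.toReal_eq_toReal_iff' (measure_ne_top _ _)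
        (ENNReal.mul_ne_top (measure_ne_top _ _) (measure_ne_top _ _)), ENNReal.toReal_mul,
      Set.inter_comm]
    exact F.real_inter_eq h hB hr hBc k x
  have := congrArg (fun κ : Measure (Fin (minRank μ) → V) => (κ D).toReal) key
  simp only [Measure.map_apply hXm .of_discrete, Measure.restrict_apply (hXm .of_discrete),
    Measure.smul_apply, Measure.map_apply hT .of_discrete, smul_eq_mul, ENNReal.toReal_mul] at this
  exact this

theorem real_label_eq_zero (hr : ∀ᵐ ω ∂P, F.Regular X N ω) {q : Fin F.p × (Fin (minRank μ) → V)}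
    (hq : q.2 ∉ F.W) : P.real {ω | F.label (X 0 ω) = q} = 0 := by
  have : {ω | F.label (X 0 ω) = q} = ∅ := by
    ext ω
    simp only [Set.mem_ofPred_eq, Set.mem_empty_iff_false, iff_false]
    rintro rfl
    exact hq (F.label_mem (F.nonempty_W hr) _)
  rw [this, measureReal_empty]

/-- Given the label of `X_0`, the vector `X_k` has the law of `f x` with `f ∼ η` and fixed `x`, and
`(f x)^L = f^L`. -/
theorem map_xL (h : IsEvolution μ P X N) (hr : ∀ᵐ ω ∂P, F.Regular X N ω) (k : ℤ) :
    P.map (fun ω => F.xL (X k ω)) = F.ηL := by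
  have : Fintype (Fin (minRank μ) → V) := Fintype.ofFinite _
  have hLm : Measurable fun ω => F.xL (X k ω) :=
    (Measurable.of_discrete (f := F.xL)).comp (h.measurable_X k)
  have := Measure.isProbabilityMeasure_map (μ := P) hLm.aemeasurable
  rw [ext_iff_measureReal_singleton]
  intro l
  have key : ∀ q, P.real (X k ⁻¹' {x | F.xL x = l} ∩ {ω | F.label (X 0 ω) = q}) =
      P.real {ω | F.label (X 0 ω) = q} * F.ηL.real {l} := by
    intro q
    rw [F.real_inter_label h hr]
    by_cases hq : q.2 ∈ F.W
    swap
    · rw [F.real_label_eq_zero hr hq, zero_mul, zero_mul]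
    congr 1
    rw [ηL, map_measureReal_apply .of_discrete .of_discrete]
    refine measureReal_congr ?_
    have hae : ∀ᵐ f ∂F.η, f ∈ supp F.η :=
      measure_eq_zero_of_forall_notMem (κ := F.η) fun z hz hz' => hz' hz
    rw [Filter.eventuallyEq_set]
    filter_upwards [hae] with f hf
    obtain ⟨-, -, -, hfL, -⟩ := F.smul_coords_of_mem_supp hf (F.gam_pow_mul_mem k q.1) hq
    simp [hfL]
  rw [map_measureReal_apply hLm .of_discrete]
  change P.real (X k ⁻¹' {x | F.xL x = l}) = _
  rw [F.sum_label h.measurable_X ((h.measurable_X k) .of_discrete).nullMeasurableSet,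
    Finset.sum_congr rfl fun q _ => key q, ← Finset.sum_mul]
  have h1 := F.sum_label (P := P) h.measurable_X MeasurableSet.univ.nullMeasurableSet
  simp only [Set.univ_inter, probReal_univ] at h1
  rw [← h1, one_mul]

end Frame

/-! ### The remote past -/

namespace Frame

open scoped Classical
open IsCore

variable {V : Type*} [Finite V] [Nonempty V] {μ : Measure (Function.End V)}
  [IsProbabilityMeasure μ] (F : Frame μ) {Ω : Type*}
  [MeasurableSpace V] [DiscreteMeasurableSpace V] [mΩ : MeasurableSpace Ω] {P : Measure Ω}
  [IsProbabilityMeasure P] {X : ℤ → Ω → Fin (minRank μ) → V} {N : ℤ → Ω → Function.End V}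

/-- On a cell of the remote past, a cylinder event of `X` is independent of the remote events: it
is determined by an early state of `X` and the noise afterwards. -/
theorem exists_real_cylinder (h : IsEvolution μ P X N) (hr : ∀ᵐ ω ∂P, F.Regular X N ω)
    (a : ℕ) (w : Fin (minRank μ) → V) (t : Finset ℤ) (D : ℤ → Set (Fin (minRank μ) → V)) :
    ∃ c : ℝ, ∀ B : Set Ω, IsRemote P X B → (∀ᵐ ω ∂P, ω ∈ B → X 0 ω ∈ F.cell 0 a w) →
      P.real ((⋂ j ∈ t, X j ⁻¹' D j) ∩ B) = c * P.real B := by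
  have : Fintype (Fin (minRank μ) → V) := Fintype.ofFinite _
  obtain ⟨i, hi⟩ := t.bddBelow
  obtain ⟨k, hk⟩ := t.bddAbove
  set n := (k - i).toNat with hn
  have hik : ∀ j ∈ t, i ≤ j ∧ j ≤ i + n := fun j hj => by
    have h1 := hi hj
    have h2 := hk hj
    omega
  set T : (Fin (minRank μ) → V) → Set Ω :=
    fun x => ⋂ j ∈ t, noiseProd N i (j - i).toNat ⁻¹' {f | f • x ∈ D j} with hT
  have hTm : ∀ x, MeasurableSet[window N i (i + n)] (T x) := by
    intro x
    refine @Finset.measurableSet_biInter _ _ (window N i (i + n)) _ t fun j hj => ?_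
    exact window_mono N le_rfl (by have := hik j hj; omega) _
      (measurable_noiseProd N i (j - i).toNat .of_discrete)
  refine ⟨∑ x, P.real (T x) *
    F.η.real {f | f • uval (F.gam ^ i * F.gam ^ a) • w = x}, fun B hB hBc => ?_⟩
  have hev : ((⋂ j ∈ t, X j ⁻¹' D j) ∩ B : Set Ω) =ᵐ[P]
      (⋃ x ∈ (Finset.univ : Finset (Fin (minRank μ) → V)), T x ∩ (B ∩ X i ⁻¹' {x}) : Set Ω) := by
    rw [Filter.eventuallyEq_set]
    filter_upwards [hr] with ω r
    have h1 : ∀ j ∈ t, X j ω = noiseProd N i (j - i).toNat ω • X i ω := by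
      intro j hj
      rw [← IsEvolution.eq_noiseProd_smul r.step]
      congr 1
      have := hik j hj
      omega
    simp only [hT, Set.mem_inter_iff, Set.mem_iInter, Set.mem_preimage, Set.mem_iUnion,
      Finset.mem_univ, Set.mem_singleton_iff, Set.mem_ofPred_eq, exists_prop, true_and]
    constructor
    · rintro ⟨h2, h3⟩
      exact ⟨X i ω, fun j hj => h1 j hj ▸ h2 j hj, h3, rfl⟩
    · rintro ⟨x, h2, h3, rfl⟩
      exact ⟨fun j hj => (h1 j hj).symm ▸ h2 j hj, h3⟩
  rw [measureReal_congr hev, measureReal_biUnion_finset₀, Finset.sum_mul]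
  · refine Finset.sum_congr rfl fun x _ => ?_
    rw [h.real_window_inter hB i n (hTm x), mul_assoc, mul_comm _ (P.real B)]
    congr 1
    exact F.real_inter_eq h hB hr hBc i x
  · intro x _ x' _ hne
    refine (Set.disjoint_left.2 fun ω hω hω' => hne ?_).aedisjoint
    exact hω.2.2.symm.trans hω'.2.2
  · intro x _
    exact (h.window_le _ _ _ (hTm x)).nullMeasurableSet.inter
      ((hB.nullMeasurableSet h.measurable_X).inter
        (h.measurable_X i (measurableSet_singleton x)).nullMeasurableSet)

/-- The remote past is trivial on each cell. -/
theorem real_remotePast_inter_label (h : IsEvolution μ P X N) (hr : ∀ᵐ ω ∂P, F.Regular X N ω)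
    {B : Set Ω} (hB : MeasurableSet[remotePast X] B) (q : Fin F.p × (Fin (minRank μ) → V)) :
    P.real (B ∩ {ω | F.label (X 0 ω) = q}) = 0 ∨
      P.real (B ∩ {ω | F.label (X 0 ω) = q}) = P.real {ω | F.label (X 0 ω) = q} := by
  obtain ⟨i, w⟩ := q
  set E := {ω | F.label (X 0 ω) = (i, w)} with hE
  have hEr : IsRemote P X E := fun j => by
    obtain ⟨B', hB', hBB⟩ := F.isRemote_cell hr i w j
    exact ⟨B', hB', (F.ae_eq_label hr i w).trans hBB⟩
  have hEc : ∀ᵐ ω ∂P, ω ∈ E → X 0 ω ∈ F.cell 0 i w := by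
    filter_upwards [Filter.eventuallyEq_set.1 (F.ae_eq_label hr i w)] with ω hω using hω.1
  have hle := past_le h.measurable_X 0
  have hBpast : MeasurableSet[past X 0] B := remotePast_le_past X 0 B hB
  have hBm : MeasurableSet[mΩ] B := hle B hBpast
  have hEm : MeasurableSet[mΩ] E :=
    F.measurable_label h.measurable_X (measurableSet_singleton (i, w))
  have : IsFiniteMeasure (P E • P.restrict (B ∩ E)) :=
    Measure.smul_finite _ (measure_ne_top _ _)
  have key := ext_on_measurableSpace_of_generate_finite mΩ
    (μ := P E • P.restrict (B ∩ E)) (ν := P (B ∩ E) • P.restrict E)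
    (piiUnionInter (fun j => {s | MeasurableSet[MeasurableSpace.comap (X j) inferInstance] s})
      {j | j ≤ 0}) ?_ hle
    (generateFrom_piiUnionInter_measurableSet _ _).symm
    (isPiSystem_piiUnionInter _ (fun j => @MeasurableSpace.isPiSystem_measurableSet Ω
      (MeasurableSpace.comap (X j) inferInstance)) _) ?_ hBpast
  · rw [Measure.smul_apply, Measure.smul_apply, Measure.restrict_apply hBm,
      Measure.restrict_apply hBm, ← Set.inter_assoc, Set.inter_self, smul_eq_mul,
      smul_eq_mul] at key
    have key := congrArg ENNReal.toReal key
    rw [ENNReal.toReal_mul, ENNReal.toReal_mul] at key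
    change P.real E * P.real (B ∩ E) = P.real (B ∩ E) * P.real (B ∩ E) at key
    rcases eq_or_ne (P.real (B ∩ E)) 0 with h0 | h0
    · exact Or.inl h0
    · exact Or.inr (mul_right_cancel₀ h0 key).symm
  · rintro s ⟨t, ht, f, hf, rfl⟩
    choose! D hD using fun (j : ℤ) (hj : j ∈ t) =>
      (show ∃ D, MeasurableSet D ∧ X j ⁻¹' D = f j from hf j hj)
    have hs : (⋂ j ∈ t, f j) = ⋂ j ∈ t, X j ⁻¹' D j :=
      Set.iInter₂_congr fun j hj => (hD j hj).2.symm
    have hsm : MeasurableSet[mΩ] (⋂ j ∈ t, X j ⁻¹' D j) :=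
      t.measurableSet_biInter fun j _ => h.measurable_X j .of_discrete
    obtain ⟨c, hc⟩ := F.exists_real_cylinder h hr i w t D
    rw [hs, Measure.smul_apply, Measure.smul_apply, Measure.restrict_apply hsm,
      Measure.restrict_apply hsm, smul_eq_mul, smul_eq_mul,
      ← ENNReal.toReal_eq_toReal_iff' (ENNReal.mul_ne_top (measure_ne_top _ _) (measure_ne_top _ _))
        (ENNReal.mul_ne_top (measure_ne_top _ _) (measure_ne_top _ _)), ENNReal.toReal_mul,
      ENNReal.toReal_mul]
    change P.real E * P.real _ = P.real (B ∩ E) * P.real _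
    rw [hc _ ((isRemote_of_remotePast hB).inter hEr) (hEc.mono fun ω hω h' => hω h'.2),
      hc _ hEr hEc]
    ring
  · simp only [Measure.smul_apply, Measure.restrict_apply MeasurableSet.univ, Set.univ_inter,
      smul_eq_mul, mul_comm]

/-- The σ-field generated by `Y_C` and `Z_W`. -/
noncomputable abbrev labelField (X : ℤ → Ω → Fin (minRank μ) → V) : MeasurableSpace Ω :=
  MeasurableSpace.comap (F.yVar X) inferInstance ⊔ MeasurableSpace.comap (F.zVar X) inferInstance

/-- The remote past is generated by `Y_C` and `Z_W`, up to null events. -/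
theorem eqAE_remotePast (h : IsEvolution μ P X N) (hr : ∀ᵐ ω ∂P, F.Regular X N ω) :
    EqAE P (remotePast X) (MeasurableSpace.comap (F.yVar X) inferInstance ⊔
      MeasurableSpace.comap (F.zVar X) inferInstance) := by
  have : Fintype (Fin (minRank μ) → V) := Fintype.ofFinite _
  have hYm := F.measurable_yVar h.measurable_X
  have hZm := F.measurable_zVar h.measurable_X
  change EqAE P _ (F.labelField X)
  have hle : F.labelField X ≤ mΩ := sup_le hYm.comap_le hZm.comap_le
  have hlabel : ∀ q, MeasurableSet[(F.labelField X)] {ω | F.label (X 0 ω) = q} := by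
    rintro ⟨i, w⟩
    have : {ω | F.label (X 0 ω) = (i, w)} =
        F.yVar X ⁻¹' {F.γpow (i : ℕ)} ∩ F.zVar X ⁻¹' {w} := by
      ext ω
      exact F.yVar_eq_iff.symm
    rw [this]
    exact MeasurableSet.inter
      (le_sup_left (a := MeasurableSpace.comap (F.yVar X) inferInstance) _
        ⟨_, measurableSet_singleton _, rfl⟩)
      (le_sup_right (b := MeasurableSpace.comap (F.zVar X) inferInstance) _
        ⟨_, measurableSet_singleton _, rfl⟩)
  have hRle : remotePast X ≤ mΩ := (remotePast_le_past X 0).trans (past_le h.measurable_X 0)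
  refine le_antisymm (sup_le (fun B hB => ?_) le_sup_right) (sup_le ?_ le_sup_right)
  · -- a remote event is a union of cells
    set S := {q | P.real (B ∩ {ω | F.label (X 0 ω) = q}) = P.real {ω | F.label (X 0 ω) = q}}
    have hS : MeasurableSet[(F.labelField X)] (⋃ q ∈ S, {ω | F.label (X 0 ω) = q}) :=
      MeasurableSet.biUnion (Set.to_countable _) fun q _ => hlabel q
    refine measurableSet_of_ae_eq (sup_le hle nullField_le) le_sup_right
      (le_sup_left (a := (F.labelField X)) (b := nullField P) _ hS) (hRle B hB) ?_
    have hq : ∀ q, ∀ᵐ ω ∂P, F.label (X 0 ω) = q → (ω ∈ B ↔ q ∈ S) := by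
      intro q
      have hm := hle _ (hlabel q)
      by_cases hqS : q ∈ S
      · have h0 : P ({ω | F.label (X 0 ω) = q} \ B) = 0 := by
          have h1 : P.real ({ω | F.label (X 0 ω) = q} \ (B ∩ {ω | F.label (X 0 ω) = q})) = 0 := by
            rw [measureReal_sdiff Set.inter_subset_right ((hRle B hB).inter hm),
              show P.real (B ∩ {ω | F.label (X 0 ω) = q}) = _ from hqS, sub_self]
          rw [Set.inter_comm, Set.sdiff_self_inter] at h1
          rwa [measureReal_eq_zero_iff] at h1
        have h2 : ∀ᵐ ω ∂P, ω ∉ {ω | F.label (X 0 ω) = q} \ B := measure_eq_zero_iff_ae_notMem.1 h0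
        filter_upwards [h2] with ω hω hωq
        simp only [hqS, iff_true]
        by_contra hcon
        exact hω ⟨hωq, hcon⟩
      · have h0 : P.real (B ∩ {ω | F.label (X 0 ω) = q}) = 0 :=
          (F.real_remotePast_inter_label h hr hB q).resolve_right hqS
        rw [measureReal_eq_zero_iff] at h0
        filter_upwards [measure_eq_zero_iff_ae_notMem.1 h0] with ω hω hωq
        simp only [hqS, iff_false]
        exact fun hcon => hω ⟨hcon, hωq⟩
    rw [Filter.eventuallyEq_set]
    filter_upwards [ae_all_iff.2 hq] with ω hω
    simp only [Set.mem_iUnion, Set.mem_ofPred_eq, exists_prop, exists_eq_right']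
    exact (hω _ rfl).symm
  · -- the cells are remote events
    have hn : nullField P ≤ remotePast X ⊔ nullField P := le_sup_right
    have hcell : ∀ q, MeasurableSet[remotePast X ⊔ nullField P] {ω | F.label (X 0 ω) = q} := by
      rintro ⟨i, w⟩
      obtain ⟨B, hB, hBB⟩ := F.exists_remotePast_cell hr i w
      exact measurableSet_of_ae_eq (sup_le hRle nullField_le) hn
        (le_sup_left (a := remotePast X) (b := nullField P) _ hB) (hle _ (hlabel (i, w)))
        ((F.ae_eq_label hr i w).trans hBB).symm
    have hlm : Measurable[remotePast X ⊔ nullField P] fun ω => F.label (X 0 ω) :=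
      @measurable_to_countable' _ _ _ _ (remotePast X ⊔ nullField P) _ hcell
    refine sup_le ?_ ?_
    · refine measurable_iff_comap_le.1 ?_
      have : F.yVar X = (fun q : Fin F.p × (Fin (minRank μ) → V) => F.γpow (q.1 : ℕ)) ∘
          fun ω => F.label (X 0 ω) := by
        funext ω
        exact (F.yVar_eq_iff (ω := ω) (i := (F.label (X 0 ω)).1) (w := (F.label (X 0 ω)).2)).2
          rfl |>.1
      rw [this]
      exact Measurable.of_discrete.comp hlm
    · refine measurable_iff_comap_le.1 ?_
      exact measurable_snd.comp hlm

end Frame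

/-! ### The σ-field of the observed past -/

theorem measurable_mul_of_measurable {V Ω : Type*} [Finite V] {m : MeasurableSpace Ω}
    {f g : Ω → Function.End V} (hf : Measurable[m] f) (hg : Measurable[m] g) :
    Measurable[m] fun ω => f ω * g ω :=
  (Measurable.of_discrete (f := fun q : Function.End V × Function.End V => q.1 * q.2)).comp
    (hf.prodMk hg)

namespace Frame

open scoped Classical
open IsCore

variable {V : Type*} [Finite V] [Nonempty V] {μ : Measure (Function.End V)}
  [IsProbabilityMeasure μ] (F : Frame μ) {Ω : Type*}

namespace Regular

variable {F} {X : ℤ → Ω → Fin (minRank μ) → V} {N : ℤ → Ω → Function.End V} {ω : Ω}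
  (r : F.Regular X N ω)
include r

theorem xG_eq (k : ℤ) : F.xG (X k ω) = F.γpow k * F.yVar X ω * F.uVar X k ω := by
  rw [(F.good_eq (r.good k)).2.1, r.gU_eq, uval_mul, uval_mul, γpow_eq]
  rfl

theorem zVar_eq (k : ℤ) : F.xW (X k ω) = F.zVar X ω := (r.wPart_eq k).symm

theorem MG_eq_MGprod (j : ℤ) (n : ℕ) : F.MG X (j + n) j ω = F.MGprod X j n ω := by
  rw [r.MG_eq, r.MGprod_eq]

theorem eq_smul_zVar (j k : ℤ) : X j ω =
    (F.xL (X j ω) * F.inv (F.MG X k j ω) * (F.γpow k * F.yVar X ω) * F.uVar X k ω) •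
      F.zVar X ω := by
  rw [mul_assoc, ← r.xG_eq, (F.good_eq (r.good k)).2.1, r.MG_eq, inv, localInv_uval, mul_assoc,
    ← uval_mul, mul_inv_rev, inv_inv, inv_mul_cancel_right, ← r.zVar_eq j]
  exact (F.good_eq (r.good j)).2.2.2

theorem uVar_eq (k : ℤ) :
    F.uVar X k ω = F.inv (F.γpow k * F.yVar X ω) * F.xG (X k ω) := by
  rw [γpow_eq, yVar, ← uval_mul, inv, localInv_uval, (F.good_eq (r.good k)).2.1, ← uval_mul, uVar,
    r.hPart_eq]

/-- The increment of `X^G` is a function of the noise and of the previous `X^L`. -/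
theorem MG_step_eq (k : ℤ) : F.MG X k (k - 1) ω = F.e * N k ω * F.xL (X (k - 1) ω) := by
  obtain ⟨h, -, he, -, -, hG, -⟩ := F.smul_coords (n := 1)
    (by rw [convPow_one]; exact r.supp k) (r.good (k - 1))
  rw [r.MG_eq, r.step k, hG, mul_inv_cancel_right, he]

/-- The coordinate `X_k^L` is a function of the recent noise once this has reached the support
of `η`. -/
theorem xL_eq_leftPart (k : ℤ) {n : ℕ} (hn : noiseProd N (k - n) n ω ∈ ActionEvolution.supp F.η) :
    F.xL (X k ω) = leftPart F.e (noiseProd N (k - n) n ω) := by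
  have h1 := IsEvolution.eq_noiseProd_smul r.step (k - n) n
  rw [sub_add_cancel] at h1
  obtain ⟨-, -, -, -, hL, -⟩ := F.smul_coords
    (IsEvolution.noiseProd_mem_supp r.supp (k - n) n) (r.good (k - n))
  rw [← h1] at hL
  rw [hL]
  exact F.core.leftPart_mul ((mem_phase_zero μ).2 hn)
    ((mem_phase_zero μ).2 (F.L_spec (F.good_eq (r.good (k - n))).1).1)

end Regular

variable [MeasurableSpace V] [DiscreteMeasurableSpace V] [mΩ : MeasurableSpace Ω] {P : Measure Ω}
  [IsProbabilityMeasure P] {X : ℤ → Ω → Fin (minRank μ) → V} {N : ℤ → Ω → Function.End V}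

theorem measurable_xL {m : MeasurableSpace Ω} {j : ℤ} (h : Measurable[m] (X j)) :
    Measurable[m] fun ω => F.xL (X j ω) :=
  (Measurable.of_discrete (f := F.xL)).comp h

theorem measurable_xG {m : MeasurableSpace Ω} {j : ℤ} (h : Measurable[m] (X j)) :
    Measurable[m] fun ω => F.xG (X j ω) :=
  (Measurable.of_discrete (f := F.xG)).comp h

theorem measurable_inv {m : MeasurableSpace Ω} {f : Ω → Function.End V} (h : Measurable[m] f) :
    Measurable[m] fun ω => F.inv (f ω) :=
  (Measurable.of_discrete (f := F.inv)).comp h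

theorem measurable_MG {m : MeasurableSpace Ω} {j k : ℤ} (hk : Measurable[m] (X k))
    (hj : Measurable[m] (X j)) : Measurable[m] (F.MG X k j) :=
  measurable_mul_of_measurable (F.measurable_xG hk) (F.measurable_inv (F.measurable_xG hj))

/-- `X_k^L` is a function of the noise up to time `k`, up to null events. -/
theorem measurable_xL_noise (h : IsEvolution μ P X N) (hr : ∀ᵐ ω ∂P, F.Regular X N ω) (k : ℤ) :
    Measurable[past N k ⊔ nullField P] fun ω => F.xL (X k ω) := by
  have hle := past_le h.measurable_N k
  have hm : past N k ⊔ nullField P ≤ mΩ := sup_le hle nullField_le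
  have hX := F.measurable_xL (h.measurable_X k)
  refine @measurable_to_countable' _ _ _ _ (past N k ⊔ nullField P) _ fun l => ?_
  have hA : MeasurableSet[past N k] (⋃ n : ℕ, noiseProd N (k - n) n ⁻¹'
      {z | z ∈ ActionEvolution.supp F.η ∧ leftPart F.e z = l}) := by
    refine MeasurableSet.iUnion fun n => ?_
    have h1 := measurable_noiseProd N (k - n) n
    rw [sub_add_cancel] at h1
    exact window_le_past N _ k _ (h1 .of_discrete)
  refine measurableSet_of_ae_eq hm le_sup_right
    (le_sup_left (a := past N k) (b := nullField P) _ hA) (hX (measurableSet_singleton l)) ?_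
  rw [Filter.eventuallyEq_set]
  filter_upwards [hr, F.ae_exists_noiseProd_mem h] with ω r hω
  simp only [Set.mem_iUnion, Set.mem_preimage, Set.mem_ofPred_eq, Set.mem_singleton_iff]
  constructor
  · rintro ⟨n, hn, rfl⟩
    exact r.xL_eq_leftPart k hn
  · rintro rfl
    obtain ⟨n, hn⟩ := hω k
    exact ⟨n, hn, (r.xL_eq_leftPart k hn).symm⟩

/-- The reduced noise is contained in the noise, up to null events. -/
theorem subAE_reducedNoise (h : IsEvolution μ P X N) (hr : ∀ᵐ ω ∂P, F.Regular X N ω) (k : ℤ) :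
    SubAE P (F.reducedNoise X k) (past N k) := by
  have hm : past N k ⊔ nullField P ≤ mΩ := sup_le (past_le h.measurable_N k) nullField_le
  have hmono : ∀ {j}, j ≤ k → past N j ⊔ nullField P ≤ past N k ⊔ nullField P :=
    fun hj => sup_le_sup_right (past_mono N hj) _
  refine sup_le (iSup₂_le fun j hj => measurable_iff_comap_le.1 ?_)
    (iSup₂_le fun j hj => measurable_iff_comap_le.1 ?_)
  · exact (F.measurable_xL_noise h hr j).mono (hmono hj) le_rfl
  · have h1 : Measurable[past N k ⊔ nullField P] fun ω => F.xL (X (j - 1) ω) :=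
      (F.measurable_xL_noise h hr (j - 1)).mono (hmono (by omega)) le_rfl
    have h2 : Measurable[past N k ⊔ nullField P] (N j) :=
      (measurable_past N hj).mono le_sup_left le_rfl
    refine measurable_of_ae_eq hm le_sup_right (measurable_mul_of_measurable
      (measurable_mul_of_measurable (@measurable_const _ _ _ (past N k ⊔ nullField P) F.e) h2) h1)
      (F.measurable_MG (h.measurable_X j) (h.measurable_X (j - 1))) ?_
    filter_upwards [hr] with ω r using (r.MG_step_eq j).symm

theorem measurable_MGprod (j : ℤ) (n : ℕ) {k : ℤ} (hk : j + n ≤ k) :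
    Measurable[F.reducedNoise X k] (F.MGprod X j n) := by
  induction n with
  | zero => exact @measurable_const _ _ _ (F.reducedNoise X k) _
  | succ n ih =>
    have h1 := measurable_past (fun j ω => F.MG X j (j - 1) ω) (j := j + n + 1) (k := k)
      (by push_cast at hk; omega)
    simp only [add_sub_cancel_right] at h1
    exact measurable_mul_of_measurable (h1.mono le_sup_right le_rfl)
      (ih (by push_cast at hk; omega))

/-- The observed past is generated by the reduced noise, the remote past and `U_k`. -/
theorem eqAE_past (h : IsEvolution μ P X N) (hr : ∀ᵐ ω ∂P, F.Regular X N ω) (k : ℤ) :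
    EqAE P (past X k) (F.reducedNoise X k ⊔ remotePast X ⊔
      MeasurableSpace.comap (F.uVar X k) inferInstance) := by
  have hXk := past_le h.measurable_X k
  have hRle : remotePast X ≤ mΩ := (remotePast_le_past X k).trans hXk
  have hUm := F.measurable_uVar h.measurable_X k
  have hYZ := F.eqAE_remotePast h hr
  have hYZ : F.labelField X ≤ remotePast X ⊔ nullField P := le_sup_left.trans hYZ.ge
  have hred : F.reducedNoise X k ≤ past X k := by
    refine sup_le (iSup₂_le fun j hj => measurable_iff_comap_le.1 ?_)
      (iSup₂_le fun j hj => measurable_iff_comap_le.1 ?_)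
    · exact F.measurable_xL (measurable_past X hj)
    · exact F.measurable_MG (measurable_past X hj) (measurable_past X (by omega))
  refine le_antisymm (sup_le (iSup₂_le fun j hj => measurable_iff_comap_le.1 ?_) le_sup_right)
    (sup_le (sup_le (sup_le ?_ ?_) (measurable_iff_comap_le.1 ?_)) le_sup_right)
  · obtain ⟨n, rfl⟩ := Int.le.dest hj
    set k := j + n
    have hm : F.reducedNoise X k ⊔ remotePast X ⊔ MeasurableSpace.comap (F.uVar X k) inferInstance ⊔
        nullField P ≤ mΩ :=
      sup_le (sup_le (sup_le (hred.trans hXk) hRle) hUm.comap_le) nullField_le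
    have hL : Measurable[F.reducedNoise X k] fun ω => F.xL (X j ω) :=
      (measurable_past (fun j ω => F.xL (X j ω)) hj).mono le_sup_left le_rfl
    have hM := F.measurable_inv (F.measurable_MGprod (X := X) j n (k := k) le_rfl)
    have hr1 : F.reducedNoise X k ≤ F.reducedNoise X k ⊔ remotePast X ⊔
        MeasurableSpace.comap (F.uVar X k) inferInstance ⊔ nullField P :=
      (le_sup_left.trans le_sup_left).trans le_sup_left
    have hr2 : F.labelField X ≤ F.reducedNoise X k ⊔ remotePast X ⊔
        MeasurableSpace.comap (F.uVar X k) inferInstance ⊔ nullField P :=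
      hYZ.trans (sup_le_sup_right (le_sup_right.trans le_sup_left) _)
    have hY : Measurable[F.labelField X] fun ω => F.γpow k * F.yVar X ω :=
      measurable_mul_of_measurable (@measurable_const _ _ _ (F.labelField X) _)
        (measurable_iff_comap_le.2 le_sup_left)
    have hZ : Measurable[F.labelField X] (F.zVar X) := measurable_iff_comap_le.2 le_sup_right
    have hU : Measurable[F.reducedNoise X k ⊔ remotePast X ⊔
        MeasurableSpace.comap (F.uVar X k) inferInstance ⊔ nullField P] (F.uVar X k) :=
      measurable_iff_comap_le.2 (le_sup_right.trans le_sup_left)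
    have hprod := measurable_mul_of_measurable (measurable_mul_of_measurable
      (measurable_mul_of_measurable hL hM |>.mono hr1 le_rfl) (hY.mono hr2 le_rfl)) hU
    have hfin : Measurable fun q : Function.End V × (Fin (minRank μ) → V) => q.1 • q.2 :=
      .of_discrete
    refine measurable_of_ae_eq hm le_sup_right (hfin.comp (hprod.prodMk (hZ.mono hr2 le_rfl)))
      (h.measurable_X j) ?_
    filter_upwards [hr] with ω r
    have := r.eq_smul_zVar j k
    rw [r.MG_eq_MGprod j n] at this
    exact this.symm
  · exact hred.trans le_sup_left
  · exact (remotePast_le_past X k).trans le_sup_left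
  · have hm : past X k ⊔ nullField P ≤ mΩ := sup_le hXk nullField_le
    have hY : Measurable[past X k ⊔ nullField P] (F.yVar X) :=
      measurable_iff_comap_le.2 ((le_sup_left.trans hYZ).trans
        (sup_le_sup_right (remotePast_le_past X k) _))
    have hX : Measurable[past X k ⊔ nullField P] (X k) :=
      (measurable_past X le_rfl).mono le_sup_left le_rfl
    refine measurable_of_ae_eq hm le_sup_right (measurable_mul_of_measurable
      (F.measurable_inv (measurable_mul_of_measurable
        (@measurable_const _ _ _ (past X k ⊔ nullField P) (F.γpow k)) hY))
      (F.measurable_xG hX)) hUm ?_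
    filter_upwards [hr] with ω r using (r.uVar_eq k).symm

end Frame

/-! ### Representations of the laws -/

theorem sum_smul_real {ι α : Type*} [Fintype ι] [MeasurableSpace α] (c : ι → ℝ≥0)
    (κ : ι → Measure α) [∀ i, IsFiniteMeasure (κ i)] (A : Set α) :
    (∑ i, c i • κ i).real A = ∑ i, (c i : ℝ) * (κ i).real A := by
  rw [measureReal_def, Measure.finsetSum_apply, ENNReal.toReal_sum]
  · refine Finset.sum_congr rfl fun i _ => ?_
    rw [Measure.smul_apply, ENNReal.smul_def, smul_eq_mul, ENNReal.toReal_mul, ENNReal.coe_toReal]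
    rfl
  · intro i _
    rw [Measure.smul_apply, ENNReal.smul_def, smul_eq_mul]
    exact ENNReal.mul_ne_top ENNReal.coe_ne_top (measure_ne_top _ _)

section Act

variable {V : Type*} [Finite V] [MeasurableSpace V] [DiscreteMeasurableSpace V] {m : ℕ}

/-- The law of `f x` is a mixture over the values of `x`. -/
theorem act_real (κ : Measure (Function.End V)) [IsFiniteMeasure κ] (Λ : Measure (Fin m → V))
    [IsFiniteMeasure Λ] [Fintype (Fin m → V)] (D : Set (Fin m → V)) :
    (act κ Λ).real D = ∑ w, Λ.real {w} * κ.real {f | f • w ∈ D} := by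
  have hm : Measurable fun q : Function.End V × (Fin m → V) => q.1 • q.2 := .of_discrete
  rw [act, map_measureReal_apply hm .of_discrete,
    sum_real_inter (measurable_snd (α := Function.End V) (β := Fin m → V))
      (MeasurableSet.of_discrete.nullMeasurableSet)]
  refine Finset.sum_congr rfl fun w _ => ?_
  have : ((fun q : Function.End V × (Fin m → V) => q.1 • q.2) ⁻¹' D ∩ {q | q.2 = w}) =
      {f | f • w ∈ D} ×ˢ {w} := by
    ext ⟨f, x⟩
    simp only [Set.mem_inter_iff, Set.mem_preimage, Set.mem_ofPred_eq, Set.mem_prod,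
      Set.mem_singleton_iff]
    constructor
    · rintro ⟨h, rfl⟩
      exact ⟨h, rfl⟩
    · rintro ⟨h, rfl⟩
      exact ⟨h, rfl⟩
  rw [this, measureReal_prod_prod, mul_comm]

theorem act_prob (κ : Measure (Function.End V)) [IsProbabilityMeasure κ] (Λ : Measure (Fin m → V))
    [IsProbabilityMeasure Λ] : IsProbabilityMeasure (act κ Λ) :=
  Measure.isProbabilityMeasure_map Measurable.of_discrete.aemeasurable

theorem IsEvolution.map_eq_act {Ω : Type*} [MeasurableSpace Ω] {μ : Measure (Function.End V)}
    {P : Measure Ω} [IsProbabilityMeasure P] {X : ℤ → Ω → Fin m → V} {N : ℤ → Ω → Function.End V}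
    (h : IsEvolution μ P X N) (k : ℤ) : P.map (X k) = act μ (P.map (X (k - 1))) := by
  have hN := h.measurable_N k
  have hX := h.measurable_X (k - 1)
  have hind : N k ⟂ᵢ[P] X (k - 1) := by
    rw [IndepFun_iff_Indep]
    exact indep_of_indep_of_le_right (h.indep_past k)
      (le_sup_of_le_left (comap_le_past X le_rfl))
  have hm : Measurable fun q : Function.End V × (Fin m → V) => q.1 • q.2 := .of_discrete
  have h1 := hind.map_prod_eq_prod_map_map hN.aemeasurable hX.aemeasurable
  rw [h.law_N] at h1
  rw [act, ← h1, Measure.map_map hm (hN.prodMk hX)]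
  exact Measure.map_congr (h.step k)

end Act

namespace Frame

open scoped Classical
open IsCore

variable {V : Type*} [Finite V] [Nonempty V] {μ : Measure (Function.End V)}
  [IsProbabilityMeasure μ] (F : Frame μ)

/-- A map in the support of `η` keeps `γⁱ w` in its cell, and different pairs `(i, w)` have
different cells. -/
theorem smul_mem_cell_iff {f : Function.End V} (hf : f ∈ supp F.η) {i i' : Fin F.p}
    {w w' : Fin (minRank μ) → V} (hw' : w' ∈ F.W) :
    f • uval (F.gam ^ (i' : ℕ)) • w' ∈ F.cell 0 i w ↔ i' = i ∧ w' = w := by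
  have hg : F.gam ^ (i' : ℕ) ∈ F.core.bigSubgroup := ⟨i', F.gam_pow_mem_phase i'⟩
  obtain ⟨h, hh, h1, -, h2, h3⟩ := F.smul_coords_of_mem_supp hf hg hw'
  rw [cell, Set.mem_ofPred_eq, h2, h3, zpow_zero, one_mul, and_iff_right h1]
  refine and_congr_left fun _ => ?_
  have hi : F.gam ^ (i : ℕ) ∈ F.core.bigSubgroup := ⟨i, F.gam_pow_mem_phase i⟩
  have h4 : (F.gam ^ (i : ℕ))⁻¹ * (h * F.gam ^ (i' : ℕ)) =
      ((F.gam ^ (i : ℕ))⁻¹ * h * F.gam ^ (i : ℕ)) *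
        ((F.gam ^ (i : ℕ))⁻¹ * F.gam ^ (i' : ℕ)) := by simp [mul_assoc]
  rw [h4, Subgroup.mul_mem_cancel_left _ (F.inv_conj_mem hi hh)]
  constructor
  · exact fun h => (Fin.ext (F.index_unique i.2 i'.2 h)).symm
  · rintro rfl
    rw [inv_mul_cancel]
    exact one_mem _

theorem ηL_mconv_real (k : ℤ) (i : ℕ) (w : Fin (minRank μ) → V) (D : Set (Fin (minRank μ) → V)) :
    (F.ηL.mconv ((Measure.dirac (F.γpow (k + i))).mconv (uniformOn F.H))).real {f | f • w ∈ D} =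
      F.η.real {f | f • uval (F.gam ^ k * F.gam ^ i) • w ∈ D} := by
  rw [γpow_eq, zpow_add, zpow_natCast, F.ηL_mconv_eq (F.gam_pow_mul_mem k i), Measure.mconv_dirac,
    map_measureReal_apply .of_discrete .of_discrete]
  congr 1

variable [MeasurableSpace V] [DiscreteMeasurableSpace V]

theorem Represents.real_apply {F : Frame μ} [Fintype (Fin (minRank μ) → V)] {c : Fin F.p → ℝ≥0}
    {ΛW : Fin F.p → Measure (Fin (minRank μ) → V)} {Λ : ℤ → Measure (Fin (minRank μ) → V)}
    (h : F.Represents c ΛW Λ) (k : ℤ) (D : Set (Fin (minRank μ) → V)) :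
    (Λ k).real D = ∑ i : Fin F.p, c i * ∑ w, (ΛW i).real {w} *
      F.η.real {f | f • uval (F.gam ^ k * F.gam ^ (i : ℕ)) • w ∈ D} := by
  have := h.isProb
  have hact := fun i : Fin F.p => act_prob
    (F.ηL.mconv ((Measure.dirac (F.γpow (k + (i : ℕ)))).mconv (uniformOn F.H))) (ΛW i)
  rw [h.eq k, sum_smul_real]
  refine Finset.sum_congr rfl fun i _ => ?_
  rw [act_real]
  congr 1
  exact Finset.sum_congr rfl fun w _ => by rw [F.ηL_mconv_real]

/-- A representation is determined by the law of `X_0` on the cells. -/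
theorem Represents.real_cell {F : Frame μ} {c : Fin F.p → ℝ≥0}
    {ΛW : Fin F.p → Measure (Fin (minRank μ) → V)} {Λ : ℤ → Measure (Fin (minRank μ) → V)}
    (h : F.Represents c ΛW Λ) (i : Fin F.p) (w : Fin (minRank μ) → V) :
    (Λ 0).real (F.cell 0 i w) = c i * (ΛW i).real {w} := by
  have : Fintype (Fin (minRank μ) → V) := Fintype.ofFinite _
  have key : ∀ i' w', (ΛW i').real {w'} *
      F.η.real {f | f • uval (F.gam ^ (0 : ℤ) * F.gam ^ (i' : ℕ)) • w' ∈ F.cell 0 i w} =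
      if i' = i ∧ w' = w then (ΛW i').real {w'} else 0 := by
    intro i' w'
    by_cases hw' : w' ∈ F.W
    swap
    · have h0 : (ΛW i').real {w'} = 0 := by
        rw [measureReal_def, measure_mono_null (Set.singleton_subset_iff.2 hw') (h.onW i'),
          ENNReal.toReal_zero]
      rw [h0, zero_mul, ite_self]
    have hae : ∀ᵐ f ∂F.η, f ∈ supp F.η :=
      measure_eq_zero_of_forall_notMem (κ := F.η) fun z hz hz' => hz' hz
    rw [zpow_zero, one_mul]
    split_ifs with hiw
    · have : F.η.real {f | f • uval (F.gam ^ (i' : ℕ)) • w' ∈ F.cell 0 i w} =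
          F.η.real Set.univ := by
        refine measureReal_congr ?_
        rw [Filter.eventuallyEq_set]
        filter_upwards [hae] with f hf
        exact iff_of_true ((F.smul_mem_cell_iff hf hw').2 hiw) trivial
      rw [this, probReal_univ, mul_one]
    · have : F.η.real {f | f • uval (F.gam ^ (i' : ℕ)) • w' ∈ F.cell 0 i w} =
          F.η.real ∅ := by
        refine measureReal_congr ?_
        rw [Filter.eventuallyEq_set]
        filter_upwards [hae] with f hf
        exact iff_of_false (fun hcon => hiw ((F.smul_mem_cell_iff hf hw').1 hcon)) id
      rw [this, measureReal_empty, mul_zero]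
  rw [h.real_apply, Finset.sum_eq_single i]
  · congr 1
    rw [Finset.sum_eq_single w]
    · rw [key, if_pos ⟨rfl, rfl⟩]
    · intro w' _ hne
      rw [key, if_neg fun h => hne h.2]
    · exact fun h => absurd (Finset.mem_univ _) h
  · intro i' _ hne
    rw [Finset.sum_eq_zero, mul_zero]
    intro w' _
    rw [key, if_neg fun h => hne h.1]
  · exact fun h => absurd (Finset.mem_univ _) h

variable {Ω : Type*} [MeasurableSpace Ω] {P : Measure Ω}
  [IsProbabilityMeasure P] {X : ℤ → Ω → Fin (minRank μ) → V} {N : ℤ → Ω → Function.End V}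

/-- The joint law of `Y_C` and `Z_W` is given by every representation. -/
theorem measure_label (h : IsEvolution μ P X N) (hr : ∀ᵐ ω ∂P, F.Regular X N ω)
    {c : Fin F.p → ℝ≥0} {ΛW : Fin F.p → Measure (Fin (minRank μ) → V)}
    (hrep : F.Represents c ΛW fun k => P.map (X k)) (i : Fin F.p) (w : Fin (minRank μ) → V) :
    P {ω | F.label (X 0 ω) = (i, w)} = c i * ΛW i {w} := by
  have := hrep.isProb
  have h1 := hrep.real_cell i w
  rw [map_measureReal_apply (h.measurable_X 0) .of_discrete,
    ← measureReal_congr (F.ae_eq_label hr i w)] at h1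
  rw [← ENNReal.toReal_eq_toReal_iff' (measure_ne_top _ _)
    (ENNReal.mul_ne_top ENNReal.coe_ne_top (measure_ne_top _ _)), ENNReal.toReal_mul,
    ENNReal.coe_toReal]
  exact h1

/-- A representation is given by the law of the index `i` of `Y_C = γⁱ` and the conditional laws of
`Z_W` given this index. -/
theorem exists_represents (h : IsEvolution μ P X N) (hr : ∀ᵐ ω ∂P, F.Regular X N ω) :
    ∃ c ΛW, F.Represents c ΛW fun k => P.map (X k) := by
  have : Fintype (Fin (minRank μ) → V) := Fintype.ofFinite _
  obtain ⟨w₀, hw₀⟩ := F.nonempty_W hr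
  have hZ := F.measurable_zVar h.measurable_X
  have hlm := F.measurable_label h.measurable_X
  set E : Fin F.p → Set Ω := fun i => {ω | (F.label (X 0 ω)).1 = i} with hE
  have hEm : ∀ i, MeasurableSet (E i) := fun i =>
    (measurable_fst.comp hlm) (measurableSet_singleton i)
  set c : Fin F.p → ℝ≥0 := fun i => (P (E i)).toNNReal with hc
  -- the conditional law of `Z_W`; its value is irrelevant where `c i = 0`
  set ΛW : Fin F.p → Measure (Fin (minRank μ) → V) := fun i =>
    if P (E i) = 0 then Measure.dirac w₀ else (P[|E i]).map (F.zVar X) with hΛ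
  have hprob : ∀ i, IsProbabilityMeasure (ΛW i) := by
    intro i
    simp only [hΛ]
    split_ifs with h0
    · infer_instance
    · have := cond_isProbabilityMeasure (μ := P) (s := E i) h0
      exact Measure.isProbabilityMeasure_map hZ.aemeasurable
  have hjoint : ∀ i w, (c i : ℝ) * (ΛW i).real {w} = P.real {ω | F.label (X 0 ω) = (i, w)} := by
    intro i w
    have hset : {ω | F.label (X 0 ω) = (i, w)} = E i ∩ F.zVar X ⁻¹' {w} := by
      ext ω
      simp only [hE, Set.mem_ofPred_eq, Set.mem_inter_iff, Set.mem_preimage,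
        Set.mem_singleton_iff, Prod.ext_iff]
      rfl
    have hci : (c i : ℝ) = P.real (E i) := rfl
    rw [hset, hci]
    by_cases h0 : P (E i) = 0
    · rw [measureReal_def, h0, ENNReal.toReal_zero, zero_mul, measureReal_def,
        measure_mono_null Set.inter_subset_left h0, ENNReal.toReal_zero]
    · simp only [hΛ, if_neg h0]
      rw [map_measureReal_apply hZ (measurableSet_singleton w), measureReal_def (μ := P[|E i]),
        cond_apply (hEm i), ENNReal.toReal_mul, ENNReal.toReal_inv, ← measureReal_def,
        ← measureReal_def, ← mul_assoc, mul_inv_cancel₀, one_mul]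
      rwa [Ne, measureReal_eq_zero_iff]
  refine ⟨c, ΛW, ?_, hprob, ?_, ?_⟩
  · rw [← NNReal.coe_inj, NNReal.coe_sum, NNReal.coe_one]
    have := sum_real_inter (Q := P) (measurable_fst.comp hlm) MeasurableSet.univ.nullMeasurableSet
    rw [probReal_univ] at this
    rw [this]
    refine Finset.sum_congr rfl fun i _ => ?_
    rw [Set.univ_inter]
    rfl
  · intro i
    simp only [hΛ]
    split_ifs with h0
    · rw [Measure.dirac_apply' _ .of_discrete]
      simp [hw₀]
    · rw [Measure.map_apply hZ .of_discrete]
      have : F.zVar X ⁻¹' F.Wᶜ = ∅ := by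
        ext ω
        simp only [Set.mem_preimage, Set.mem_compl_iff, Set.mem_empty_iff_false, iff_false, not_not]
        exact F.label_mem ⟨w₀, hw₀⟩ (X 0 ω)
      rw [this, measure_empty]
  · intro k
    have hact := fun i : Fin F.p => act_prob
      (F.ηL.mconv ((Measure.dirac (F.γpow (k + (i : ℕ)))).mconv (uniformOn F.H))) (ΛW i)
    have hmapX := Measure.isProbabilityMeasure_map (μ := P) (h.measurable_X k).aemeasurable
    refine Measure.ext_of_singleton fun x => ?_
    rw [← ENNReal.toReal_eq_toReal_iff' (measure_ne_top _ _) (measure_ne_top _ _)]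
    change (P.map (X k)).real {x} = Measure.real _ {x}
    rw [sum_smul_real, map_measureReal_apply (h.measurable_X k) .of_discrete,
      F.sum_label h.measurable_X ((h.measurable_X k) .of_discrete).nullMeasurableSet,
      Fintype.sum_prod_type]
    refine Finset.sum_congr rfl fun i _ => ?_
    rw [act_real, Finset.mul_sum]
    refine Finset.sum_congr rfl fun w _ => ?_
    rw [F.real_inter_label h hr, F.ηL_mconv_real, ← mul_assoc, hjoint]

end Frame

end ActionEvolution

open ActionEvolution in
theorem mainTheorem4 {V : Type*} [Finite V] [Nonempty V] [MeasurableSpace V]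
    [DiscreteMeasurableSpace V] (μ : Measure (Function.End V)) [IsProbabilityMeasure μ] :
    Nonempty (Frame μ) ∧
    ∀ (F : Frame μ) {Ω : Type*} [MeasurableSpace Ω] (P : Measure Ω) [IsProbabilityMeasure P]
      (X : ℤ → Ω → Fin (minRank μ) → V) (N : ℤ → Ω → Function.End V),
      IsEvolution μ P X N →
      -- the component processes `X¹, …, X^{m_μ}` are a.s. distinct
      (∀ᵐ ω ∂P, Function.Injective (fun (i : Fin (minRank μ)) (k : ℤ) => X k ω i)) →
      -- the laws `Λ_k` live on distinct vectors and satisfy both equivalent conditions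
      (∀ k, ∀ᵐ ω ∂P, Function.Injective (X k ω)) ∧
      (∀ k, P.map (X k) = act μ (P.map (X (k - 1)))) ∧
      (∃ c ΛW, F.Represents c ΛW (fun k => P.map (X k))) ∧
      ∃ (Y : Ω → Function.End V) (U : ℤ → Ω → Function.End V) (Z : Ω → Fin (minRank μ) → V),
        Measurable Y ∧ (∀ k, Measurable (U k)) ∧ Measurable Z ∧
        (∀ ω, Y ω ∈ F.C) ∧ (∀ k ω, U k ω ∈ F.H) ∧ (∀ ω, Z ω ∈ F.W) ∧
        -- (i)
        (∀ k, ∀ᵐ ω ∂P, X k ω ∈ F.prodMap '' F.box) ∧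
        (∀ k, P.map (fun ω => F.xL (X k ω)) = F.ηL) ∧
        -- (ii)
        (∀ k, ∀ᵐ ω ∂P, F.xG (X k ω) = (F.γpow k * Y ω) * U k ω) ∧
        (∀ k, P.map (U k) = uniformOn F.H) ∧
        -- (iii)
        (∀ k, ∀ᵐ ω ∂P, F.xW (X k ω) = Z ω) ∧
        -- (iv)
        (∀ (j : ℤ) (n : ℕ), ∀ᵐ ω ∂P, F.MG X (j + n) j ω = F.MGprod X j n ω) ∧
        (∀ j k, j ≤ k → ∀ᵐ ω ∂P, X j ω =
          (F.xL (X j ω) * F.inv (F.MG X k j ω) * (F.γpow k * Y ω) * U k ω) • Z ω) ∧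
        -- (v)
        (∀ k, EqAE P (past X k)
          (F.reducedNoise X k ⊔ remotePast X ⊔ MeasurableSpace.comap (U k) inferInstance)) ∧
        (∀ k, SubAE P (F.reducedNoise X k) (past N k)) ∧
        (∀ k, iIndep ![past N k, remotePast X, MeasurableSpace.comap (U k) inferInstance] P) ∧
        EqAE P (remotePast X)
          (MeasurableSpace.comap Y inferInstance ⊔ MeasurableSpace.comap Z inferInstance) ∧
        -- the joint law of `Y_C` and `Z_W`
        (∀ c ΛW, F.Represents c ΛW (fun k => P.map (X k)) →
          ∀ (i : Fin F.p), ∀ w ∈ F.W,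
            P {ω | Y ω = F.γpow (i : ℕ) ∧ Z ω = w} = c i * ΛW i {w}) := by
  refine ⟨frame_nonempty μ, fun F Ω _ P _ X N h hX => ?_⟩
  have hr := F.ae_regular h hX
  refine ⟨fun k => ?_, h.map_eq_act, F.exists_represents h hr, F.yVar X, F.uVar X, F.zVar X,
    F.measurable_yVar h.measurable_X, F.measurable_uVar h.measurable_X,
    F.measurable_zVar h.measurable_X, fun ω => F.cosetRep_mem_C _, F.uVar_mem X,
    fun ω => F.label_mem (F.nonempty_W hr) (X 0 ω), fun k => ?_, F.map_xL h hr, fun k => ?_,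
    F.map_uVar h hr, fun k => ?_, fun j n => ?_, fun j k _ => ?_, F.eqAE_past h hr,
    F.subAE_reducedNoise h hr, F.iIndep_past_remotePast h hr, F.eqAE_remotePast h hr,
    fun c ΛW hrep i w _ => ?_⟩
  · filter_upwards [hr] with ω r using F.injective_of_good (r.good k)
  · filter_upwards [hr] with ω r using r.good k
  · filter_upwards [hr] with ω r using r.xG_eq k
  · filter_upwards [hr] with ω r using r.zVar_eq k
  · filter_upwards [hr] with ω r using r.MG_eq_MGprod j n
  · filter_upwards [hr] with ω r using r.eq_smul_zVar j k
  · rw [← F.measure_label h hr hrep i w]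
    congr 1
    ext ω
    exact F.yVar_eq_iff
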